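/- **Theorem 5.8 (Galois theorem for differential schemes).** *Setting.* Let $S$ be a scheme. An $S$-differential scheme is an $S$-scheme $X$ with a derivation $\delta_X$ of $\mathcal O_X$ that vanishes on (the image of) $\mathcal O_S$; morphisms are $S$-morphisms commuting with the derivations. These form a category $\mathrm{DSch}_S$ with fibre products, and there is a functor $C:\mathrm{Sch}_{/S}\to\mathrm{DSch}_S$, $T\mapsto(T,0)$. The differential scheme $X$ *has a categorical scheme of leaves* if there is a universal arrow $\eta_X:X\to C(\pi_0(X))$ from $X$ to $C$. A *precategory* in a category is a diagram $C_2\to C_1\rightrightarrows C_0$ with maps $d_0,d_1:C_1\to C_0$, $n:C_0\to C_1$, $r_0,r_1,m:C_2\to C_1$ such that $d_0n=d_1n=\mathrm{id}$, $d_0r_1=d_1r_0$, $d_0m=d_0r_0$, $d_1m=d_1r_1$. For a contravariant pseudofunctor $\mathcal P$ to categories, a *$\mathcal P$-action* of a precategory is an object $P\in\mathcal P(C_0)$ with an isomorphism $\varphi:d_0^*P\cong d_1^*P$ such that $n^*\varphi=\mathrm{id}$ and $r_1^*\varphi\circ r_0^*\varphi=m^*\varphi$; morphisms are morphisms in $\mathcal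 P(C_0)$ compatible with the isomorphisms $\varphi$. Every $X\in\mathrm{DSch}_S$ gives a precategory $\mathbb X$ of $S$-schemes with $X_0=X$, $X_1=X\times\operatorname{Spec}\mathbb Z[\varepsilon]/(\varepsilon^2)$, $X_2=X\times\operatorname{Spec}\mathbb Z[\varepsilon_0,\varepsilon_1]/(\varepsilon_0^2,\varepsilon_0\varepsilon_1,\varepsilon_1^2)$, where $d_0$ is the projection, $d_1$ is given by $a\mapsto a+\varepsilon\delta_X(a)$, $n$ by $\varepsilon\mapsto0$, and $r_0,m,r_1$ are given by $\varepsilon\mapsto\varepsilon_0,\ \varepsilon_0+\varepsilon_1,\ \varepsilon_1$ together with, on $\mathcal O_X$, the inclusion for $r_0$ and $m$, and $a\mapsto a+\varepsilon_0\delta_X(a)$ for $r_1$. Let $\mathcal P:\mathrm{Sch}_{/S}^{\mathrm{op}}\to\mathrm{Cat}$ be a pseudofunctor, and let $\delta{\downarrow}\mathcal P:\mathrm{DSch}_S^{\mathrm{op}}\to\mathrm{Cat}$ be the pseudofunctor sending $X$ to the category of $\mathcal P$-actions of $\mathbb X$. If $X$ has a scheme of leaves, $C_X:\mathcal P(\pi_0(X))\to\delta{\downarrow}\mathcal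 P(X)$ sends $Q$ to $\eta_X^*Q$ with its canonical action. We say that $X$ is *$\mathcal P$-simple* if $\pi_0(X)$ exists, $X_1\rightrightarrows X_0\to\pi_0(X)$ is a coequaliser of $S$-schemes, and for every $Q\in\mathcal P(\pi_0(X))$ the diagram $\eta_1^*Q\rightrightarrows\eta_0^*Q\to Q$ (where $\eta_0=\eta_X$ and $\eta_1:X_1\to\pi_0(X)$ is the composite) is a coequaliser in the total category of $\mathcal P$. For $f:X\to Y$ in $\mathrm{DSch}_S$, let $\mathbb G_f$ be its kernel-pair groupoid $X\times_YX\times_YX\to X\times_YX\rightrightarrows X$. We call $f$ *of effective descent for $\delta{\downarrow}\mathcal P$* if the canonical functor from $\delta{\downarrow}\mathcal P(Y)$ to the category of $\delta{\downarrow}\mathcal P$-actions of $\mathbb G_f$ (descent data) is an equivalence. We call $f$ *pre-Picard–Vessiot for $\mathcal P$* if $X$ and $Y$ have schemes of leaves, $f$ is of effective descent for $\delta{\downarrow}\mathcal P$, and $X$, $X\times_YX$, $X\times_YX\times_YX$ are $\mathcal P$-simple. Then $\mathrm{Gal}[f]=\pi_0(\mathbb G_f)$ is a precategory in $\mathrm{Sch}_{/S}$.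 Let $\mathrm{Split}_C(f)$ be the full subcategory of $\delta{\downarrow}\mathcal P(Y)$ of the objects $A$ with $f^*A\cong C_X(Q)$ for some $Q\in\mathcal P(\pi_0(X))$. *Theorem, first part.* If $f$ is pre-Picard–Vessiot for $\mathcal P$, then $f$ induces an equivalence of categories $$E:\mathrm{Split}_C(f)\simeq\mathcal P^{\mathrm{Gal}[f]}$$ with the category of $\mathcal P$-actions of the precategory $\mathrm{Gal}[f]$. Here "induces" means that there are isomorphisms $\theta_A:C_X(E(A)_0)\cong f^*A$ in $\delta{\downarrow}\mathcal P(X)$, natural in $A$, where $E(A)_0\in\mathcal P(\pi_0(X))$ underlies $E(A)$, whose underlying morphisms in $\mathcal P(X)$ identify the action on $E(A)$, pulled back along $\eta:\mathbb G_f\to\mathrm{Gal}[f]$, with the canonical descent datum of $f^*A$. *Theorem, second part.* Let $\mathcal S$ be a full sub-pseudofunctor of the self-indexing of $\mathrm{Sch}_{/S}$, given by a class of morphisms of $S$-schemes that is stable under base change and composition, and let $U:\mathcal P\Rightarrow\mathcal S$ be a faithful pseudonatural transformation. A coequaliser $A\rightrightarrows B\to T$ of $S$-schemes is *$\mathcal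 S$-universal* if it remains a coequaliser after base change along every morphism $R\to T$ in $\mathcal S$. Assume that $\delta{\downarrow}U$ reflects coequalisers associated with $\mathcal S$-universal connected components: for every $Z\in\mathrm{DSch}_S$ with a scheme of leaves, every $A\in\delta{\downarrow}\mathcal P(Z)$, every $Q\in\mathcal P(\pi_0(Z))$ and every morphism $r:A_0\to Q$ over $\eta_Z$ in the total category of $\mathcal P$ that coequalises the two maps $A_1\rightrightarrows A_0$ of the action (where $A_1=d_0^*A_0$), if $U$ maps $A_1\rightrightarrows A_0\to Q$ to an $\mathcal S$-universal coequaliser of $S$-schemes, then $A_1\rightrightarrows A_0\to Q$ is a coequaliser in the total category of $\mathcal P$. Suppose that $f:X\to Y$ is *Picard–Vessiot for $U$*: $X$ and $Y$ have schemes of leaves, $f$ is of effective descent for $\delta{\downarrow}\mathcal P$, $X$ is $\mathcal S$-simple (that is, $X_1\rightrightarrows X_0\to\pi_0(X)$ is an $\mathcal S$-universal coequaliser), and $f$ is auto-split (that is, the underlying morphism of $f$ is in $\mathcal S$ and $X\times_YX\cong X\times_{C(\pi_0(X))}C(G)$ over $X$ for some $G\to\pi_0(X)$ in $\mathcal S$).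 Then $f$ is pre-Picard–Vessiot for $\mathcal P$, so that the equivalence of the first part holds, and $\mathrm{Gal}[f]$ is a groupoid in $\mathrm{Sch}_{/S}$. -/

import Mathlib

open CategoryTheory Limits Opposite AlgebraicGeometry

universe v₁ u₁ v w u

namespace DiffGalois

section Precategories

/-- An internal precategory in `C`: a diagram `C₂ ⟶ C₁ ⇉ C₀` with the face maps `r₀, m, r₁` and
`d₀, d₁` and the degeneracy `n` of a truncated category object. Neither composability of all pairs
nor associativity is required. -/
structure Precat (C : Type u₁) [Category.{v₁} C] where
  C₀ : C
  C₁ : C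
  C₂ : C
  d₀ : C₁ ⟶ C₀
  d₁ : C₁ ⟶ C₀
  n : C₀ ⟶ C₁
  r₀ : C₂ ⟶ C₁
  r₁ : C₂ ⟶ C₁
  m : C₂ ⟶ C₁
  n_d₀ : n ≫ d₀ = 𝟙 C₀
  n_d₁ : n ≫ d₁ = 𝟙 C₀
  r₁_d₀ : r₁ ≫ d₀ = r₀ ≫ d₁
  m_d₀ : m ≫ d₀ = r₀ ≫ d₀
  m_d₁ : m ≫ d₁ = r₁ ≫ d₁

namespace Precat

variable {C : Type u₁} [Category.{v₁} C]

/-- Morphisms of precategories: triples commuting with all structure maps. -/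
@[ext]
structure Hom (A B : Precat C) where
  f₀ : A.C₀ ⟶ B.C₀
  f₁ : A.C₁ ⟶ B.C₁
  f₂ : A.C₂ ⟶ B.C₂
  d₀ : A.d₀ ≫ f₀ = f₁ ≫ B.d₀
  d₁ : A.d₁ ≫ f₀ = f₁ ≫ B.d₁
  n : A.n ≫ f₁ = f₀ ≫ B.n
  r₀ : A.r₀ ≫ f₁ = f₂ ≫ B.r₀
  r₁ : A.r₁ ≫ f₁ = f₂ ≫ B.r₁
  m : A.m ≫ f₁ = f₂ ≫ B.m

@[simps]
instance : Category (Precat C) where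
  Hom := Hom
  id A := ⟨𝟙 _, 𝟙 _, 𝟙 _, by simp, by simp, by simp, by simp, by simp, by simp⟩
  comp f g := ⟨f.f₀ ≫ g.f₀, f.f₁ ≫ g.f₁, f.f₂ ≫ g.f₂,
    by rw [reassoc_of% f.d₀, g.d₀, Category.assoc], by rw [reassoc_of% f.d₁, g.d₁, Category.assoc],
    by rw [reassoc_of% f.n, g.n, Category.assoc], by rw [reassoc_of% f.r₀, g.r₀, Category.assoc],
    by rw [reassoc_of% f.r₁, g.r₁, Category.assoc], by rw [reassoc_of% f.m, g.m, Category.assoc]⟩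

end Precat
end Precategories

section Actions
open Pseudofunctor.LocallyDiscreteOpToCat

variable {C : Type u₁} [Category.{v₁} C] (F : Pseudofunctor (LocallyDiscrete Cᵒᵖ) Cat.{v, w})

lemma locComp {X Y Z : C} {f : Y ⟶ Z} {g : X ⟶ Y} {k : X ⟶ Z} (h : g ≫ f = k) :
    f.op.toLoc ≫ g.op.toLoc = k.op.toLoc := by
  subst h
  rfl

lemma locId {X : C} {p : X ⟶ X} (h : p = 𝟙 X) : p.op.toLoc = 𝟙 (LocallyDiscrete.mk (op X)) := by
  subst h
  rfl

/-- `F`-actions of a precategory `G`: an object of `F(C₀)` with an isomorphism `φ : d₀^* P ≅ d₁^* P`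
in `F(C₁)` such that `n^* φ = id` and `r₁^* φ ∘ r₀^* φ = m^* φ`. Here `pullHom φ g _ _` is `g^* φ`,
transported along the structure isomorphisms of the pseudofunctor `F`. -/
structure Action (G : Precat C) where
  obj : F.obj ⟨op G.C₀⟩
  iso : (F.map G.d₀.op.toLoc).toFunctor.obj obj ≅ (F.map G.d₁.op.toLoc).toFunctor.obj obj
  unit : pullHom iso.hom G.n (𝟙 _) (𝟙 _) G.n_d₀ G.n_d₁ = 𝟙 _
  cocycle : pullHom iso.hom G.r₀ (G.r₀ ≫ G.d₀) (G.r₀ ≫ G.d₁) rfl rfl ≫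
      pullHom iso.hom G.r₁ (G.r₀ ≫ G.d₁) (G.r₁ ≫ G.d₁) G.r₁_d₀ rfl =
    pullHom iso.hom G.m (G.r₀ ≫ G.d₀) (G.r₁ ≫ G.d₁) G.m_d₀ G.m_d₁

namespace Action

variable {F}

/-- Morphisms of actions: morphisms in `F(C₀)` commuting with the given isomorphisms. -/
@[ext]
structure Hom {G : Precat C} (A B : Action F G) where
  hom : A.obj ⟶ B.obj
  comm : (F.map G.d₀.op.toLoc).toFunctor.map hom ≫ B.iso.hom =
    A.iso.hom ≫ (F.map G.d₁.op.toLoc).toFunctor.map hom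

instance (G : Precat C) : Category (Action F G) where
  Hom := Hom
  id A := ⟨𝟙 _, by simp⟩
  comp f g := ⟨f.hom ≫ g.hom, by simp [g.comm, reassoc_of% f.comm]⟩

@[ext] lemma hom_ext {G : Precat C} {A B : Action F G} {f g : A ⟶ B} (h : f.hom = g.hom) : f = g :=
  Hom.ext h

@[simp] lemma id_hom {G : Precat C} (A : Action F G) : Hom.hom (𝟙 A) = 𝟙 A.obj := rfl
@[simp] lemma comp_hom {G : Precat C} {A B D : Action F G} (f : A ⟶ B) (g : B ⟶ D) :
    (f ≫ g).hom = f.hom ≫ g.hom := rfl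

/-- The underlying object of `F(C₀)`. -/
@[simps]
def forget (F : Pseudofunctor (LocallyDiscrete Cᵒᵖ) Cat.{v, w}) (G : Precat C) : Action F G ⥤ F.obj ⟨op G.C₀⟩ where
  obj A := A.obj
  map f := f.hom

/-- Isomorphisms of actions. -/
@[simps]
def isoMk {G : Precat C} {A B : Action F G} (e : A.obj ≅ B.obj)
    (h : (F.map G.d₀.op.toLoc).toFunctor.map e.hom ≫ B.iso.hom =
      A.iso.hom ≫ (F.map G.d₁.op.toLoc).toFunctor.map e.hom) : A ≅ B where
  hom := ⟨e.hom, h⟩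
  inv := ⟨e.inv, by
    rw [← cancel_mono ((F.map G.d₁.op.toLoc).toFunctor.map e.hom), Category.assoc, Category.assoc,
      ← h, ← Functor.map_comp_assoc]
    simp [← Functor.map_comp]⟩

/-- `pullHom` is functorial -/
lemma pullHom_comp ⦃X₁ X₂ X₃ : C⦄ ⦃M₁ : F.obj ⟨op X₁⟩⦄ ⦃M₂ : F.obj ⟨op X₂⟩⦄ ⦃M₃ : F.obj ⟨op X₃⟩⦄
    ⦃Y : C⦄ ⦃f₁ : Y ⟶ X₁⦄ ⦃f₂ : Y ⟶ X₂⦄ ⦃f₃ : Y ⟶ X₃⦄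
    (φ : (F.map f₁.op.toLoc).toFunctor.obj M₁ ⟶ (F.map f₂.op.toLoc).toFunctor.obj M₂)
    (ψ : (F.map f₂.op.toLoc).toFunctor.obj M₂ ⟶ (F.map f₃.op.toLoc).toFunctor.obj M₃) ⦃Y' : C⦄
    (g : Y' ⟶ Y) (gf₁ : Y' ⟶ X₁) (gf₂ : Y' ⟶ X₂) (gf₃ : Y' ⟶ X₃) (h₁ : g ≫ f₁ = gf₁)
    (h₂ : g ≫ f₂ = gf₂) (h₃ : g ≫ f₃ = gf₃) :
    pullHom φ g gf₁ gf₂ h₁ h₂ ≫ pullHom ψ g gf₂ gf₃ h₂ h₃ =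
      pullHom (φ ≫ ψ) g gf₁ gf₃ h₁ h₃ := by
  simp [pullHom]

/-- `pullHom` of a conjugate -/
lemma pullHom_conj ⦃X₁ X₂ Z₁ Z₂ : C⦄ (p₁ : Z₁ ⟶ X₁) (p₂ : Z₂ ⟶ X₂) (M₁ : F.obj ⟨op X₁⟩)
    (M₂ : F.obj ⟨op X₂⟩) ⦃Y : C⦄ (a₁ : Y ⟶ Z₁) (a₂ : Y ⟶ Z₂) (f₁ : Y ⟶ X₁) (f₂ : Y ⟶ X₂)
    (h₁ : a₁ ≫ p₁ = f₁) (h₂ : a₂ ≫ p₂ = f₂)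
    (φ : (F.map f₁.op.toLoc).toFunctor.obj M₁ ⟶ (F.map f₂.op.toLoc).toFunctor.obj M₂) ⦃Y' : C⦄
    (t : Y' ⟶ Y) (ta₁ : Y' ⟶ Z₁) (ta₂ : Y' ⟶ Z₂) (tf₁ : Y' ⟶ X₁) (tf₂ : Y' ⟶ X₂)
    (ha₁ : t ≫ a₁ = ta₁) (ha₂ : t ≫ a₂ = ta₂) (hf₁ : t ≫ f₁ = tf₁) (hf₂ : t ≫ f₂ = tf₂) :
    pullHom (M₁ := (F.map p₁.op.toLoc).toFunctor.obj M₁)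
      (M₂ := (F.map p₂.op.toLoc).toFunctor.obj M₂)
      ((F.mapComp' p₁.op.toLoc a₁.op.toLoc f₁.op.toLoc (locComp h₁)).inv.toNatTrans.app M₁ ≫
        φ ≫ (F.mapComp' p₂.op.toLoc a₂.op.toLoc f₂.op.toLoc
          (locComp h₂)).hom.toNatTrans.app M₂) t ta₁ ta₂ ha₁ ha₂ =
      (F.mapComp' p₁.op.toLoc ta₁.op.toLoc tf₁.op.toLoc
        (locComp (by rw [← ha₁, Category.assoc, h₁, hf₁]))).inv.toNatTrans.app M₁ ≫
        pullHom φ t tf₁ tf₂ hf₁ hf₂ ≫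
        (F.mapComp' p₂.op.toLoc ta₂.op.toLoc tf₂.op.toLoc
          (locComp (by rw [← ha₂, Category.assoc, h₂, hf₂]))).hom.toNatTrans.app M₂ := by
  dsimp only [pullHom]
  simp only [Functor.map_comp, Category.assoc]
  rw [F.mapComp'₀₁₃_inv_comp_mapComp'₀₂₃_hom_app_assoc p₁.op.toLoc a₁.op.toLoc t.op.toLoc
      f₁.op.toLoc ta₁.op.toLoc tf₁.op.toLoc (locComp h₁) (locComp ha₁)
      (locComp (by rw [← ha₁, Category.assoc, h₁, hf₁])),
    F.mapComp'₀₂₃_inv_comp_mapComp'₀₁₃_hom_app p₂.op.toLoc a₂.op.toLoc t.op.toLoc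
      f₂.op.toLoc ta₂.op.toLoc tf₂.op.toLoc (locComp h₂) (locComp ha₂) (locComp hf₂)]

/-- The isomorphism of the pullback `g^* P` of an action along `g : A ⟶ B`: it is `g₁^*` of the
isomorphism of `P`. -/
def pullIso {A B : Precat C} (g : A ⟶ B) (P : Action F B) :
    (F.map A.d₀.op.toLoc).toFunctor.obj ((F.map g.f₀.op.toLoc).toFunctor.obj P.obj) ≅
      (F.map A.d₁.op.toLoc).toFunctor.obj ((F.map g.f₀.op.toLoc).toFunctor.obj P.obj) :=
  ((Cat.Hom.toNatIso (F.mapComp' g.f₀.op.toLoc A.d₀.op.toLoc (A.d₀ ≫ g.f₀).op.toLoc (locComp rfl))).app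
      P.obj).symm ≪≫
    ((Cat.Hom.toNatIso (F.mapComp' B.d₀.op.toLoc g.f₁.op.toLoc (A.d₀ ≫ g.f₀).op.toLoc
      (locComp g.d₀.symm))).app P.obj) ≪≫ (F.map g.f₁.op.toLoc).toFunctor.mapIso P.iso ≪≫
    ((Cat.Hom.toNatIso (F.mapComp' B.d₁.op.toLoc g.f₁.op.toLoc (A.d₁ ≫ g.f₀).op.toLoc
      (locComp g.d₁.symm))).app P.obj).symm ≪≫
    ((Cat.Hom.toNatIso (F.mapComp' g.f₀.op.toLoc A.d₁.op.toLoc (A.d₁ ≫ g.f₀).op.toLoc (locComp rfl))).app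
      P.obj)

lemma pullIso_hom {A B : Precat C} (g : A ⟶ B) (P : Action F B) :
    (pullIso g P).hom =
      (F.mapComp' g.f₀.op.toLoc A.d₀.op.toLoc (A.d₀ ≫ g.f₀).op.toLoc (locComp rfl)).inv.toNatTrans.app P.obj ≫
        pullHom P.iso.hom g.f₁ (A.d₀ ≫ g.f₀) (A.d₁ ≫ g.f₀) g.d₀.symm g.d₁.symm ≫
      (F.mapComp' g.f₀.op.toLoc A.d₁.op.toLoc (A.d₁ ≫ g.f₀).op.toLoc (locComp rfl)).hom.toNatTrans.app
        P.obj := by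
  simp [pullIso, pullHom]

lemma pullHom_pullIso {A B : Precat C} (g : A ⟶ B) (P : Action F B) {T : C} (t : T ⟶ A.C₁)
    (a b : T ⟶ A.C₀) (a' b' : T ⟶ B.C₀) (ha : t ≫ A.d₀ = a) (hb : t ≫ A.d₁ = b)
    (ha' : a ≫ g.f₀ = a') (hb' : b ≫ g.f₀ = b') :
    pullHom (pullIso g P).hom t a b ha hb =
      (F.mapComp' g.f₀.op.toLoc a.op.toLoc a'.op.toLoc
        (locComp ha')).inv.toNatTrans.app P.obj ≫
        pullHom P.iso.hom (t ≫ g.f₁) a' b'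
          (by rw [Category.assoc, ← g.d₀, reassoc_of% ha, ha'])
          (by rw [Category.assoc, ← g.d₁, reassoc_of% hb, hb']) ≫
      (F.mapComp' g.f₀.op.toLoc b.op.toLoc b'.op.toLoc
        (locComp hb')).hom.toNatTrans.app P.obj := by
  rw [pullIso_hom, pullHom_conj (hf₁ := by rw [reassoc_of% ha, ha'])
    (hf₂ := by rw [reassoc_of% hb, hb']) (h₁ := rfl) (h₂ := rfl), pullHom_pullHom]

lemma pullHom_congr ⦃X₁ X₂ : C⦄ ⦃M₁ : F.obj ⟨op X₁⟩⦄ ⦃M₂ : F.obj ⟨op X₂⟩⦄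
    ⦃Y : C⦄ ⦃f₁ : Y ⟶ X₁⦄ ⦃f₂ : Y ⟶ X₂⦄
    (φ : (F.map f₁.op.toLoc).toFunctor.obj M₁ ⟶ (F.map f₂.op.toLoc).toFunctor.obj M₂) ⦃Y' : C⦄
    {g g' : Y' ⟶ Y} (h : g = g') (gf₁ : Y' ⟶ X₁) (gf₂ : Y' ⟶ X₂) (h₁ : g ≫ f₁ = gf₁)
    (h₂ : g ≫ f₂ = gf₂) :
    pullHom φ g gf₁ gf₂ h₁ h₂ = pullHom φ g' gf₁ gf₂ (h ▸ h₁) (h ▸ h₂) := by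
  subst h; rfl

lemma pullHom_one ⦃X₁ : C⦄ ⦃M₁ : F.obj ⟨op X₁⟩⦄
    ⦃Y : C⦄ ⦃f₁ : Y ⟶ X₁⦄ ⦃Y' : C⦄
    (g : Y' ⟶ Y) (gf₁ : Y' ⟶ X₁) (h₁ : g ≫ f₁ = gf₁) :
    pullHom (𝟙 ((F.map f₁.op.toLoc).toFunctor.obj M₁)) g gf₁ gf₁ h₁ h₁ = 𝟙 _ := by
  simp [pullHom]

/-- The pullback `g^* P` of an action along a morphism of precategories. -/
def pullObj {A B : Precat C} (g : A ⟶ B) (P : Action F B) : Action F A where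
  obj := (F.map g.f₀.op.toLoc).toFunctor.obj P.obj
  iso := pullIso g P
  unit := by
    rw [pullHom_pullIso g P A.n (𝟙 _) (𝟙 _) g.f₀ g.f₀ A.n_d₀ A.n_d₁ (by simp) (by simp),
      pullHom_congr _ g.n, ← pullHom_pullHom _ _ (𝟙 _) (𝟙 _) _ _ _ B.n_d₀ B.n_d₁ (by simp) (by simp),
      P.unit, pullHom_one]
    · simp
  cocycle := by
    rw [pullHom_pullIso g P _ _ _ (A.r₀ ≫ A.d₀ ≫ g.f₀) (A.r₀ ≫ A.d₁ ≫ g.f₀) _ _ (by simp) (by simp),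
      pullHom_pullIso g P _ _ _ (A.r₀ ≫ A.d₁ ≫ g.f₀) (A.r₁ ≫ A.d₁ ≫ g.f₀) _ _ (by simp) (by simp),
      pullHom_pullIso g P _ _ _ (A.r₀ ≫ A.d₀ ≫ g.f₀) (A.r₁ ≫ A.d₁ ≫ g.f₀) _ _ (by simp) (by simp)]
    have e₀ : A.r₀ ≫ A.d₀ ≫ g.f₀ = g.f₂ ≫ B.r₀ ≫ B.d₀ := by
      rw [g.d₀, reassoc_of% g.r₀]
    have e₁ : A.r₀ ≫ A.d₁ ≫ g.f₀ = g.f₂ ≫ B.r₀ ≫ B.d₁ := by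
      rw [g.d₁, reassoc_of% g.r₀]
    have e₂ : A.r₁ ≫ A.d₁ ≫ g.f₀ = g.f₂ ≫ B.r₁ ≫ B.d₁ := by
      rw [g.d₁, reassoc_of% g.r₁]
    rw [pullHom_congr _ g.r₀, pullHom_congr _ g.r₁, pullHom_congr _ g.m,
      ← pullHom_pullHom _ B.r₀ (B.r₀ ≫ B.d₀) (B.r₀ ≫ B.d₁) g.f₂ _ _ rfl rfl e₀.symm e₁.symm,
      ← pullHom_pullHom _ B.r₁ (B.r₀ ≫ B.d₁) (B.r₁ ≫ B.d₁) g.f₂ _ _ B.r₁_d₀ rfl e₁.symm e₂.symm,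
      ← pullHom_pullHom _ B.m (B.r₀ ≫ B.d₀) (B.r₁ ≫ B.d₁) g.f₂ _ _ B.m_d₀ B.m_d₁ e₀.symm e₂.symm,
      ← P.cocycle, ← pullHom_comp (h₂ := e₁.symm)]
    simp only [Category.assoc, Cat.Hom.hom_inv_id_toNatTrans_app_assoc]

lemma pullIso_hom' {A B : Precat C} (g : A ⟶ B) (P : Action F B) (a' b' : A.C₁ ⟶ B.C₀)
    (ha : A.d₀ ≫ g.f₀ = a') (hb : A.d₁ ≫ g.f₀ = b') :
    (pullIso g P).hom =
      (F.mapComp' g.f₀.op.toLoc A.d₀.op.toLoc a'.op.toLoc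
        (locComp ha)).inv.toNatTrans.app P.obj ≫
        pullHom P.iso.hom g.f₁ a' b' (ha ▸ g.d₀.symm) (hb ▸ g.d₁.symm) ≫
      (F.mapComp' g.f₀.op.toLoc A.d₁.op.toLoc b'.op.toLoc
        (locComp hb)).hom.toNatTrans.app P.obj := by
  subst ha hb
  exact pullIso_hom g P

lemma Hom.pullHom_comm {A : Precat C} {P Q : Action F A} (f : P ⟶ Q) {T : C} (t : T ⟶ A.C₁)
    (a b : T ⟶ A.C₀) (ha : t ≫ A.d₀ = a) (hb : t ≫ A.d₁ = b) :
    (F.map a.op.toLoc).toFunctor.map (Hom.hom f) ≫ pullHom Q.iso.hom t a b ha hb =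
      pullHom P.iso.hom t a b ha hb ≫ (F.map b.op.toLoc).toFunctor.map (Hom.hom f) := by
  simp only [pullHom, Category.assoc]
  rw [F.mapComp'_hom_naturality_assoc, ← F.mapComp'_inv_naturality, ← Functor.map_comp_assoc,
    Hom.comm, Functor.map_comp_assoc]

lemma pullIso_naturality {A B : Precat C} (g : A ⟶ B) {P Q : Action F B} (f : P ⟶ Q) :
    (F.map A.d₀.op.toLoc).toFunctor.map ((F.map g.f₀.op.toLoc).toFunctor.map (Hom.hom f)) ≫
      (pullIso g Q).hom = (pullIso g P).hom ≫
    (F.map A.d₁.op.toLoc).toFunctor.map ((F.map g.f₀.op.toLoc).toFunctor.map (Hom.hom f)) := by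
  rw [pullIso_hom, pullIso_hom, F.mapComp'_inv_naturality_assoc,
    reassoc_of% (Hom.pullHom_comm f), Category.assoc, Category.assoc, F.mapComp'_hom_naturality]

lemma mapId'_compat' {X Y : LocallyDiscrete Cᵒᵖ} (p : X ⟶ X) (hp : p = 𝟙 X) (a : X ⟶ Y)
    (M : F.obj X) :
    (F.mapComp' p a a (by rw [hp, Category.id_comp])).inv.toNatTrans.app M =
      (F.map a).toFunctor.map ((F.mapId' p hp).hom.toNatTrans.app M) := by
  subst hp
  refine (F.mapComp'_id_comp_inv_app a M).trans ?_
  rw [Pseudofunctor.mapId'_eq_mapId]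

lemma mapId'_compat {X Y : C} (p : X ⟶ X) (hp : p = 𝟙 X) (a : Y ⟶ X) (M : F.obj ⟨op X⟩) :
    (F.mapComp' p.op.toLoc a.op.toLoc a.op.toLoc
      (locComp (by rw [hp, Category.comp_id]))).inv.toNatTrans.app M =
      (F.map a.op.toLoc).toFunctor.map ((F.mapId' p.op.toLoc (locId hp)).hom.toNatTrans.app M) :=
  mapId'_compat' _ _ _ _

lemma pullIso_id {A : Precat C} (g : A ⟶ A) (hg : g = 𝟙 A) (P : Action F A) :
    (F.map A.d₀.op.toLoc).toFunctor.map
        ((F.mapId' g.f₀.op.toLoc (locId (by subst hg; rfl))).hom.toNatTrans.app P.obj) ≫ P.iso.hom =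
      (pullIso g P).hom ≫ (F.map A.d₁.op.toLoc).toFunctor.map
        ((F.mapId' g.f₀.op.toLoc (locId (by subst hg; rfl))).hom.toNatTrans.app P.obj) := by
  have h₀ : g.f₀ = 𝟙 _ := by subst hg; rfl
  have h₁ : g.f₁ = 𝟙 _ := by subst hg; rfl
  rw [pullIso_hom' g P A.d₀ A.d₁ (by simp [h₀]) (by simp [h₀]), ← mapId'_compat _ h₀,
    ← mapId'_compat _ h₀, pullHom_congr _ h₁, pullHom_id]
  simp

lemma pullIso_comp_aux {D : Type*} [Category* D] {x₁ x₂ x₃ x₄ x₅ x₆ x₇ x₈ : D} {α : x₁ ⟶ x₂}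
    {β : x₂ ⟶ x₃} {K : x₃ ⟶ x₄} {γ : x₄ ⟶ x₅} {b : x₁ ⟶ x₆} {κ : x₆ ⟶ x₇} {c : x₇ ⟶ x₈}
    {δ : x₈ ≅ x₅} {b' : x₆ ≅ x₃} {c' : x₇ ≅ x₄} (key : K = b'.inv ≫ κ ≫ c'.hom)
    (e₀ : b ≫ b'.hom = α ≫ β) (e₁ : c'.inv ≫ c = γ ≫ δ.inv) :
    α ≫ β ≫ K ≫ γ = (b ≫ κ ≫ c) ≫ δ.hom := by
  rw [Iso.inv_comp_eq] at e₁
  subst e₁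
  rw [← reassoc_of% e₀, key]
  simp

lemma pullIso_comp {A B D : Precat C} (g : A ⟶ B) (h : B ⟶ D) (k : A ⟶ D) (hk : g ≫ h = k)
    (P : Action F D) :
    (F.map A.d₀.op.toLoc).toFunctor.map ((F.mapComp' h.f₀.op.toLoc g.f₀.op.toLoc
      k.f₀.op.toLoc (locComp (by subst hk; rfl))).hom.toNatTrans.app P.obj) ≫
        (pullIso g (pullObj h P)).hom =
      (pullIso k P).hom ≫ (F.map A.d₁.op.toLoc).toFunctor.map ((F.mapComp' h.f₀.op.toLoc
        g.f₀.op.toLoc k.f₀.op.toLoc (locComp (by subst hk; rfl))).hom.toNatTrans.app P.obj) := by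
  have h₀ : g.f₀ ≫ h.f₀ = k.f₀ := by subst hk; rfl
  have h₁ : g.f₁ ≫ h.f₁ = k.f₁ := by subst hk; rfl
  have key := pullHom_pullIso h P g.f₁ (A.d₀ ≫ g.f₀) (A.d₁ ≫ g.f₀) (A.d₀ ≫ k.f₀) (A.d₁ ≫ k.f₀)
    g.d₀.symm g.d₁.symm (by rw [Category.assoc, h₀]) (by rw [Category.assoc, h₀])
  rw [pullHom_congr _ h₁] at key
  have e₀ := F.mapComp'₀₂₃_inv_comp_mapComp'₀₁₃_hom_app h.f₀.op.toLoc g.f₀.op.toLoc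
    A.d₀.op.toLoc k.f₀.op.toLoc (A.d₀ ≫ g.f₀).op.toLoc (A.d₀ ≫ k.f₀).op.toLoc (locComp h₀)
    (locComp rfl) (locComp rfl) P.obj
  have e₁ := F.mapComp'₀₁₃_inv_comp_mapComp'₀₂₃_hom_app h.f₀.op.toLoc g.f₀.op.toLoc
    A.d₁.op.toLoc k.f₀.op.toLoc (A.d₁ ≫ g.f₀).op.toLoc (A.d₁ ≫ k.f₀).op.toLoc (locComp h₀)
    (locComp rfl) (locComp (by rw [Category.assoc, h₀])) P.obj
  rw [pullIso_hom k P, pullIso_hom g (pullObj h P)]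
  exact pullIso_comp_aux
    (b' := (Cat.Hom.toNatIso (F.mapComp' _ _ _ (locComp (by rw [Category.assoc, h₀])))).app P.obj)
    (c' := (Cat.Hom.toNatIso (F.mapComp' _ _ _ (locComp (by rw [Category.assoc, h₀])))).app P.obj)
    (δ := (F.map _).toFunctor.mapIso
      ((Cat.Hom.toNatIso (F.mapComp' _ _ _ (locComp h₀))).app P.obj)) key e₀ e₁

/-- The pullback of actions along a morphism of precategories. -/
@[simps]
def pull (F : Pseudofunctor (LocallyDiscrete Cᵒᵖ) Cat.{v, w}) {A B : Precat C} (g : A ⟶ B) :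
    Action F B ⥤ Action F A where
  obj P := pullObj g P
  map {P Q} f := ⟨(F.map g.f₀.op.toLoc).toFunctor.map (Hom.hom f), pullIso_naturality g f⟩
  map_id P := by ext; exact CategoryTheory.Functor.map_id _ _
  map_comp f g := by ext; exact Functor.map_comp _ _ _

/-- Pullback along the identity. -/
def pullId {A : Precat C} (g : A ⟶ A) (hg : g = 𝟙 A) : pull F g ≅ 𝟭 (Action F A) :=
  NatIso.ofComponents (fun P => isoMk ((Cat.Hom.toNatIso (F.mapId' g.f₀.op.toLoc
    (locId (by subst hg; rfl)))).app P.obj) (pullIso_id g hg P))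
    (fun f => hom_ext (F.mapId'_hom_naturality _ (locId (by subst hg; rfl)) _))

/-- Pullback along a composite. -/
def pullComp {A B D : Precat C} (g : A ⟶ B) (h : B ⟶ D) (k : A ⟶ D) (hk : g ≫ h = k) :
    pull F k ≅ pull F h ⋙ pull F g :=
  NatIso.ofComponents (fun P => isoMk ((Cat.Hom.toNatIso (F.mapComp' h.f₀.op.toLoc g.f₀.op.toLoc
      k.f₀.op.toLoc (locComp (by subst hk; rfl)))).app P.obj) (pullIso_comp g h k hk P))
    (fun f => hom_ext (F.mapComp'_hom_naturality _ _ _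
      (locComp (by subst hk; rfl)) _))

@[simp] lemma eqToHom_app_hom {A B : Precat C} {K K' : Action F B ⥤ Action F A} (h : K = K')
    (P : Action F B) : Hom.hom ((eqToHom h).app P) = eqToHom (by rw [h]) := by
  subst h
  rfl

lemma pull_assoc {A B D E : Precat C} (f : D ⟶ E) (g : B ⟶ D) (h : A ⟶ B) (gf : B ⟶ E)
    (hg : A ⟶ D) (k k' : A ⟶ E) (h₁ : g ≫ f = gf) (h₂ : h ≫ g = hg) (h₃ : h ≫ gf = k)
    (h₄ : hg ≫ f = k') (hk : pull F k = pull F k') :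
    (pullComp h gf k h₃).hom ≫ Functor.whiskerRight (pullComp g f gf h₁).hom (pull F h) ≫
      (Functor.associator _ _ _).hom ≫ Functor.whiskerLeft _ (pullComp h g hg h₂).inv ≫
      (pullComp hg f k' h₄).inv = eqToHom hk := by
  obtain rfl : k = k' := by rw [← h₃, ← h₄, ← h₁, ← h₂, Category.assoc]
  ext P
  have := F.mapComp'₀₂₃_hom_comp_mapComp'_hom_whiskerRight_app f.f₀.op.toLoc g.f₀.op.toLoc
    h.f₀.op.toLoc gf.f₀.op.toLoc hg.f₀.op.toLoc k.f₀.op.toLoc (locComp (by subst h₁; rfl))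
    (locComp (by subst h₂; rfl)) (locComp (by subst h₃; rfl)) P.obj
  simp only [eqToHom_refl]
  refine (Category.assoc _ _ _).symm.trans ?_
  change (((F.mapComp' gf.f₀.op.toLoc h.f₀.op.toLoc k.f₀.op.toLoc
      (locComp (by subst h₃; rfl))).hom.toNatTrans.app P.obj) ≫ (F.map h.f₀.op.toLoc).toFunctor.map
      ((F.mapComp' f.f₀.op.toLoc g.f₀.op.toLoc gf.f₀.op.toLoc
        (locComp (by subst h₁; rfl))).hom.toNatTrans.app P.obj)) ≫ 𝟙 _ ≫
      ((F.mapComp' g.f₀.op.toLoc h.f₀.op.toLoc hg.f₀.op.toLoc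
        (locComp (by subst h₂; rfl))).inv.toNatTrans.app ((F.map f.f₀.op.toLoc).toFunctor.obj P.obj)) ≫
      (F.mapComp' f.f₀.op.toLoc hg.f₀.op.toLoc k.f₀.op.toLoc
      (locComp (by subst h₄; rfl))).inv.toNatTrans.app P.obj = 𝟙 _
  rw [this]
  simp only [Category.assoc, Category.id_comp, Cat.Hom.hom_inv_id_toNatTrans_app_assoc,
    Cat.Hom.hom_inv_id_toNatTrans_app]

lemma pull_left_unit {A B : Precat C} (f : A ⟶ B) (i : B ⟶ B) (k : A ⟶ B) (hi : i = 𝟙 B)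
    (hk : f ≫ i = k) (h : pull F k = pull F f) :
    (pullComp f i k hk).hom ≫ Functor.whiskerRight (pullId i hi).hom (pull F f) ≫
      (Functor.leftUnitor _).hom = eqToHom h := by
  obtain rfl : f = k := by rw [← hk, hi, Category.comp_id]
  ext P
  simp only [eqToHom_refl]
  have := mapId'_compat (F := F) i.f₀ (by subst hi; rfl) f.f₀ P.obj
  change ((F.mapComp' i.f₀.op.toLoc f.f₀.op.toLoc f.f₀.op.toLoc
      (locComp (by subst hi; exact Category.comp_id _))).hom.toNatTrans.app P.obj) ≫
      (F.map f.f₀.op.toLoc).toFunctor.map ((F.mapId' i.f₀.op.toLoc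
        (locId (by subst hi; rfl))).hom.toNatTrans.app P.obj) ≫ 𝟙 _ = 𝟙 _
  rw [← this]
  exact (congrArg _ (Category.comp_id _)).trans (Cat.Hom.hom_inv_id_toNatTrans_app _ _)

lemma mapId'_compat_right' {X Y : LocallyDiscrete Cᵒᵖ} (p : Y ⟶ Y) (hp : p = 𝟙 Y) (a : X ⟶ Y)
    (M : F.obj X) :
    (F.mapComp' a p a (by rw [hp, Category.comp_id])).inv.toNatTrans.app M =
      ((F.mapId' p hp).hom.toNatTrans.app ((F.map a).toFunctor.obj M)) := by
  subst hp
  refine (F.mapComp'_comp_id_inv_app a M).trans ?_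
  rw [Pseudofunctor.mapId'_eq_mapId]

lemma pull_right_unit {A B : Precat C} (f : A ⟶ B) (i : A ⟶ A) (k : A ⟶ B) (hi : i = 𝟙 A)
    (hk : i ≫ f = k) (h : pull F k = pull F f) :
    (pullComp i f k hk).hom ≫ Functor.whiskerLeft (pull F f) (pullId i hi).hom ≫
      (Functor.rightUnitor _).hom = eqToHom h := by
  obtain rfl : f = k := by rw [← hk, hi, Category.id_comp]
  ext P
  simp only [eqToHom_refl]
  have := mapId'_compat_right' (F := F) i.f₀.op.toLoc (locId (by subst hi; rfl)) f.f₀.op.toLoc P.obj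
  change ((F.mapComp' f.f₀.op.toLoc i.f₀.op.toLoc f.f₀.op.toLoc
      (locComp (by subst hi; exact Category.id_comp _))).hom.toNatTrans.app P.obj) ≫
      (F.mapId' i.f₀.op.toLoc (locId (by subst hi; rfl))).hom.toNatTrans.app
        ((F.map f.f₀.op.toLoc).toFunctor.obj P.obj) ≫ 𝟙 _ = 𝟙 _
  rw [← this]
  exact (congrArg _ (Category.comp_id _)).trans (Cat.Hom.hom_inv_id_toNatTrans_app _ _)

lemma eqToHom_natTrans {A B : Type w} [Category.{v} A] [Category.{v} B] {F G : A ⥤ B}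
    (h : F.toCatHom = G.toCatHom) (h' : F = G) : eqToHom h' = (eqToHom h).toNatTrans := by
  subst h'
  rfl

open Bicategory in
/-- The pseudofunctor `X ↦ F^(G(X))` of `F`-actions of the precategories `G(X)`. -/
def actions {D : Type*} [Category* D] (G : D ⥤ Precat C) :
    Pseudofunctor (LocallyDiscrete Dᵒᵖ) Cat :=
  LocallyDiscrete.mkPseudofunctor
    (fun X ↦ Cat.of (Action F (G.obj X.unop)))
    (fun f ↦ (pull F (G.map f.unop)).toCatHom)
    (fun X ↦ Cat.Hom.isoMk <| pullId _ (G.map_id _))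
    (fun f g ↦ Cat.Hom.isoMk <| pullComp _ _ _ (G.map_comp g.unop f.unop).symm)
    (fun f g h ↦ by
      ext1
      refine (pull_assoc _ _ _ _ _ _ _ (G.map_comp _ _).symm (G.map_comp _ _).symm
        (G.map_comp _ _).symm (G.map_comp _ _).symm (by simp)).trans ?_
      exact eqToHom_natTrans _ _)
    (fun f ↦ by
      ext1
      refine (pull_left_unit _ _ _ (G.map_id _) (G.map_comp _ _).symm (by simp)).trans ?_
      exact eqToHom_natTrans _ _)
    (fun f ↦ by
      ext1
      refine (pull_right_unit _ _ _ (G.map_id _) (G.map_comp _ _).symm (by simp)).trans ?_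
      exact eqToHom_natTrans _ _)

section augment

variable (F)

/-- The canonical isomorphism `d₀^* c^* M ≅ d₁^* c^* M` when `d₀ ≫ c = d₁ ≫ c`. -/
def descentIso {Y₀ Y₁ T : C} {d₀ d₁ : Y₁ ⟶ Y₀} (c : Y₀ ⟶ T) (hc : d₀ ≫ c = d₁ ≫ c)
    (M : F.obj ⟨op T⟩) :
    (F.map d₀.op.toLoc).toFunctor.obj ((F.map c.op.toLoc).toFunctor.obj M) ≅
      (F.map d₁.op.toLoc).toFunctor.obj ((F.map c.op.toLoc).toFunctor.obj M) :=
  ((Cat.Hom.toNatIso (F.mapComp' c.op.toLoc d₀.op.toLoc (d₀ ≫ c).op.toLoc (locComp rfl))).app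
      M).symm ≪≫
    ((Cat.Hom.toNatIso (F.mapComp' c.op.toLoc d₁.op.toLoc (d₀ ≫ c).op.toLoc
      (locComp hc.symm))).app M)

lemma pullHom_descentIso {Y₀ Y₁ T : C} {d₀ d₁ : Y₁ ⟶ Y₀} (c : Y₀ ⟶ T) (hc : d₀ ≫ c = d₁ ≫ c)
    (M : F.obj ⟨op T⟩) {Z : C} (t : Z ⟶ Y₁) (a b : Z ⟶ Y₀) (k : Z ⟶ T) (ha : t ≫ d₀ = a)
    (hb : t ≫ d₁ = b) (hk : a ≫ c = k) (hk' : b ≫ c = k) :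
    pullHom (descentIso F c hc M).hom t a b ha hb =
      (F.mapComp' c.op.toLoc a.op.toLoc k.op.toLoc (locComp hk)).inv.toNatTrans.app M ≫
      (F.mapComp' c.op.toLoc b.op.toLoc k.op.toLoc (locComp hk')).hom.toNatTrans.app M := by
  have := pullHom_conj (F := F) c c M M d₀ d₁ (d₀ ≫ c) (d₀ ≫ c) rfl hc.symm (𝟙 _) t a b k k ha hb
    (by rw [reassoc_of% ha, hk]) (by rw [reassoc_of% ha, hk])
  rw [pullHom_one, Category.id_comp, Category.id_comp] at this
  exact this

/-- The functor `F(T) ⥤ F^G` sending `M` to `c^* M` with its canonical action, for a morphism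
`c : C₀ ⟶ T` with `d₀ ≫ c = d₁ ≫ c`. -/
@[simps]
def augment (G : Precat C) {T : C} (c : G.C₀ ⟶ T) (hc : G.d₀ ≫ c = G.d₁ ≫ c) :
    F.obj ⟨op T⟩ ⥤ Action F G where
  obj M :=
    { obj := (F.map c.op.toLoc).toFunctor.obj M
      iso := descentIso F c hc M
      unit := by
        rw [pullHom_descentIso F c hc M G.n (𝟙 _) (𝟙 _) c G.n_d₀ G.n_d₁ (Category.id_comp _)
          (Category.id_comp _), Cat.Hom.inv_hom_id_toNatTrans_app]
        rfl
      cocycle := by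
        have h₀ : (G.r₀ ≫ G.d₁) ≫ c = (G.r₀ ≫ G.d₀) ≫ c := by simp [hc]
        have h₁ : (G.r₁ ≫ G.d₁) ≫ c = (G.r₀ ≫ G.d₀) ≫ c := by
          rw [Category.assoc, ← hc, reassoc_of% G.r₁_d₀, ← hc, Category.assoc]
        rw [pullHom_descentIso F c hc M _ _ _ ((G.r₀ ≫ G.d₀) ≫ c) rfl rfl rfl h₀,
          pullHom_descentIso F c hc M _ _ _ ((G.r₀ ≫ G.d₀) ≫ c) G.r₁_d₀ rfl h₀ h₁,
          pullHom_descentIso F c hc M _ _ _ ((G.r₀ ≫ G.d₀) ≫ c) G.m_d₀ G.m_d₁ rfl h₁,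
          Category.assoc, Cat.Hom.hom_inv_id_toNatTrans_app_assoc] }
  map f :=
    { hom := (F.map c.op.toLoc).toFunctor.map f
      comm := by
        simp only [descentIso, Iso.trans_hom, Iso.symm_hom, Iso.app_inv, Iso.app_hom,
          Category.assoc]
        exact (F.mapComp'_inv_naturality_assoc c.op.toLoc G.d₀.op.toLoc (G.d₀ ≫ c).op.toLoc
          (locComp rfl) f _).trans (congrArg _ (F.mapComp'_hom_naturality c.op.toLoc G.d₁.op.toLoc
            (G.d₀ ≫ c).op.toLoc (locComp hc.symm) f)) }
  map_id _ := by ext; exact CategoryTheory.Functor.map_id _ _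
  map_comp _ _ := by ext; exact Functor.map_comp _ _ _

end augment
end Action
end Actions

section Twist

/-- A derivation of the structure sheaf of a scheme. -/
structure SheafDer (X : Scheme.{u}) where
  app (U : X.Opens) : Derivation ℤ Γ(X, U) Γ(X, U)
  map_app {U V : X.Opens} (h : U ≤ V) (a : Γ(X, V)) :
    X.presheaf.map (homOfLE h).op (app V a) = app U (X.presheaf.map (homOfLE h).op a)

/-- Restriction of global functions. -/
def res {X : Scheme.{u}} (e : Γ(X, ⊤)) (U : X.Opens) : Γ(X, U) :=
  X.presheaf.map (homOfLE le_top : U ⟶ ⊤).op e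

lemma map_res {X : Scheme.{u}} (e : Γ(X, ⊤)) {U V : X.Opens} (h : U ⟶ V) :
    X.presheaf.map h.op (res e V) = res e U := by
  simp only [res, ← CategoryTheory.comp_apply, ← Functor.map_comp]
  rfl

lemma app_res {X Y : Scheme.{u}} (f : X ⟶ Y) (e : Γ(Y, ⊤)) (U : Y.Opens) :
    f.app U (res e U) = res (f.appTop e) (f ⁻¹ᵁ U) := by
  have := congr($(f.naturality (homOfLE le_top : U ⟶ ⊤).op) e)
  exact this

lemma res_add {X : Scheme.{u}} (e e' : Γ(X, ⊤)) (U : X.Opens) :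
    res (e + e') U = res e U + res e' U := map_add _ _ _
lemma res_mul {X : Scheme.{u}} (e e' : Γ(X, ⊤)) (U : X.Opens) :
    res (e * e') U = res e U * res e' U := map_mul _ _ _
lemma res_zero {X : Scheme.{u}} (U : X.Opens) :
    res (0 : Γ(X, ⊤)) U = 0 := map_zero _
lemma res_sq {X : Scheme.{u}} {e : Γ(X, ⊤)} (he : e * e = 0) (U : X.Opens) :
    res e U * res e U = 0 := by rw [← res_mul, he, res_zero]

variable {X T : Scheme.{u}} (D : SheafDer X) (p : T ⟶ X) (e : Γ(T, ⊤)) (he : e * e = 0)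

/-- The ring homomorphism `a ↦ p^♯(a) + e p^♯(D a)`. -/
def twistApp (U : X.Opens) : Γ(X, U) →+* Γ(T, p ⁻¹ᵁ U) where
  toFun a := p.app U a + res e (p ⁻¹ᵁ U) * p.app U (D.app U a)
  map_one' := by simp
  map_zero' := by simp
  map_add' a b := by simp only [map_add]; ring
  map_mul' a b := by
    simp only [map_mul, Derivation.leibniz, smul_eq_mul, map_add]
    linear_combination (-(p.app U (D.app U a)) * p.app U (D.app U b)) * res_sq he (p ⁻¹ᵁ U)

lemma twistApp_apply (U : X.Opens) (a : Γ(X, U)) :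
    twistApp D p e he U a = p.app U a + res e (p ⁻¹ᵁ U) * p.app U (D.app U a) := rfl

/-- The morphism of schemes `a ↦ p^♯(a) + e p^♯(D a)`, with the same map of spaces as `p`, for a
derivation `D` on `X` and a global function `e` on `T` with `e² = 0`. -/
def twist : T ⟶ X where
  base := p.base
  c :=
    { app := fun U => CommRingCat.ofHom (twistApp D p e he U.unop)
      naturality := by
        rintro U V i
        ext a
        have h₁ (b : Γ(X, U.unop)) := congr($(p.naturality i) b)
        have h₂ := D.map_app i.unop.le a
        change twistApp D p e he V.unop (X.presheaf.map i a) =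
          T.presheaf.map ((TopologicalSpace.Opens.map p.base).map i.unop).op
            (twistApp D p e he U.unop a)
        rw [twistApp_apply, twistApp_apply, map_add, map_mul, map_res]
        change X.presheaf.map i _ = D.app V.unop (X.presheaf.map i a) at h₂
        rw [← h₂]
        exact congr($(h₁ a) + _ * $(h₁ (D.app _ a))) }
  prop := by
    intro x
    constructor
    intro s hs
    obtain ⟨U, hxU, a, rfl⟩ := X.presheaf.exists_germ_eq s
    rw [PresheafedSpace.stalkMap_germ_apply] at hs
    have h : T.presheaf.germ (p ⁻¹ᵁ U) x hxU (twistApp D p e he U a) =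
      p.stalkMap x (X.presheaf.germ U (p x) hxU a) + T.presheaf.germ (p ⁻¹ᵁ U) x hxU
        (res e (p ⁻¹ᵁ U) * p.app U (D.app U a)) := by
      rw [Scheme.Hom.germ_stalkMap_apply, ← map_add, twistApp_apply]
    have hn : IsNilpotent (T.presheaf.germ (p ⁻¹ᵁ U) x hxU
        (res e (p ⁻¹ᵁ U) * p.app U (D.app U a))) := by
      refine ⟨2, ?_⟩
      rw [← map_pow, mul_pow, pow_two, res_sq he, zero_mul, map_zero]
    have hu : IsUnit (p.stalkMap x (X.presheaf.germ U (p x) hxU a)) := by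
      have := hn.neg.isUnit_add_left_of_commute (h ▸ hs) (Commute.all _ _)
      simpa using! this
    exact (isUnit_map_iff (p.stalkMap x).hom _).mp hu

lemma twist_app (U : X.Opens) : (twist D p e he).app U = CommRingCat.ofHom (twistApp D p e he U) :=
  rfl

lemma twist_app_apply (U : X.Opens) (a : Γ(X, U)) :
    (twist D p e he).app U a = p.app U a + res e (p ⁻¹ᵁ U) * p.app U (D.app U a) := rfl

lemma map_self {V : T.Opens} (h : V = V) (y : Γ(T, V)) :
    T.presheaf.map (eqToHom h).op y = y := by
  simp

lemma hom_ext_rfl {f g : T ⟶ X} (h : f.base = g.base) (h' : ∀ (U : X.Opens) (a : Γ(X, U)),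
    g.app U a = T.presheaf.map (eqToHom (by rw [h])).op (f.app U a)) : f = g := by
  refine Scheme.Hom.ext h fun U => ?_
  ext a
  exact (h' U a).symm

lemma twist_congr {p q : T ⟶ X} {e e' : Γ(T, ⊤)} (h : p = q) (h' : e = e') (he : e * e = 0) :
    twist D p e he = twist D q e' (h' ▸ he) := by
  subst h h'
  rfl

lemma comp_twist {T' : Scheme.{u}} (g : T' ⟶ T) :
    g ≫ twist D p e he = twist D (g ≫ p) (g.appTop e)
      (by rw [← map_mul, he, map_zero]) := by
  refine hom_ext_rfl rfl fun U a => Eq.trans ?_ (map_self _ _).symm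
  change _ = (g.app _) (twistApp D p e he U a)
  rw [twistApp_apply, map_add, map_mul (g.app (p ⁻¹ᵁ U)).hom, app_res]
  rfl

lemma twist_zero : twist D p 0 (zero_mul 0) = p := by
  refine hom_ext_rfl rfl fun U a => Eq.trans ?_ (map_self _ _).symm
  change _ = twistApp D p 0 (zero_mul 0) U a
  rw [twistApp_apply, res_zero, zero_mul, add_zero]

/-- `f` commutes with the given derivations. -/
def IsDifferential {X Y : Scheme.{u}} (D : SheafDer X) (E : SheafDer Y) (f : X ⟶ Y) : Prop :=
  ∀ (U : Y.Opens) (a : Γ(Y, U)), f.app U (E.app U a) = D.app (f ⁻¹ᵁ U) (f.app U a)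

lemma twist_comp {Y : Scheme.{u}} {E : SheafDer Y} {f : X ⟶ Y} (hf : IsDifferential D E f) :
    twist D p e he ≫ f = twist E (p ≫ f) e he := by
  refine hom_ext_rfl rfl fun U a => Eq.trans ?_ (map_self _ _).symm
  change (p.app _) (f.app U a) + res e _ * (p.app _) (f.app U (E.app U a)) =
    twistApp D p e he _ (f.app U a)
  rw [twistApp_apply, hf]

lemma twist_comp_of_zero {Y : Scheme.{u}} {f : X ⟶ Y}
    (hf : ∀ (U : Y.Opens) (a : Γ(Y, U)), D.app (f ⁻¹ᵁ U) (f.app U a) = 0) :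
    twist D p e he ≫ f = p ≫ f := by
  refine hom_ext_rfl rfl fun U a => Eq.trans ?_ (map_self _ _).symm
  change (p.app _) (f.app U a) = twistApp D p e he _ (f.app U a)
  rw [twistApp_apply, hf, map_zero, mul_zero, add_zero]

lemma twist_twist (e' : Γ(T, ⊤)) (he' : e' * e' = 0) (hee : e * e' = 0) :
    twist D (twist D p e he) e' he' =
      twist D p (e + e') (by linear_combination he + he' + 2 * hee) := by
  refine hom_ext_rfl rfl fun U a => Eq.trans ?_ (map_self _ _).symm
  have h : res e (p ⁻¹ᵁ U) * res e' (p ⁻¹ᵁ U) = 0 := by rw [← res_mul, hee, res_zero]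
  refine (twist_app_apply D p (e + e') _ U a).trans ?_
  change _ = twistApp D p e he U a + res e' (p ⁻¹ᵁ U) * twistApp D p e he U (D.app U a)
  rw [twistApp_apply, twistApp_apply, res_add]
  linear_combination (- p.app U (D.app U (D.app U a))) * h

end Twist

section Thick

/-- The ring `ℤ[ε_i : i ∈ ι] / (ε_i ε_j : i, j ∈ ι)`. -/
abbrev NilAlg (ι : Type) : Type u :=
  MvPolynomial ι (ULift.{u} ℤ) ⧸
    Ideal.span {x : MvPolynomial ι (ULift.{u} ℤ) | ∃ i j, x = MvPolynomial.X i * MvPolynomial.X j}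

namespace NilAlg

variable {ι : Type}

/-- The generator `ε_i`. -/
noncomputable def gen (i : ι) : NilAlg.{u} ι := Ideal.Quotient.mk _ (MvPolynomial.X i)

lemma gen_mul (i j : ι) : gen.{u} i * gen j = 0 := by
  rw [gen, gen, ← map_mul, Ideal.Quotient.eq_zero_iff_mem]
  exact Ideal.subset_span ⟨i, j, rfl⟩

/-- Ring homomorphisms out of `ℤ[ε_i] / (ε_i ε_j)`. -/
noncomputable def lift {A : Type*} [CommRing A] (e : ι → A) (he : ∀ i j, e i * e j = 0) :
    NilAlg.{u} ι →+* A :=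
  Ideal.Quotient.lift _ (MvPolynomial.eval₂Hom
    ((Int.castRingHom A).comp (ULift.ringEquiv (R := ℤ)).toRingHom) e) (by
      intro a ha
      rw [← RingHom.mem_ker]
      refine Ideal.span_le.2 ?_ ha
      rintro _ ⟨i, j, rfl⟩
      simp [he])

@[simp] lemma lift_gen {A : Type*} [CommRing A] (e : ι → A) (he : ∀ i j, e i * e j = 0) (i : ι) :
    lift.{u} e he (gen i) = e i := by
  simp [lift, gen]

lemma ringHom_ext {A : Type*} [CommRing A] {f g : NilAlg.{u} ι →+* A}
    (h : ∀ i, f (gen i) = g (gen i)) : f = g := by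
  refine Ideal.Quotient.ringHom_ext (MvPolynomial.ringHom_ext (fun r => ?_) h)
  have : (f.comp ((Ideal.Quotient.mk _).comp (MvPolynomial.C (R := ULift.{u} ℤ) (σ := ι)))).comp
    (ULift.ringEquiv (R := ℤ)).symm.toRingHom = (g.comp ((Ideal.Quotient.mk _).comp
      (MvPolynomial.C (R := ULift.{u} ℤ) (σ := ι)))).comp
    (ULift.ringEquiv (R := ℤ)).symm.toRingHom := RingHom.ext_int _ _
  exact congr($this r.down)

end NilAlg

/-- The scheme `X[ε_i : i ∈ ι] = X ×_ℤ Spec ℤ[ε_i] / (ε_i ε_j)`. -/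
noncomputable def thick (X : Scheme.{u}) (ι : Type) : Scheme.{u} :=
  pullback (specULiftZIsTerminal.from X) (specULiftZIsTerminal.from (Spec (.of (NilAlg.{u} ι))))

variable {X T : Scheme.{u}} {ι : Type}

/-- The projection `X[ε_i] ⟶ X`. -/
noncomputable def thickProj (X : Scheme.{u}) (ι : Type) : thick X ι ⟶ X := pullback.fst _ _

/-- The second projection of `X[ε_i]`. -/
noncomputable def thickSnd (X : Scheme.{u}) (ι : Type) : thick X ι ⟶ Spec (.of (NilAlg.{u} ι)) :=
  pullback.snd _ _

/-- The global function `ε_i` on `X[ε_i]`. -/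
noncomputable def eps (X : Scheme.{u}) {ι : Type} (i : ι) : Γ(thick X ι, ⊤) :=
  (thickSnd X ι).appTop ((Scheme.ΓSpecIso (.of (NilAlg.{u} ι))).inv (NilAlg.gen i))

lemma eps_mul (i j : ι) : eps X i * eps X j = 0 := by
  rw [eps, eps, ← map_mul, ← map_mul, NilAlg.gen_mul, map_zero, map_zero]

/-- The morphism to `X[ε_i]` given by a morphism to `X` and functions with products zero. -/
noncomputable def thickLift (g : T ⟶ X) (e : ι → Γ(T, ⊤)) (he : ∀ i j, e i * e j = 0) :
    T ⟶ thick X ι :=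
  pullback.lift g (T.toSpecΓ ≫ Spec.map (CommRingCat.ofHom (NilAlg.lift.{u} e he)))
    (specULiftZIsTerminal.hom_ext _ _)

@[simp] lemma thickLift_proj (g : T ⟶ X) (e : ι → Γ(T, ⊤)) (he : ∀ i j, e i * e j = 0) :
    thickLift g e he ≫ thickProj X ι = g := pullback.lift_fst _ _ _

lemma thickLift_eps (g : T ⟶ X) (e : ι → Γ(T, ⊤)) (he : ∀ i j, e i * e j = 0) (i : ι) :
    (thickLift g e he).appTop (eps X i) = e i := by
  have h : thickLift g e he ≫ thickSnd X ι =
    T.toSpecΓ ≫ Spec.map (CommRingCat.ofHom (NilAlg.lift.{u} e he)) := pullback.lift_snd _ _ _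
  have h₂ := congr(Scheme.Hom.appTop $h ((Scheme.ΓSpecIso (.of (NilAlg.{u} ι))).inv (NilAlg.gen i)))
  rw [Scheme.Hom.comp_appTop] at h₂
  refine Eq.trans h₂ ?_
  simp

lemma thick_hom_ext {f g : T ⟶ thick X ι} (h : f ≫ thickProj X ι = g ≫ thickProj X ι)
    (heps : ∀ i, f.appTop (eps X i) = g.appTop (eps X i)) : f = g := by
  refine pullback.hom_ext h ?_
  apply (ΓSpec.adjunction.homEquiv _ _).symm.injective
  apply Quiver.Hom.unop_inj
  rw [Adjunction.homEquiv_symm_apply, Adjunction.homEquiv_symm_apply]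
  dsimp
  ext1
  refine NilAlg.ringHom_ext fun i => ?_
  exact heps i

/-- The section of the projection given by `ε_i ↦ 0`. -/
noncomputable def thickZero (X : Scheme.{u}) (ι : Type) : X ⟶ thick X ι :=
  thickLift (𝟙 X) (fun _ => 0) (fun _ _ => zero_mul _)

lemma thickZero_proj : thickZero X ι ≫ thickProj X ι = 𝟙 X := thickLift_proj _ _ _

lemma ringHom_ext_of_terminal {A : CommRingCat.{u}}
    (f g : Γ(Spec (.of (ULift.{u} ℤ)), ⊤) ⟶ A) : f = g := by
  rw [← cancel_epi (Scheme.ΓSpecIso (.of (ULift.{u} ℤ))).inv]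
  ext r
  have := RingHom.ext_int (((Scheme.ΓSpecIso (.of (ULift.{u} ℤ))).inv ≫ f).hom.comp
    (ULift.ringEquiv (R := ℤ)).symm.toRingHom) (((Scheme.ΓSpecIso (.of (ULift.{u} ℤ))).inv ≫ g).hom.comp
    (ULift.ringEquiv (R := ℤ)).symm.toRingHom)
  exact congr($this r.down)

lemma thick_isPushout (ι : Type) {U : X.Opens} (hU : IsAffineOpen U) :
    IsPushout ((specULiftZIsTerminal.from X).appLE ⊤ U le_top)
      ((specULiftZIsTerminal.from (Spec (.of (NilAlg.{u} ι)))).appTop)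
      ((thickProj X ι).app U)
      ((thickSnd X ι).appLE ⊤ (thickProj X ι ⁻¹ᵁ U) le_top) := by
  have h := (isIso_pushoutSection_iff (IsPullback.of_hasPullback (specULiftZIsTerminal.from X)
    (specULiftZIsTerminal.from (Spec (.of (NilAlg.{u} ι))))) (US := ⊤) (UT := ⊤) (UX := U)
    (UY := thickProj X ι ⁻¹ᵁ U) le_top le_top (by simp [thickProj])).1
    (isIso_pushoutSection_of_isAffineOpen _ _ _ _ (isAffineOpen_top _) (isAffineOpen_top _) hU)
  rw [Scheme.Hom.app_eq_appLE, Scheme.Hom.appTop, Scheme.Hom.app_eq_appLE]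
  exact h

/-- Functions on `U[ε]` as dual numbers, for `U` affine. -/
noncomputable def toDual {U : X.Opens} (hU : IsAffineOpen U) :
    Γ(thick X Unit, thickProj X Unit ⁻¹ᵁ U) ⟶ .of (DualNumber Γ(X, U)) :=
  (thick_isPushout Unit hU).desc (CommRingCat.ofHom (TrivSqZeroExt.inlHom _ _))
    ((Scheme.ΓSpecIso _).hom ≫ CommRingCat.ofHom
      (NilAlg.lift.{u} (fun _ => DualNumber.eps) (fun _ _ => DualNumber.eps_mul_eps)))
    (ringHom_ext_of_terminal _ _)

lemma toDual_proj {U : X.Opens} (hU : IsAffineOpen U) (a : Γ(X, U)) :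
    toDual hU ((thickProj X Unit).app U a) = TrivSqZeroExt.inl a :=
  ConcreteCategory.congr_hom
    ((thick_isPushout Unit hU).inl_desc _ _ (ringHom_ext_of_terminal _ _)) a

lemma toDual_eps {U : X.Opens} (hU : IsAffineOpen U) :
    toDual hU (res (eps X ()) _) = DualNumber.eps := by
  have := congr($((thick_isPushout Unit hU).inr_desc _ _ (ringHom_ext_of_terminal
    (_ ≫ (CommRingCat.ofHom (TrivSqZeroExt.inlHom Γ(X, U) Γ(X, U)))) (_ ≫ (Scheme.ΓSpecIso _).hom ≫ CommRingCat.ofHom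
      (NilAlg.lift.{u} (fun _ => DualNumber.eps) (fun _ _ => DualNumber.eps_mul_eps)))))
      ((Scheme.ΓSpecIso (.of (NilAlg.{u} Unit))).inv (NilAlg.gen ())))
  refine Eq.trans ?_ (this.trans ?_)
  · rfl
  · simp

/-- Dual numbers as functions on `U[ε]`. -/
noncomputable def ofDual (U : X.Opens) :
    DualNumber Γ(X, U) →+* Γ(thick X Unit, thickProj X Unit ⁻¹ᵁ U) where
  toFun c := (thickProj X Unit).app U c.fst + res (eps X ()) _ * (thickProj X Unit).app U c.snd
  map_one' := by simp
  map_zero' := by simp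
  map_add' a b := by simp only [map_add, TrivSqZeroExt.fst_add, TrivSqZeroExt.snd_add]; ring
  map_mul' a b := by
    simp only [TrivSqZeroExt.fst_mul, TrivSqZeroExt.snd_mul, smul_eq_mul, map_add, map_mul,
      MulOpposite.smul_eq_mul_unop, MulOpposite.unop_op]
    linear_combination (- (thickProj X Unit).app U a.snd * (thickProj X Unit).app U b.snd) *
      res_sq (eps_mul () ()) (thickProj X Unit ⁻¹ᵁ U)

lemma ofDual_apply (U : X.Opens) (c : DualNumber Γ(X, U)) :
    ofDual U c = (thickProj X Unit).app U c.fst +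
      res (eps X ()) _ * (thickProj X Unit).app U c.snd := rfl

lemma ofDual_toDual {U : X.Opens} (hU : IsAffineOpen U)
    (c : Γ(thick X Unit, thickProj X Unit ⁻¹ᵁ U)) : ofDual U (toDual hU c) = c := by
  have : toDual hU ≫ CommRingCat.ofHom (ofDual U) = 𝟙 _ := by
    refine (thick_isPushout Unit hU).hom_ext ?_ ?_
    · ext a
      change ofDual U (toDual hU ((thickProj X Unit).app U a)) = (thickProj X Unit).app U a
      rw [toDual_proj, ofDual_apply]
      simp
    · rw [← cancel_epi (Scheme.ΓSpecIso (.of (NilAlg.{u} Unit))).inv]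
      ext1
      refine NilAlg.ringHom_ext fun i => ?_
      change ofDual U (toDual hU (res (eps X ()) _)) = res (eps X ()) _
      rw [toDual_eps, ofDual_apply]
      simp
  exact ConcreteCategory.congr_hom this c

lemma eps_mul_inj_of_affine {U : X.Opens} (hU : IsAffineOpen U) (a : Γ(X, U))
    (ha : res (eps X ()) _ * (thickProj X Unit).app U a = 0) : a = 0 := by
  have := congrArg (toDual hU) ha
  rw [map_mul, toDual_eps, toDual_proj, map_zero] at this
  simpa using! congrArg TrivSqZeroExt.snd this

lemma exists_of_affine {U : X.Opens} (hU : IsAffineOpen U)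
    (c : Γ(thick X Unit, thickProj X Unit ⁻¹ᵁ U)) :
    ∃ a b, c = (thickProj X Unit).app U a + res (eps X ()) _ * (thickProj X Unit).app U b :=
  ⟨_, _, (ofDual_toDual hU c).symm⟩

/-- The affine open subschemes contained in `U`. -/
abbrev AffSub (U : X.Opens) : Type u := {V : X.Opens // IsAffineOpen V ∧ V ≤ U}

lemma le_iSup_affSub (U : X.Opens) : U ≤ iSup (fun V : AffSub U => V.1) := by
  intro x hx
  obtain ⟨_, ⟨V, hV, rfl⟩, hxV, hVU⟩ := X.isBasis_affineOpens.exists_subset_of_mem_open hx U.2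
  exact TopologicalSpace.Opens.mem_iSup.2 ⟨⟨V, hV, hVU⟩, hxV⟩

lemma thick_preimage_le_iSup (U : X.Opens) :
    thickProj X ι ⁻¹ᵁ U ≤ iSup (fun V : AffSub U => thickProj X ι ⁻¹ᵁ V.1) := by
  intro x hx
  obtain ⟨V, hV⟩ := TopologicalSpace.Opens.mem_iSup.1 (le_iSup_affSub U hx)
  exact TopologicalSpace.Opens.mem_iSup.2 ⟨V, hV⟩

lemma map_app {T : Scheme.{u}} (f : T ⟶ X) {U V : X.Opens} (h : U ⟶ V) (a : Γ(X, V)) :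
    T.presheaf.map ((TopologicalSpace.Opens.map f.base).map h).op (f.app V a) =
      f.app U (X.presheaf.map h.op a) :=
  (ConcreteCategory.congr_hom (f.naturality h.op) a).symm

lemma eps_mul_inj {U : X.Opens} (a : Γ(X, U))
    (ha : res (eps X ()) _ * (thickProj X Unit).app U a = 0) : a = 0 := by
  refine X.sheaf.eq_of_locally_eq' (fun V : AffSub U => V.1) U (fun V => homOfLE V.2.2)
    (le_iSup_affSub U) a 0 fun V => ?_
  refine (eps_mul_inj_of_affine V.2.1 _ ?_).trans (map_zero _).symm
  have := congrArg ((thick X Unit).presheaf.map ((TopologicalSpace.Opens.map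
    (thickProj X Unit).base).map (homOfLE V.2.2)).op) ha
  rw [map_mul, map_zero, map_res, map_app] at this
  exact this

lemma le_thickZero (U : X.Opens) : U ≤ thickZero X ι ⁻¹ᵁ (thickProj X ι ⁻¹ᵁ U) := by
  rw [← Scheme.Hom.comp_preimage, thickZero_proj]
  exact le_rfl

/-- The reduction modulo the `ε_i`. -/
noncomputable def thickRed (U : X.Opens) : Γ(thick X ι, thickProj X ι ⁻¹ᵁ U) ⟶ Γ(X, U) :=
  (thickZero X ι).appLE _ U (le_thickZero U)

lemma appLE_of_eq_id (f : X ⟶ X) (hf : f = 𝟙 X) {U : X.Opens} (h : U ≤ f ⁻¹ᵁ U) :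
    f.appLE U U h = 𝟙 _ := by
  subst hf
  exact (Scheme.Hom.app_eq_appLE (𝟙 X)).symm.trans (Scheme.Hom.id_app U)

lemma thickRed_proj (U : X.Opens) (a : Γ(X, U)) :
    thickRed (ι := ι) U ((thickProj X ι).app U a) = a := by
  have : (thickProj X ι).app U ≫ thickRed U = 𝟙 _ := by
    rw [thickRed, Scheme.Hom.app_eq_appLE, Scheme.Hom.appLE_comp_appLE]
    exact appLE_of_eq_id _ thickZero_proj _
  exact ConcreteCategory.congr_hom this a

lemma thickRed_eps (U : X.Opens) (i : ι) : thickRed U (res (eps X i) _) = 0 := by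
  have : (thick X ι).presheaf.map (homOfLE le_top).op ≫ thickRed U =
      (thickZero X ι).appTop ≫ X.presheaf.map (homOfLE le_top).op := by
    rw [thickRed, Scheme.Hom.map_appLE, Scheme.Hom.appLE]
    rfl
  refine (ConcreteCategory.congr_hom this _).trans ?_
  rw [CategoryTheory.comp_apply, thickZero, thickLift_eps, map_zero]

lemma exists_of_red_eq_zero_of_affine {U : X.Opens} (hU : IsAffineOpen U)
    (c : Γ(thick X Unit, thickProj X Unit ⁻¹ᵁ U)) (hc : thickRed U c = 0) :
    ∃ b, c = res (eps X ()) _ * (thickProj X Unit).app U b := by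
  obtain ⟨a, b, rfl⟩ := exists_of_affine hU c
  rw [map_add, map_mul, thickRed_proj, thickRed_eps, zero_mul, add_zero] at hc
  subst hc
  exact ⟨b, by simp⟩

lemma thickRed_map {U V : X.Opens} (h : U ⟶ V) (c : Γ(thick X ι, thickProj X ι ⁻¹ᵁ V)) :
    thickRed U ((thick X ι).presheaf.map ((TopologicalSpace.Opens.map
      (thickProj X ι).base).map h).op c) = X.presheaf.map h.op (thickRed V c) := by
  have : (thick X ι).presheaf.map ((TopologicalSpace.Opens.map
      (thickProj X ι).base).map h).op ≫ thickRed U = thickRed V ≫ X.presheaf.map h.op := by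
    rw [thickRed, thickRed, Scheme.Hom.map_appLE, Scheme.Hom.appLE_map]
  exact ConcreteCategory.congr_hom this c

lemma map_eps_mul {U V : X.Opens} (h : U ⟶ V) (b : Γ(X, V)) :
    (thick X Unit).presheaf.map ((TopologicalSpace.Opens.map (thickProj X Unit).base).map h).op
      (res (eps X ()) _ * (thickProj X Unit).app V b) =
      res (eps X ()) _ * (thickProj X Unit).app U (X.presheaf.map h.op b) := by
  rw [map_mul, map_res, map_app]

lemma eps_mul_inj' {U : X.Opens} {a b : Γ(X, U)} (h : res (eps X ()) _ *
    (thickProj X Unit).app U a = res (eps X ()) _ * (thickProj X Unit).app U b) : a = b := by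
  refine sub_eq_zero.1 (eps_mul_inj _ ?_)
  rw [map_sub, mul_sub, h, sub_self]

lemma exists_of_red_eq_zero {U : X.Opens}
    (c : Γ(thick X Unit, thickProj X Unit ⁻¹ᵁ U)) (hc : thickRed U c = 0) :
    ∃ b, c = res (eps X ()) _ * (thickProj X Unit).app U b := by
  have h (V : AffSub U) : ∃ b, (thick X Unit).presheaf.map ((TopologicalSpace.Opens.map
      (thickProj X Unit).base).map (homOfLE V.2.2)).op c =
        res (eps X ()) _ * (thickProj X Unit).app V.1 b := by
    apply exists_of_red_eq_zero_of_affine V.2.1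
    rw [thickRed_map, hc, map_zero]
  choose b hb using h
  obtain ⟨b', hb', -⟩ := X.sheaf.existsUnique_gluing' (fun V : AffSub U => V.1) U
    (fun V => homOfLE V.2.2) (le_iSup_affSub U) b (by
      intro V W
      refine eps_mul_inj' ?_
      refine (map_eps_mul (TopologicalSpace.Opens.infLELeft V.1 W.1) (b V)).symm.trans
        (Eq.trans ?_ (map_eps_mul (TopologicalSpace.Opens.infLERight V.1 W.1) (b W)))
      rw [← hb, ← hb, ← CategoryTheory.comp_apply, ← CategoryTheory.comp_apply,
        ← Functor.map_comp, ← Functor.map_comp]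
      rfl)
  refine ⟨b', ?_⟩
  refine (thick X Unit).sheaf.eq_of_locally_eq' (fun V : AffSub U => thickProj X Unit ⁻¹ᵁ V.1) _
    (fun V => ((TopologicalSpace.Opens.map (thickProj X Unit).base).map (homOfLE V.2.2)))
    (thick_preimage_le_iSup U) _ _ fun V => ?_
  refine (hb V).trans (Eq.trans ?_ (map_eps_mul (homOfLE V.2.2) b').symm)
  rw [← hb' V]
  rfl

lemma thickProj_injective : Function.Injective (thickProj X Unit) := by
  intro x y hxy
  have : IsAffineHom (thickProj X Unit) := by
    have h : IsAffineHom (specULiftZIsTerminal.from (Spec (.of (NilAlg.{u} Unit)))) :=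
      isAffineHom_of_isAffine _
    exact MorphismProperty.of_isPullback (P := @IsAffineHom)
      (IsPullback.of_hasPullback (specULiftZIsTerminal.from X)
        (specULiftZIsTerminal.from (Spec (.of (NilAlg.{u} Unit))))).flip h
  have key : ∀ x y : thick X Unit, thickProj X Unit x = thickProj X Unit y →
      ∀ O : (thick X Unit).Opens, x ∈ O → y ∈ O := by
    intro x y hxy O hxO
    obtain ⟨_, ⟨U, hU, rfl⟩, hxU, -⟩ := X.isBasis_affineOpens.exists_subset_of_mem_open
      (Set.mem_univ (thickProj X Unit x)) isOpen_univ
    obtain ⟨c, hcO, hc⟩ := (hU.preimage (thickProj X Unit)).exists_basicOpen_le ⟨x, hxO⟩ hxU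
    refine hcO ?_
    obtain ⟨a, b, rfl⟩ := exists_of_affine hU c
    have hb : (thick X Unit).basicOpen ((thickProj X Unit).app U a +
        res (eps X ()) _ * (thickProj X Unit).app U b) =
        thickProj X Unit ⁻¹ᵁ X.basicOpen a := by
      rw [Scheme.preimage_basicOpen]
      ext z
      have hn (hz : z ∈ thickProj X Unit ⁻¹ᵁ U) : IsNilpotent ((thick X Unit).presheaf.germ _ z hz
          (res (eps X ()) _ * (thickProj X Unit).app U b)) := by
        refine ⟨2, ?_⟩
        rw [← map_pow, mul_pow, pow_two, res_sq (eps_mul () ()), zero_mul, map_zero]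
      simp only [SetLike.mem_coe, Scheme.mem_basicOpen'', map_add]
      refine exists_congr fun hz => ⟨fun h => ?_, fun h => ?_⟩
      · simpa using! (hn hz).neg.isUnit_add_left_of_commute h (Commute.all _ _)
      · exact (hn hz).isUnit_add_left_of_commute h (Commute.all _ _)
    rw [hb] at hc ⊢
    change thickProj X Unit x ∈ X.basicOpen a at hc
    change thickProj X Unit y ∈ X.basicOpen a
    rwa [← hxy]
  have : Inseparable x y := by
    rw [inseparable_iff_forall_isOpen]
    exact fun s hs => ⟨key x y hxy ⟨s, hs⟩, key y x hxy.symm ⟨s, hs⟩⟩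
  exact this.eq

end Thick

section OfThick

variable {X T : Scheme.{u}}

lemma thickZero_thickProj_apply (z : thick X Unit) :
    thickZero X Unit (thickProj X Unit z) = z := by
  apply thickProj_injective
  rw [← Scheme.Hom.comp_apply, thickZero_proj]
  rfl

lemma base_eq_of_section (d : thick X Unit ⟶ X) (hd : thickZero X Unit ≫ d = 𝟙 X)
    : (thickProj X Unit).base = d.base := by
  ext z
  have h : d (thickZero X Unit (thickProj X Unit z)) = thickProj X Unit z := by
    rw [← Scheme.Hom.comp_apply, hd]
    rfl
  rw [thickZero_thickProj_apply] at h
  exact h.symm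

lemma preimage_eq_of_section (d : thick X Unit ⟶ X) (hd : thickZero X Unit ≫ d = 𝟙 X)
    (U : X.Opens) : thickProj X Unit ⁻¹ᵁ U ≤ d ⁻¹ᵁ U := by
  rw [base_eq_of_section d hd]

lemma exists_der (d : thick X Unit ⟶ X) (hd : thickZero X Unit ≫ d = 𝟙 X)
    (U : X.Opens) (a : Γ(X, U)) :
    ∃ b, d.appLE U (thickProj X Unit ⁻¹ᵁ U) (preimage_eq_of_section d hd U) a =
      (thickProj X Unit).app U a + res (eps X ()) _ * (thickProj X Unit).app U b := by
  obtain ⟨b, hb⟩ := exists_of_red_eq_zero (d.appLE U (thickProj X Unit ⁻¹ᵁ U)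
    (preimage_eq_of_section d hd U) a - (thickProj X Unit).app U a) (by
      have : d.appLE U (thickProj X Unit ⁻¹ᵁ U) (preimage_eq_of_section d hd U) ≫ thickRed U =
          𝟙 _ := by
        rw [thickRed, Scheme.Hom.appLE_comp_appLE]
        exact appLE_of_eq_id _ hd _
      rw [map_sub, thickRed_proj, sub_eq_zero]
      exact ConcreteCategory.congr_hom this a)
  exact ⟨b, sub_eq_iff_eq_add'.1 hb⟩

/-- The `ε`-component of a morphism `X[ε] ⟶ X` that restricts to the identity. -/
noncomputable def derFun (d : thick X Unit ⟶ X) (hd : thickZero X Unit ≫ d = 𝟙 X)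
    (U : X.Opens) (a : Γ(X, U)) : Γ(X, U) := (exists_der d hd U a).choose

lemma derFun_spec (d : thick X Unit ⟶ X) (hd : thickZero X Unit ≫ d = 𝟙 X)
    (U : X.Opens) (a : Γ(X, U)) :
    d.appLE U (thickProj X Unit ⁻¹ᵁ U) (preimage_eq_of_section d hd U) a =
      (thickProj X Unit).app U a +
        res (eps X ()) _ * (thickProj X Unit).app U (derFun d hd U a) :=
  (exists_der d hd U a).choose_spec

lemma derFun_eq (d : thick X Unit ⟶ X) (hd : thickZero X Unit ≫ d = 𝟙 X)
    {U : X.Opens} {a b : Γ(X, U)}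
    (h : d.appLE U (thickProj X Unit ⁻¹ᵁ U) (preimage_eq_of_section d hd U) a =
      (thickProj X Unit).app U a + res (eps X ()) _ * (thickProj X Unit).app U b) :
    derFun d hd U a = b :=
  eps_mul_inj' (add_left_cancel ((derFun_spec d hd U a).symm.trans h))

lemma derFun_add (d : thick X Unit ⟶ X) (hd : thickZero X Unit ≫ d = 𝟙 X) (U : X.Opens) (a b : Γ(X, U)) :
    derFun d hd U (a + b) = derFun d hd U a + derFun d hd U b := by
  refine derFun_eq d hd ?_
  rw [map_add, derFun_spec d hd, derFun_spec d hd, map_add, map_add]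
  ring

lemma derFun_mul (d : thick X Unit ⟶ X) (hd : thickZero X Unit ≫ d = 𝟙 X) (U : X.Opens) (a b : Γ(X, U)) :
    derFun d hd U (a * b) = a * derFun d hd U b + b * derFun d hd U a := by
  refine derFun_eq d hd ?_
  rw [map_mul, derFun_spec d hd, derFun_spec d hd, map_add, map_mul, map_mul, map_mul]
  linear_combination ((thickProj X Unit).app U (derFun d hd U a) *
    (thickProj X Unit).app U (derFun d hd U b)) * res_sq (eps_mul () ()) (thickProj X Unit ⁻¹ᵁ U)

lemma derFun_map (d : thick X Unit ⟶ X) (hd : thickZero X Unit ≫ d = 𝟙 X) {U V : X.Opens} (h : U ⟶ V) (a : Γ(X, V)) :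
    derFun d hd U (X.presheaf.map h.op a) = X.presheaf.map h.op (derFun d hd V a) := by
  refine derFun_eq d hd ?_
  have h₁ : X.presheaf.map h.op ≫ d.appLE U (thickProj X Unit ⁻¹ᵁ U)
      (preimage_eq_of_section d hd U) =
      d.appLE V (thickProj X Unit ⁻¹ᵁ V) (preimage_eq_of_section d hd V) ≫
      (thick X Unit).presheaf.map
        ((TopologicalSpace.Opens.map (thickProj X Unit).base).map h).op := by
    rw [Scheme.Hom.map_appLE, Scheme.Hom.appLE_map]
  refine (ConcreteCategory.congr_hom h₁ a).trans ?_
  rw [CategoryTheory.comp_apply, derFun_spec d hd, map_add, map_eps_mul, map_app]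

/-- The derivation given by a morphism `X[ε] ⟶ X` that restricts to the identity. -/
noncomputable def SheafDer.ofSection (d : thick X Unit ⟶ X) (hd : thickZero X Unit ≫ d = 𝟙 X) : SheafDer X where
  app U := Derivation.mk' (AddMonoidHom.mk' (derFun d hd U) (derFun_add d hd U)).toIntLinearMap
    (derFun_mul d hd U)
  map_app h a := (derFun_map d hd (homOfLE h) a).symm

lemma SheafDer.ofSection_app (d : thick X Unit ⟶ X) (hd : thickZero X Unit ≫ d = 𝟙 X)
    (U : X.Opens) (a : Γ(X, U)) :
    (SheafDer.ofSection d hd).app U a = derFun d hd U a := rfl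

lemma twist_ofSection (d : thick X Unit ⟶ X) (hd : thickZero X Unit ≫ d = 𝟙 X)
    :
    twist (SheafDer.ofSection d hd) (thickProj X Unit) (eps X ()) (eps_mul () ()) = d := by
  refine hom_ext_rfl (base_eq_of_section d hd) fun U a => ?_
  have h : d.app U = d.appLE U (thickProj X Unit ⁻¹ᵁ U) (preimage_eq_of_section d hd U) ≫
      (thick X Unit).presheaf.map (eqToHom (by rw [base_eq_of_section d hd])).op := by
    rw [Scheme.Hom.appLE_map, Scheme.Hom.app_eq_appLE]
  exact (ConcreteCategory.congr_hom h a).trans (congrArg _ (derFun_spec d hd U a))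

/-- Compatibility with derivations in terms of the morphisms `id + ε D`. -/
lemma isDifferential_iff {X Y : Scheme.{u}} (D : SheafDer X) (E : SheafDer Y) (f : X ⟶ Y) :
    IsDifferential D E f ↔
      twist D (thickProj X Unit) (eps X ()) (eps_mul () ()) ≫ f =
        twist E (thickProj X Unit ≫ f) (eps X ()) (eps_mul () ()) := by
  refine ⟨fun h => twist_comp D _ _ _ h, fun h U a => ?_⟩
  refine eps_mul_inj' ?_
  have h₁ (q : thick X Unit ⟶ Y)
      (hq : q = twist E (thickProj X Unit ≫ f) (eps X ()) (eps_mul () ()))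
      (hU : thickProj X Unit ⁻¹ᵁ (f ⁻¹ᵁ U) ≤ q ⁻¹ᵁ U) :
      q.appLE U (thickProj X Unit ⁻¹ᵁ (f ⁻¹ᵁ U)) hU a =
        twistApp E (thickProj X Unit ≫ f) (eps X ()) (eps_mul () ()) U a := by
    subst hq
    exact (ConcreteCategory.congr_hom (Scheme.Hom.app_eq_appLE _) a).symm
  have h₂ := (ConcreteCategory.congr_hom (Scheme.Hom.app_eq_appLE _) a).trans (h₁ _ h le_rfl)
  change twistApp D (thickProj X Unit) (eps X ()) (eps_mul () ()) (f ⁻¹ᵁ U) (f.app U a) = _ at h₂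
  rw [twistApp_apply, twistApp_apply] at h₂
  exact (add_left_cancel h₂).symm

end OfThick

section ThickPrecat

variable {X T : Scheme.{u}} (D : SheafDer X)

/-- The morphism `id + ε D : X[ε] ⟶ X`. -/
noncomputable def SheafDer.flow : thick X Unit ⟶ X :=
  twist D (thickProj X Unit) (eps X ()) (eps_mul _ _)

lemma thickLift_flow (g : T ⟶ X) (e : Γ(T, ⊤)) (he : e * e = 0) :
    thickLift g (fun _ => e) (fun _ _ => he) ≫ D.flow = twist D g e he := by
  rw [SheafDer.flow, comp_twist]
  exact twist_congr D (thickLift_proj _ _ _) (thickLift_eps _ _ _ _) _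

lemma thickZero_flow : thickZero X Unit ≫ D.flow = 𝟙 X :=
  (thickLift_flow D (𝟙 X) 0 (zero_mul 0)).trans (twist_zero D _)

lemma eps_add_mul (X : Scheme.{u}) :
    (eps X (0 : Fin 2) + eps X 1) * (eps X (0 : Fin 2) + eps X 1) = 0 := by
  rw [add_mul, mul_add, mul_add, eps_mul, eps_mul, eps_mul, eps_mul, add_zero, add_zero]

/-- The morphism `X[ε₀, ε₁] ⟶ X[ε]`, `ε ↦ ε₀ + ε₁`. -/
noncomputable def thickMul (X : Scheme.{u}) : thick X (Fin 2) ⟶ thick X Unit :=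
  thickLift (thickProj X (Fin 2)) (fun _ => eps X 0 + eps X 1) (fun _ _ => eps_add_mul X)

/-- The morphism `X[ε₀, ε₁] ⟶ X[ε]`, `ε ↦ ε₀`. -/
noncomputable def thickFst (X : Scheme.{u}) : thick X (Fin 2) ⟶ thick X Unit :=
  thickLift (thickProj X (Fin 2)) (fun _ => eps X 0) (fun _ _ => eps_mul _ _)

/-- The morphism `X[ε₀, ε₁] ⟶ X[ε]`, `a ↦ a + ε₀ D(a)`, `ε ↦ ε₁`. -/
noncomputable def SheafDer.flowSnd : thick X (Fin 2) ⟶ thick X Unit :=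
  thickLift (twist D (thickProj X (Fin 2)) (eps X 0) (eps_mul _ _)) (fun _ => eps X 1)
    (fun _ _ => eps_mul _ _)

lemma thickMul_proj : thickMul X ≫ thickProj X Unit = thickProj X (Fin 2) := thickLift_proj _ _ _
lemma thickFst_proj : thickFst X ≫ thickProj X Unit = thickProj X (Fin 2) := thickLift_proj _ _ _

lemma flowSnd_proj : D.flowSnd ≫ thickProj X Unit = thickFst X ≫ D.flow :=
  (thickLift_proj _ _ _).trans (thickLift_flow D _ _ _).symm

lemma thickMul_flow : thickMul X ≫ D.flow = D.flowSnd ≫ D.flow := by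
  rw [thickMul, SheafDer.flowSnd, thickLift_flow, thickLift_flow, twist_twist D _ _ _ _ (eps_mul _ _)
    (eps_mul _ _)]
  exact eps_mul _ _

variable {Y Z : Scheme.{u}}

/-- Functoriality of `X[ε_i]` in `X`. -/
noncomputable def thickMap (f : X ⟶ Y) (ι : Type) : thick X ι ⟶ thick Y ι :=
  thickLift (thickProj X ι ≫ f) (fun i => eps X i) (fun _ _ => eps_mul _ _)

lemma thickMap_proj (f : X ⟶ Y) (ι : Type) :
    thickMap f ι ≫ thickProj Y ι = thickProj X ι ≫ f := thickLift_proj _ _ _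

lemma thickMap_eps (f : X ⟶ Y) {ι : Type} (i : ι) :
    (thickMap f ι).appTop (eps Y i) = eps X i := thickLift_eps _ _ _ _

lemma thickLift_map {ι : Type} (g : T ⟶ X) (f : X ⟶ Y) (e : ι → Γ(T, ⊤))
    (he : ∀ i j, e i * e j = 0) : thickLift g e he ≫ thickMap f ι = thickLift (g ≫ f) e he := by
  refine thick_hom_ext ?_ fun i => ?_
  · rw [Category.assoc, thickMap_proj, ← Category.assoc, thickLift_proj, thickLift_proj]
  · rw [Scheme.Hom.comp_appTop, CategoryTheory.comp_apply, thickMap_eps, thickLift_eps,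
      thickLift_eps]

lemma thickMap_lift {ι κ : Type} (f : X ⟶ Y) (g : thick Y κ ⟶ Z) (e : ι → Γ(thick Y κ, ⊤))
    (he : ∀ i j, e i * e j = 0) (e' : ι → Γ(thick X κ, ⊤)) (he' : ∀ i j, e' i * e' j = 0)
    (h : ∀ i, (thickMap f κ).appTop (e i) = e' i) :
    thickMap f κ ≫ thickLift g e he = thickLift (thickMap f κ ≫ g) e' he' := by
  refine thick_hom_ext ?_ fun i => ?_
  · rw [Category.assoc, thickLift_proj, thickLift_proj]
  · rw [Scheme.Hom.comp_appTop, CategoryTheory.comp_apply, thickLift_eps, thickLift_eps, h]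

lemma thickMap_id (ι : Type) : thickMap (𝟙 X) ι = 𝟙 (thick X ι) := by
  refine thick_hom_ext ?_ fun i => ?_
  · rw [thickMap_proj, Category.id_comp, Category.comp_id]
  · rw [thickMap_eps]
    rfl

lemma thickMap_comp (f : X ⟶ Y) (g : Y ⟶ Z) (ι : Type) :
    thickMap (f ≫ g) ι = thickMap f ι ≫ thickMap g ι := by
  rw [thickMap, thickMap, thickLift_map, Category.assoc]

lemma thickZero_map (f : X ⟶ Y) (ι : Type) :
    thickZero X ι ≫ thickMap f ι = f ≫ thickZero Y ι := by
  refine thick_hom_ext ?_ fun i => ?_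
  · rw [Category.assoc, Category.assoc, thickMap_proj, thickZero_proj, ← Category.assoc,
      thickZero_proj, Category.comp_id, Category.id_comp]
  · rw [Scheme.Hom.comp_appTop, Scheme.Hom.comp_appTop, CategoryTheory.comp_apply,
      CategoryTheory.comp_apply, thickMap_eps, thickZero, thickZero, thickLift_eps, thickLift_eps,
      map_zero]

lemma thickMul_map (f : X ⟶ Y) : thickMul X ≫ thickMap f Unit = thickMap f (Fin 2) ≫ thickMul Y := by
  rw [thickMul, thickMul, thickLift_map, thickMap_lift f _ _ _ (fun _ => eps X 0 + eps X 1)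
    (fun _ _ => eps_add_mul X)]
  · simp only [thickMap_proj]
  · intro i
    rw [map_add, thickMap_eps, thickMap_eps]

lemma thickFst_map (f : X ⟶ Y) : thickFst X ≫ thickMap f Unit = thickMap f (Fin 2) ≫ thickFst Y := by
  rw [thickFst, thickFst, thickLift_map, thickMap_lift f _ _ _ (fun _ => eps X 0)
    (fun _ _ => eps_mul _ _)]
  · simp only [thickMap_proj]
  · intro i
    rw [thickMap_eps]

variable {D} {E : SheafDer Y}

lemma flow_comp {f : X ⟶ Y} (hf : IsDifferential D E f) :
    D.flow ≫ f = thickMap f Unit ≫ E.flow := by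
  exact (twist_comp _ _ _ _ hf).trans (thickLift_flow _ _ _ _).symm

lemma flowSnd_map {f : X ⟶ Y} (hf : IsDifferential D E f) :
    D.flowSnd ≫ thickMap f Unit = thickMap f (Fin 2) ≫ E.flowSnd := by
  rw [SheafDer.flowSnd, SheafDer.flowSnd, thickLift_map, thickMap_lift f _ _ _ (fun _ => eps X 1)
    (fun _ _ => eps_mul _ _)]
  · congr 1
    rw [twist_comp _ _ _ _ hf, comp_twist]
    exact twist_congr _ (thickMap_proj _ _).symm (thickMap_eps _ _).symm _
  · intro i
    rw [thickMap_eps]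

end ThickPrecat

section DSch

/-- An `S`-differential scheme: an `S`-scheme with an `S`-linear derivation of its structure
sheaf. -/
structure DSch (S : Scheme.{u}) where
  X : Over S
  der : SheafDer X.left
  der_base (V : S.Opens) (s : Γ(S, V)) : der.app (X.hom ⁻¹ᵁ V) (X.hom.app V s) = 0

namespace DSch

variable {S : Scheme.{u}}

/-- Morphisms of `S`-differential schemes: `S`-morphisms commuting with the derivations. -/
@[ext]
structure Hom (X Y : DSch S) where
  toOver : X.X ⟶ Y.X
  isDifferential : IsDifferential X.der Y.der toOver.left

instance : Category (DSch S) where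
  Hom := Hom
  id X := ⟨𝟙 _, fun _ _ => rfl⟩
  comp f g := ⟨f.toOver ≫ g.toOver, fun U a => by
    change f.toOver.left.app _ (g.toOver.left.app U _) = _
    rw [g.isDifferential, f.isDifferential]
    rfl⟩

@[ext] lemma hom_ext {X Y : DSch S} {f g : X ⟶ Y} (h : f.toOver = g.toOver) : f = g := Hom.ext h

@[simp] lemma id_toOver (X : DSch S) : Hom.toOver (𝟙 X) = 𝟙 X.X := rfl
@[simp] lemma comp_toOver {X Y Z : DSch S} (f : X ⟶ Y) (g : Y ⟶ Z) :
    (f ≫ g).toOver = f.toOver ≫ g.toOver := rfl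

/-- The underlying `S`-scheme. -/
@[simps]
def forget (S : Scheme.{u}) : DSch S ⥤ Over S where
  obj X := X.X
  map f := f.toOver

/-- The functor `T ↦ (T, 0)`. -/
@[simps]
def const (S : Scheme.{u}) : Over S ⥤ DSch S where
  obj T := ⟨T, ⟨fun _ => 0, fun _ _ => map_zero _⟩, fun _ _ => rfl⟩
  map f := ⟨f, fun _ _ => map_zero _⟩

/-- `X[ε_i]` as an `S`-scheme. -/
noncomputable def thickOver (X : Over S) (ι : Type) : Over S :=
  Over.mk (thickProj X.left ι ≫ X.hom)

lemma thickMap_hom {X Y : Over S} (f : X ⟶ Y) (ι : Type) :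
    thickMap f.left ι ≫ thickProj Y.left ι ≫ Y.hom = thickProj X.left ι ≫ X.hom := by
  rw [← Category.assoc, thickMap_proj, Category.assoc, Over.w]

lemma flow_hom (X : DSch S) : X.der.flow ≫ X.X.hom = thickProj X.X.left Unit ≫ X.X.hom :=
  twist_comp_of_zero _ _ _ _ X.der_base

lemma flowSnd_hom (X : DSch S) : X.der.flowSnd ≫ thickProj X.X.left Unit ≫ X.X.hom =
    thickProj X.X.left (Fin 2) ≫ X.X.hom := by
  rw [reassoc_of% flowSnd_proj, flow_hom, reassoc_of% thickFst_proj]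

/-- The precategory `X[ε₀, ε₁] ⟶ X[ε] ⇉ X` of a differential scheme, with `d₀` the projection and
`d₁ = id + ε δ`. -/
noncomputable def toPrecat (X : DSch S) : Precat (Over S) where
  C₀ := X.X
  C₁ := thickOver X.X Unit
  C₂ := thickOver X.X (Fin 2)
  d₀ := Over.homMk (thickProj X.X.left Unit) rfl
  d₁ := Over.homMk X.der.flow X.flow_hom
  n := Over.homMk (thickZero X.X.left Unit)
    ((Category.assoc _ _ _).symm.trans ((congrArg (· ≫ X.X.hom) thickZero_proj).trans (Category.id_comp _)))
  r₀ := Over.homMk (thickFst X.X.left)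
    ((Category.assoc _ _ _).symm.trans (congrArg (· ≫ X.X.hom) thickFst_proj))
  r₁ := Over.homMk X.der.flowSnd X.flowSnd_hom
  m := Over.homMk (thickMul X.X.left)
    ((Category.assoc _ _ _).symm.trans (congrArg (· ≫ X.X.hom) thickMul_proj))
  n_d₀ := by ext1; exact thickZero_proj
  n_d₁ := by ext1; exact thickZero_flow _
  r₁_d₀ := by ext1; exact flowSnd_proj _
  m_d₀ := by ext1; exact thickMul_proj.trans thickFst_proj.symm
  m_d₁ := by ext1; exact thickMul_flow _

/-- The precategory of a differential scheme, as a functor. -/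
noncomputable def precat (S : Scheme.{u}) : DSch S ⥤ Precat (Over S) where
  obj X := X.toPrecat
  map {X Y} f :=
    { f₀ := f.toOver
      f₁ := Over.homMk (thickMap f.toOver.left Unit) (thickMap_hom f.toOver _)
      f₂ := Over.homMk (thickMap f.toOver.left (Fin 2)) (thickMap_hom f.toOver _)
      d₀ := by ext1; exact (thickMap_proj _ _).symm
      d₁ := by ext1; exact flow_comp f.isDifferential
      n := by ext1; exact thickZero_map _ _
      r₀ := by ext1; exact thickFst_map _
      r₁ := by ext1; exact flowSnd_map f.isDifferential
      m := by ext1; exact thickMul_map _ }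
  map_id X := by
    refine Precat.Hom.ext rfl ?_ ?_
    · ext1; exact thickMap_id _
    · ext1; exact thickMap_id _
  map_comp f g := by
    refine Precat.Hom.ext rfl ?_ ?_
    · ext1; exact thickMap_comp _ _ _
    · ext1; exact thickMap_comp _ _ _

section Pullback

variable {X Y Z : DSch S} (f : X ⟶ Z) (g : Y ⟶ Z)

lemma pullFlow_aux :
    (thickMap (pullback.fst f.toOver.left g.toOver.left) Unit ≫ X.der.flow) ≫ f.toOver.left =
    (thickMap (pullback.snd f.toOver.left g.toOver.left) Unit ≫ Y.der.flow) ≫ g.toOver.left := by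
  rw [Category.assoc, Category.assoc, flow_comp f.isDifferential, flow_comp g.isDifferential,
    ← Category.assoc, ← Category.assoc, ← thickMap_comp, ← thickMap_comp, pullback.condition]

/-- The morphism `id + ε δ` of a fibre product, componentwise. -/
noncomputable def pullFlow : thick (pullback f.toOver.left g.toOver.left) Unit ⟶
    pullback f.toOver.left g.toOver.left :=
  pullback.lift _ _ (pullFlow_aux f g)

lemma pullFlow_fst : pullFlow f g ≫ pullback.fst _ _ = thickMap (pullback.fst _ _) Unit ≫ X.der.flow :=
  pullback.lift_fst _ _ _
lemma pullFlow_snd : pullFlow f g ≫ pullback.snd _ _ = thickMap (pullback.snd _ _) Unit ≫ Y.der.flow :=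
  pullback.lift_snd _ _ _

lemma thickZero_pullFlow : thickZero _ Unit ≫ pullFlow f g = 𝟙 _ := by
  refine pullback.hom_ext ?_ ?_
  · rw [Category.assoc, pullFlow_fst, ← Category.assoc, thickZero_map, Category.assoc,
      thickZero_flow, Category.comp_id, Category.id_comp]
  · rw [Category.assoc, pullFlow_snd, ← Category.assoc, thickZero_map, Category.assoc,
      thickZero_flow, Category.comp_id, Category.id_comp]

/-- The derivation on the fibre product. -/
noncomputable def pullDer : SheafDer (pullback f.toOver.left g.toOver.left) :=
  SheafDer.ofSection (pullFlow f g) (thickZero_pullFlow f g)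

lemma pullDer_flow : (pullDer f g).flow = pullFlow f g := twist_ofSection _ _

lemma isDifferential_iff_flow {X Y : Scheme.{u}} (D : SheafDer X) (E : SheafDer Y) (f : X ⟶ Y) :
    IsDifferential D E f ↔ D.flow ≫ f = thickMap f Unit ≫ E.flow := by
  rw [isDifferential_iff]
  refine Eq.congr_right ?_
  exact (thickLift_flow _ _ _ _).symm

lemma isDifferential_fst : IsDifferential (pullDer f g) X.der (pullback.fst _ _) := by
  rw [isDifferential_iff_flow, pullDer_flow, pullFlow_fst]

lemma isDifferential_snd : IsDifferential (pullDer f g) Y.der (pullback.snd _ _) := by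
  rw [isDifferential_iff_flow, pullDer_flow, pullFlow_snd]

lemma isDifferential_lift {T : Scheme.{u}} (D : SheafDer T)
    (t : T ⟶ pullback f.toOver.left g.toOver.left)
    (h₁ : IsDifferential D X.der (t ≫ pullback.fst _ _))
    (h₂ : IsDifferential D Y.der (t ≫ pullback.snd _ _)) : IsDifferential D (pullDer f g) t := by
  rw [isDifferential_iff_flow] at h₁ h₂ ⊢
  rw [pullDer_flow]
  refine pullback.hom_ext ?_ ?_
  · rw [Category.assoc, Category.assoc, h₁, pullFlow_fst, thickMap_comp, Category.assoc]
  · rw [Category.assoc, Category.assoc, h₂, pullFlow_snd, thickMap_comp, Category.assoc]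

/-- The fibre product of differential schemes. -/
noncomputable def pullbackObj : DSch S where
  X := Over.mk (pullback.fst f.toOver.left g.toOver.left ≫ X.X.hom)
  der := pullDer f g
  der_base V s := by
    change (pullDer f g).app (pullback.fst f.toOver.left g.toOver.left ⁻¹ᵁ (X.X.hom ⁻¹ᵁ V))
      ((pullback.fst f.toOver.left g.toOver.left).app _ (X.X.hom.app V s)) = 0
    rw [← isDifferential_fst, X.der_base, map_zero]

/-- The first projection. -/
noncomputable def pullbackFst : pullbackObj f g ⟶ X where
  toOver := Over.homMk (pullback.fst f.toOver.left g.toOver.left) rfl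
  isDifferential := isDifferential_fst f g

/-- The second projection. -/
noncomputable def pullbackSnd : pullbackObj f g ⟶ Y where
  toOver := Over.homMk (pullback.snd f.toOver.left g.toOver.left) (by
    change _ = pullback.fst f.toOver.left g.toOver.left ≫ X.X.hom
    rw [← Over.w f.toOver, ← Over.w g.toOver, pullback.condition_assoc]
    rfl)
  isDifferential := isDifferential_snd f g

lemma isPullback : IsPullback (pullbackFst f g) (pullbackSnd f g) f g := by
  refine ⟨⟨hom_ext (Over.OverMorphism.ext pullback.condition)⟩, ⟨PullbackCone.IsLimit.mk _ ?_ ?_ ?_ ?_⟩⟩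
  · intro s
    have hw : s.fst.toOver.left ≫ f.toOver.left = s.snd.toOver.left ≫ g.toOver.left :=
      congrArg (fun h => (Hom.toOver h).left) s.condition
    exact
      { toOver := Over.homMk (pullback.lift s.fst.toOver.left s.snd.toOver.left hw)
          ((Category.assoc _ _ _).symm.trans
            ((congrArg (· ≫ X.X.hom) (pullback.lift_fst _ _ hw)).trans (Over.w s.fst.toOver)))
        isDifferential := isDifferential_lift f g _ _
          ((pullback.lift_fst _ _ hw).symm ▸ s.fst.isDifferential)
          ((pullback.lift_snd _ _ hw).symm ▸ s.snd.isDifferential) }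
  · intro s
    exact hom_ext (Over.OverMorphism.ext (pullback.lift_fst _ _ _))
  · intro s
    exact hom_ext (Over.OverMorphism.ext (pullback.lift_snd _ _ _))
  · intro s m h₁ h₂
    refine hom_ext (Over.OverMorphism.ext (pullback.hom_ext ?_ ?_))
    · exact (congrArg (fun h => (Hom.toOver h).left) h₁).trans (pullback.lift_fst _ _ _).symm
    · exact (congrArg (fun h => (Hom.toOver h).left) h₂).trans (pullback.lift_snd _ _ _).symm

instance : HasPullbacks (DSch S) :=
  have {X Y Z : DSch S} {f : X ⟶ Z} {g : Y ⟶ Z} : HasLimit (cospan f g) :=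
    (isPullback f g).hasPullback
  hasPullbacks_of_hasLimit_cospan _

end Pullback

end DSch
end DSch

section Coequalizers

/-- The fork `a, b ⇉ c` commutes and is a coequaliser. -/
def IsCoeq {C : Type u₁} [Category.{v₁} C] {A B Q : C} (a b : A ⟶ B) (c : B ⟶ Q) : Prop :=
  ∃ w : a ≫ c = b ≫ c, Nonempty (IsColimit (Cofork.ofπ c w))

end Coequalizers

namespace Precat

variable {C : Type u₁} [Category.{v₁} C]

/-- The image of a precategory under a functor. -/
@[simps]
def mapFunctor {D : Type*} [Category* D] (G : Precat C) (F : C ⥤ D) : Precat D where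
  C₀ := F.obj G.C₀
  C₁ := F.obj G.C₁
  C₂ := F.obj G.C₂
  d₀ := F.map G.d₀
  d₁ := F.map G.d₁
  n := F.map G.n
  r₀ := F.map G.r₀
  r₁ := F.map G.r₁
  m := F.map G.m
  n_d₀ := by rw [← F.map_comp, G.n_d₀, F.map_id]
  n_d₁ := by rw [← F.map_comp, G.n_d₁, F.map_id]
  r₁_d₀ := by rw [← F.map_comp, G.r₁_d₀, F.map_comp]
  m_d₀ := by rw [← F.map_comp, G.m_d₀, F.map_comp]
  m_d₁ := by rw [← F.map_comp, G.m_d₁, F.map_comp]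

/-- A precategory whose objects lie in a full subcategory, as a precategory in it. -/
@[simps]
def lift (G : Precat C) (P : ObjectProperty C) (h₀ : P G.C₀) (h₁ : P G.C₁) (h₂ : P G.C₂) :
    Precat P.FullSubcategory where
  C₀ := ⟨G.C₀, h₀⟩
  C₁ := ⟨G.C₁, h₁⟩
  C₂ := ⟨G.C₂, h₂⟩
  d₀ := ObjectProperty.homMk G.d₀
  d₁ := ObjectProperty.homMk G.d₁
  n := ObjectProperty.homMk G.n
  r₀ := ObjectProperty.homMk G.r₀
  r₁ := ObjectProperty.homMk G.r₁
  m := ObjectProperty.homMk G.m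
  n_d₀ := by ext; exact G.n_d₀
  n_d₁ := by ext; exact G.n_d₁
  r₁_d₀ := by ext; exact G.r₁_d₀
  m_d₀ := by ext; exact G.m_d₀
  m_d₁ := by ext; exact G.m_d₁

/-- The kernel-pair precategory `X ×_Y X ×_Y X ⟶ X ×_Y X ⇉ X` of a morphism. -/
@[simps]
noncomputable def kernel [HasPullbacks C] {X Y : C} (f : X ⟶ Y) : Precat C where
  C₀ := X
  C₁ := pullback f f
  C₂ := pullback (pullback.snd f f) (pullback.fst f f)
  d₀ := pullback.fst f f
  d₁ := pullback.snd f f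
  n := pullback.lift (𝟙 X) (𝟙 X) rfl
  r₀ := pullback.fst _ _
  r₁ := pullback.snd _ _
  m := pullback.lift (pullback.fst _ _ ≫ pullback.fst f f) (pullback.snd _ _ ≫ pullback.snd f f)
    (by rw [Category.assoc, pullback.condition, pullback.condition_assoc, Category.assoc,
      pullback.condition])
  n_d₀ := pullback.lift_fst _ _ _
  n_d₁ := pullback.lift_snd _ _ _
  r₁_d₀ := pullback.condition.symm
  m_d₀ := pullback.lift_fst _ _ _
  m_d₁ := pullback.lift_snd _ _ _

/-- A precategory is an internal groupoid: `C₂` is the object of composable pairs, composition is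
unital and associative (on generalized elements), and every arrow has an inverse. -/
structure IsGroupoid (G : Precat C) : Prop where
  isPullback : IsPullback G.r₀ G.r₁ G.d₁ G.d₀
  id_comp {T : C} (a : T ⟶ G.C₁) (c : T ⟶ G.C₂) (h₀ : c ≫ G.r₀ = a ≫ G.d₀ ≫ G.n)
    (h₁ : c ≫ G.r₁ = a) : c ≫ G.m = a
  comp_id {T : C} (a : T ⟶ G.C₁) (c : T ⟶ G.C₂) (h₀ : c ≫ G.r₀ = a)
    (h₁ : c ≫ G.r₁ = a ≫ G.d₁ ≫ G.n) : c ≫ G.m = a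
  assoc {T : C} (p q s t : T ⟶ G.C₂) (h : p ≫ G.r₁ = q ≫ G.r₀) (hs₀ : s ≫ G.r₀ = p ≫ G.m)
    (hs₁ : s ≫ G.r₁ = q ≫ G.r₁) (ht₀ : t ≫ G.r₀ = p ≫ G.r₀) (ht₁ : t ≫ G.r₁ = q ≫ G.m) :
    s ≫ G.m = t ≫ G.m
  inverse : ∃ (i : G.C₁ ⟶ G.C₁) (l r : G.C₁ ⟶ G.C₂), i ≫ G.d₀ = G.d₁ ∧ i ≫ G.d₁ = G.d₀ ∧
    (l ≫ G.r₀ = 𝟙 _ ∧ l ≫ G.r₁ = i ∧ l ≫ G.m = G.d₀ ≫ G.n) ∧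
    (r ≫ G.r₀ = i ∧ r ≫ G.r₁ = 𝟙 _ ∧ r ≫ G.m = G.d₁ ≫ G.n)

end Precat

namespace Action

variable {C : Type u₁} [Category.{v₁} C] {F : Pseudofunctor (LocallyDiscrete Cᵒᵖ) Cat.{v, w}}
  {G : Precat C} (A : Action F G)

/-- The object of arrows `d₀^* A` of an action, in the total category of `F`. -/
@[simps]
def total₁ : Pseudofunctor.CoGrothendieck F where
  base := G.C₁
  fiber := (F.map G.d₀.op.toLoc).toFunctor.obj A.obj

/-- The object of objects of an action, in the total category of `F`. -/
@[simps]
def total₀ : Pseudofunctor.CoGrothendieck F where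
  base := G.C₀
  fiber := A.obj

/-- The source morphism of an action, in the total category of `F`; it is cartesian over `d₀`. -/
def src : A.total₁ ⟶ A.total₀ where
  base := G.d₀
  fiber := 𝟙 _

/-- The target morphism of an action, in the total category of `F`; it is the composite of the
action isomorphism and the cartesian morphism over `d₁`. -/
def tgt : A.total₁ ⟶ A.total₀ where
  base := G.d₁
  fiber := A.iso.hom

end Action

namespace DSch

variable {S : Scheme.{u}}

/-- The differential scheme `X` has a categorical scheme of leaves. -/
abbrev HasLeaves (X : DSch S) : Prop := (const S).leftAdjointObjIsDefined X

/-- The categorical scheme of leaves of `X`. -/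
noncomputable abbrev leaves (X : DSch S) (h : HasLeaves X) : Over S :=
  (const S).partialLeftAdjointObj ⟨X, h⟩

/-- The universal differential morphism from `X` to a scheme with zero derivation. -/
noncomputable def eta (X : DSch S) (h : HasLeaves X) : X ⟶ (const S).obj (X.leaves h) :=
  (const S).partialLeftAdjointHomEquiv (X := ⟨X, h⟩) (𝟙 _)

/-- A differential morphism to a scheme with zero derivation coequalises the two structure
maps of the source. -/
lemma toPrecat_condition {X : DSch S} {T : Over S} (g : X ⟶ (const S).obj T) :
    X.toPrecat.d₀ ≫ g.toOver = X.toPrecat.d₁ ≫ g.toOver := by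
  ext1
  exact (twist_comp_of_zero X.der _ _ (eps_mul _ _)
    (fun U a => (g.isDifferential U a).symm.trans (map_zero _))).symm

variable (P : Pseudofunctor (LocallyDiscrete (Over S)ᵒᵖ) Cat.{v, w})

/-- The pseudofunctor `δ↓P`: its value at `X` is the category of `P`-actions of the precategory
of `X`. -/
noncomputable abbrev delta : Pseudofunctor (LocallyDiscrete (DSch S)ᵒᵖ) Cat.{v, max w v} :=
  Action.actions (F := P) (precat S)

/-- Descent for `δ↓P`: the comparison functor from `δ↓P(Y)` to the category of descent data, i.e.
actions of the kernel-pair groupoid of `f` in `δ↓P`, is an equivalence. -/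
def IsEffectiveDescent {X Y : DSch S} (f : X ⟶ Y) : Prop :=
  (Action.augment (delta P) (Precat.kernel f) f pullback.condition).IsEquivalence

/-- The functor `C_X : P(π₀(X)) ⥤ δ↓P(X)`. -/
noncomputable abbrev constFunctor (X : DSch S) (h : HasLeaves X) :
    P.obj ⟨op (X.leaves h)⟩ ⥤ Action P X.toPrecat :=
  Action.augment P X.toPrecat (X.eta h).toOver (toPrecat_condition _)

/-- The projection of `C_X(Q)` to `Q`, in the total category of `P`; it is cartesian over `η`. -/
noncomputable def constProj (X : DSch S) (h : HasLeaves X) (Q : P.obj ⟨op (X.leaves h)⟩) :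
    ((constFunctor P X h).obj Q).total₀ ⟶ ⟨X.leaves h, Q⟩ where
  base := (X.eta h).toOver
  fiber := 𝟙 _

/-- `X` is simple with respect to `P`: the categorical scheme of leaves exists and the coequaliser
`X₁ ⇉ X₀ ⟶ π₀(X)` is universal for `P`, i.e. for every `Q` in `P(π₀(X))` the fork
`η₁^* Q ⇉ η₀^* Q ⟶ Q` is a coequaliser in the total category of `P`. -/
structure IsSimple (X : DSch S) : Prop where
  hasLeaves : HasLeaves X
  isCoeq : IsCoeq X.toPrecat.d₀ X.toPrecat.d₁ (X.eta hasLeaves).toOver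
  universal (Q : P.obj ⟨op (X.leaves hasLeaves)⟩) :
    IsCoeq ((constFunctor P X hasLeaves).obj Q).src ((constFunctor P X hasLeaves).obj Q).tgt
      (constProj P X hasLeaves Q)

variable {X Y : DSch S} (f : X ⟶ Y)

/-- The objects `A` of `δ↓P(Y)` that are `C`-split by `f`: `f^* A ≅ C_X(Q)` for some
`Q` in `P(π₀(X))`. -/
def split (h : HasLeaves X) : ObjectProperty ((delta P).obj ⟨op Y⟩) := fun A =>
  ∃ Q : P.obj ⟨op (X.leaves h)⟩,
    Nonempty (((delta P).map f.op.toLoc).toFunctor.obj A ≅ (constFunctor P X h).obj Q)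

/-- Pre-Picard-Vessiot morphisms with respect to `P`. Here `(Precat.kernel f).C₀ = X`,
`C₁ = X ×_Y X` and `C₂ = X ×_Y X ×_Y X`. -/
structure IsPrePicardVessiot : Prop where
  leaves_source : HasLeaves X
  leaves_target : HasLeaves Y
  effectiveDescent : IsEffectiveDescent P f
  simple₀ : IsSimple P (Precat.kernel f).C₀
  simple₁ : IsSimple P (Precat.kernel f).C₁
  simple₂ : IsSimple P (Precat.kernel f).C₂

variable {P f} in
/-- The Galois precategory `π₀` of the kernel-pair groupoid of `f`. -/
noncomputable def gal (h : IsPrePicardVessiot P f) : Precat (Over S) :=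
  ((Precat.kernel f).lift _ h.simple₀.hasLeaves h.simple₁.hasLeaves
    h.simple₂.hasLeaves).mapFunctor (const S).partialLeftAdjoint

lemma eta_naturality {X Y : (const S).PartialLeftAdjointSource} (g : X ⟶ Y) :
    g.hom.toOver ≫ (Y.obj.eta Y.property).toOver =
      (X.obj.eta X.property).toOver ≫ (const S).partialLeftAdjoint.map g := by
  have h : g.hom ≫ Y.obj.eta Y.property =
      X.obj.eta X.property ≫ (const S).map ((const S).partialLeftAdjoint.map g) :=
    ((const S).partialLeftAdjointHomEquiv_map g).symm.trans
      ((congrArg _ (Category.id_comp _).symm).trans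
        ((const S).partialLeftAdjointHomEquiv_comp (X := X) (𝟙 _) _))
  exact congrArg Hom.toOver h

variable {P f} in
/-- The canonical morphism from the kernel-pair groupoid of `f` to the Galois precategory. -/
noncomputable def toGal (h : IsPrePicardVessiot P f) :
    (Precat.kernel f).mapFunctor (forget S) ⟶ gal h where
  f₀ := (eta _ h.simple₀.hasLeaves).toOver
  f₁ := (eta _ h.simple₁.hasLeaves).toOver
  f₂ := (eta _ h.simple₂.hasLeaves).toOver
  d₀ := eta_naturality (Precat.d₀ (Precat.lift (Precat.kernel f) _ _ _ _))
  d₁ := eta_naturality (Precat.d₁ (Precat.lift (Precat.kernel f) _ _ _ _))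
  n := eta_naturality (Precat.n (Precat.lift (Precat.kernel f) _ _ _ _))
  r₀ := eta_naturality (Precat.r₀ (Precat.lift (Precat.kernel f) _ _ _ _))
  r₁ := eta_naturality (Precat.r₁ (Precat.lift (Precat.kernel f) _ _ _ _))
  m := eta_naturality (Precat.m (Precat.lift (Precat.kernel f) _ _ _ _))

variable {P f} in
/-- The Galois equivalence: there is an equivalence `E` from the category of objects of `δ↓P(Y)`
that are `C`-split by `f` to the category of `P`-actions of the Galois precategory which is induced
by `f`, in the sense that there are natural isomorphisms `θ : C_X(E(A)) ≅ f^* A` in `δ↓P(X)`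
that identify the action on `E(A)`, pulled back along `toGal h`, with the canonical descent datum
of `f^* A`. -/
def GaloisEquivalence (h : IsPrePicardVessiot P f) : Prop :=
  ∃ (E : (split P f h.leaves_source).FullSubcategory ≌ Action P (gal h))
    (θ : E.functor ⋙ Action.forget P (gal h) ⋙ constFunctor P X h.leaves_source ≅
      (split P f h.leaves_source).ι ⋙ ((delta P).map f.op.toLoc).toFunctor)
    (θ' : E.functor ⋙ Action.pull P (toGal h) ≅
      (split P f h.leaves_source).ι ⋙ Action.forget P Y.toPrecat ⋙
        Action.augment P ((Precat.kernel f).mapFunctor (forget S)) f.toOver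
          (congrArg Hom.toOver (pullback.condition (f := f) (g := f)))),
    ∀ A, (θ.hom.app A).hom = (θ'.hom.app A).hom

end DSch

section SelfIndexing

variable {C : Type u₁} [Category.{v₁} C] (W : MorphismProperty C)

lemma over_hom_ext {X : C} {A B : W.Over ⊤ X} {f g : A ⟶ B} (h : f.left = g.left) : f = g :=
  MorphismProperty.Over.Hom.ext h

variable [HasPullbacks C] [W.IsStableUnderBaseChange]

/-- The fibre product with an identity. -/
noncomputable def pullbackIdIso {A X : C} (a : A ⟶ X) (p : X ⟶ X) (hp : p = 𝟙 X) :
    pullback a p ≅ A where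
  hom := pullback.fst a p
  inv := pullback.lift (𝟙 A) a (by rw [hp, Category.comp_id, Category.id_comp])
  hom_inv_id := by
    subst hp
    refine pullback.hom_ext ?_ ?_
    · rw [Category.assoc, pullback.lift_fst, Category.comp_id, Category.id_comp]
    · rw [Category.assoc, pullback.lift_snd, pullback.condition, Category.comp_id, Category.id_comp]
  inv_hom_id := pullback.lift_fst _ _ _

/-- Base change along the identity. -/
noncomputable def overPullbackId {X : C} (p : X ⟶ X) (hp : p = 𝟙 X) :
    MorphismProperty.Over.pullback W ⊤ p ≅ 𝟭 (W.Over ⊤ X) :=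
  NatIso.ofComponents (fun A => MorphismProperty.Over.isoMk (pullbackIdIso A.hom p hp)
      (pullback.condition.trans ((congrArg _ hp).trans (Category.comp_id _))))
    (fun g => by ext; exact pullback.lift_fst _ _ _)

/-- Base change along a composite. -/
noncomputable def overPullbackComp {X Y Z : C} (f : X ⟶ Y) (g : Y ⟶ Z) (k : X ⟶ Z)
    (hk : f ≫ g = k) : MorphismProperty.Over.pullback W ⊤ k ≅
      MorphismProperty.Over.pullback W ⊤ g ⋙ MorphismProperty.Over.pullback W ⊤ f :=
  MorphismProperty.Over.pullbackComp f g k hk.symm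

@[simp] lemma overPullbackId_hom_left {X : C} (p : X ⟶ X) (hp : p = 𝟙 X) (A : W.Over ⊤ X) :
   ((overPullbackId W p hp).hom.app A).left = pullback.fst A.hom p := rfl

@[simp] lemma overPullbackComp_hom_fst {X Y Z : C} (f : X ⟶ Y) (g : Y ⟶ Z) (k : X ⟶ Z)
    (hk : f ≫ g = k) (A : W.Over ⊤ Z) :
   ((overPullbackComp W f g k hk).hom.app A).left ≫ pullback.fst _ _ ≫ pullback.fst _ _ = pullback.fst _ _ := by
  subst hk
  exact MorphismProperty.Over.pullbackComp_left_fst_fst f g A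

@[simp] lemma overPullbackComp_hom_snd {X Y Z : C} (f : X ⟶ Y) (g : Y ⟶ Z) (k : X ⟶ Z)
    (hk : f ≫ g = k) (A : W.Over ⊤ Z) :
   ((overPullbackComp W f g k hk).hom.app A).left ≫ pullback.snd _ _ = pullback.snd _ _ :=
  MorphismProperty.Over.w ((overPullbackComp W f g k hk).hom.app A)

lemma over_pullback_hom_ext {X Z : C} (f : X ⟶ Z) {A : W.Over ⊤ Z} {B : W.Over ⊤ X}
    {u v : B ⟶ (MorphismProperty.Over.pullback W ⊤ f).obj A}
    (h : u.left ≫ pullback.fst A.hom f = v.left ≫ pullback.fst A.hom f) : u = v := by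
  refine over_hom_ext W (pullback.hom_ext h ?_)
  exact (MorphismProperty.Over.w u).trans (MorphismProperty.Over.w v).symm

lemma overPullback_map_fst {X Z : C} (f : X ⟶ Z) {A B : W.Over ⊤ Z} (u : A ⟶ B) :
    ((MorphismProperty.Over.pullback W ⊤ f).map u).left ≫ pullback.fst B.hom f =
      pullback.fst A.hom f ≫ u.left :=
  pullback.lift_fst _ _ _

lemma overPullback_fst_hom {X Z : C} (f : X ⟶ Z) {A : W.Over ⊤ Z} {B : W.Over ⊤ X}
    (u : B ⟶ (MorphismProperty.Over.pullback W ⊤ f).obj A) :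
    (u.left ≫ pullback.fst A.hom f) ≫ A.hom = B.hom ≫ f :=
  (Category.assoc _ _ _).trans ((congrArg _ pullback.condition).trans
    ((Category.assoc _ _ _).symm.trans (congrArg (· ≫ f) (MorphismProperty.Over.w u))))

lemma over_pullback_hom_ext₂ {X Y Z : C} (f : X ⟶ Y) (g : Y ⟶ Z) {A : W.Over ⊤ Z} {B : W.Over ⊤ X}
    {u v : B ⟶ (MorphismProperty.Over.pullback W ⊤ f).obj
      ((MorphismProperty.Over.pullback W ⊤ g).obj A)}
    (h : u.left ≫ pullback.fst (pullback.snd A.hom g) f ≫ pullback.fst A.hom g =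
      v.left ≫ pullback.fst (pullback.snd A.hom g) f ≫ pullback.fst A.hom g) : u = v := by
  refine over_pullback_hom_ext W _ (pullback.hom_ext ?_ ?_)
  · exact (Category.assoc _ _ _).trans (h.trans (Category.assoc _ _ _).symm)
  · exact (overPullback_fst_hom W f u).trans (overPullback_fst_hom W f v).symm

lemma pullback_fst_comp_eq {T A X Z : C} {p : A ⟶ Z} {g : X ⟶ Z} (a b : T ⟶ pullback p g)
    (h : a ≫ pullback.snd p g = b ≫ pullback.snd p g) :
    (a ≫ pullback.fst p g) ≫ p = (b ≫ pullback.fst p g) ≫ p := by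
  rw [Category.assoc, Category.assoc, pullback.condition, reassoc_of% h]

lemma over_pullback_hom_ext₃ {X Y Z T : C} (f : X ⟶ Y) (g : Y ⟶ Z) (k : Z ⟶ T) {A : W.Over ⊤ T}
    {B : W.Over ⊤ X} {u v : B ⟶ (MorphismProperty.Over.pullback W ⊤ f).obj
      ((MorphismProperty.Over.pullback W ⊤ g).obj ((MorphismProperty.Over.pullback W ⊤ k).obj A))}
    (h : u.left ≫ pullback.fst (pullback.snd (pullback.snd A.hom k) g) f ≫
        pullback.fst (pullback.snd A.hom k) g ≫ pullback.fst A.hom k =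
      v.left ≫ pullback.fst (pullback.snd (pullback.snd A.hom k) g) f ≫
        pullback.fst (pullback.snd A.hom k) g ≫ pullback.fst A.hom k) : u = v := by
  refine over_pullback_hom_ext₂ W _ _ (pullback.hom_ext ?_ ?_)
  · refine (Category.assoc _ _ _).trans (Eq.trans ?_ (Category.assoc _ _ _).symm)
    exact (congrArg _ (Category.assoc _ _ _)).trans
      (h.trans (congrArg _ (Category.assoc _ _ _).symm))
  · have hu := overPullback_fst_hom W f u
    have hv := overPullback_fst_hom W f v
    refine (congrArg (· ≫ _) (Category.assoc _ _ _).symm).trans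
      (Eq.trans ?_ (congrArg (· ≫ _) (Category.assoc _ _ _)))
    exact pullback_fst_comp_eq _ _ (hu.trans hv.symm)

lemma overPullbackComp_assoc {A B D E : C} (f : D ⟶ E) (g : B ⟶ D) (h : A ⟶ B) (gf : B ⟶ E)
    (hg : A ⟶ D) (k : A ⟶ E) (h₁ : g ≫ f = gf) (h₂ : h ≫ g = hg) (h₃ : h ≫ gf = k)
    (h₄ : hg ≫ f = k) (M : W.Over ⊤ E) :
    (overPullbackComp W h gf k h₃).hom.app M ≫
      (MorphismProperty.Over.pullback W ⊤ h).map ((overPullbackComp W g f gf h₁).hom.app M) =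
    (overPullbackComp W hg f k h₄).hom.app M ≫ (overPullbackComp W h g hg h₂).hom.app _ := by
  refine over_pullback_hom_ext₃ W _ _ _ ?_
  have e₁ := overPullbackComp_hom_fst W h gf k h₃ M
  have e₂ := overPullbackComp_hom_fst W g f gf h₁ M
  have e₃ := overPullbackComp_hom_fst W hg f k h₄ M
  have e₄ := overPullbackComp_hom_fst W h g hg h₂ ((MorphismProperty.Over.pullback W ⊤ f).obj M)
  have e₅ := overPullback_map_fst W h ((overPullbackComp W g f gf h₁).hom.app M)
  refine Eq.trans (b := pullback.fst M.hom k) ?_ ?_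
  · refine (Category.assoc _ _ _).trans ?_
    refine Eq.trans ?_ e₁
    refine congrArg _ ?_
    refine (Category.assoc _ _ _).symm.trans ?_
    refine (congrArg (· ≫ _) e₅).trans ?_
    refine (Category.assoc _ _ _).trans (congrArg _ e₂)
  · refine Eq.trans e₃.symm ?_
    refine Eq.trans ?_ (Category.assoc _ _ _).symm
    refine congrArg _ ?_
    refine Eq.trans (congrArg (· ≫ _) e₄.symm) ?_
    exact (Category.assoc _ _ _).trans (congrArg _ (Category.assoc _ _ _))

lemma overPullback_assoc {A B D E : C} (f : D ⟶ E) (g : B ⟶ D) (h : A ⟶ B) (gf : B ⟶ E)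
    (hg : A ⟶ D) (k k' : A ⟶ E) (h₁ : g ≫ f = gf) (h₂ : h ≫ g = hg) (h₃ : h ≫ gf = k)
    (h₄ : hg ≫ f = k')
    (hk : MorphismProperty.Over.pullback W ⊤ k = MorphismProperty.Over.pullback W ⊤ k') :
    (overPullbackComp W h gf k h₃).hom ≫
      Functor.whiskerRight (overPullbackComp W g f gf h₁).hom
        (MorphismProperty.Over.pullback W ⊤ h) ≫
      (Functor.associator _ _ _).hom ≫ Functor.whiskerLeft _ (overPullbackComp W h g hg h₂).inv ≫
      (overPullbackComp W hg f k' h₄).inv = eqToHom hk := by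
  obtain rfl : k = k' := by rw [← h₃, ← h₄, ← h₁, ← h₂, Category.assoc]
  refine NatTrans.ext (funext fun M => ?_)
  have e := overPullbackComp_assoc W f g h gf hg k h₁ h₂ h₃ h₄ M
  simp only [eqToHom_refl]
  refine (Category.assoc _ _ _).symm.trans ?_
  refine (congrArg (· ≫ _) e).trans ?_
  refine (Category.assoc _ _ _).trans ?_
  refine (congrArg _ (congrArg _ (Category.id_comp _))).trans ?_
  refine (congrArg _ ((overPullbackComp W h g hg h₂).hom_inv_id_app_assoc _ _)).trans ?_
  exact (overPullbackComp W hg f k h₄).hom_inv_id_app _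

lemma overPullback_left_unit {A B : C} (f : A ⟶ B) (i : B ⟶ B) (k : A ⟶ B) (hi : i = 𝟙 B)
    (hk : f ≫ i = k)
    (h : MorphismProperty.Over.pullback W ⊤ k = MorphismProperty.Over.pullback W ⊤ f) :
    (overPullbackComp W f i k hk).hom ≫
      Functor.whiskerRight (overPullbackId W i hi).hom (MorphismProperty.Over.pullback W ⊤ f) ≫
      (Functor.leftUnitor _).hom = eqToHom h := by
  obtain rfl : f = k := by rw [← hk, hi, Category.comp_id]
  refine NatTrans.ext (funext fun M => ?_)
  simp only [eqToHom_refl]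
  refine over_pullback_hom_ext W _ ?_
  have e₁ := overPullbackComp_hom_fst W f i f hk M
  have e₂ := overPullback_map_fst W f ((overPullbackId W i hi).hom.app M)
  refine Eq.trans (Eq.trans ?_ e₁) (Category.id_comp _).symm
  refine (Category.assoc _ _ _).trans (congrArg _ ?_)
  refine (congrArg (· ≫ _) (Category.comp_id _)).trans ?_
  exact e₂

lemma overPullback_right_unit {A B : C} (f : A ⟶ B) (i : A ⟶ A) (k : A ⟶ B) (hi : i = 𝟙 A)
    (hk : i ≫ f = k)
    (h : MorphismProperty.Over.pullback W ⊤ k = MorphismProperty.Over.pullback W ⊤ f) :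
    (overPullbackComp W i f k hk).hom ≫
      Functor.whiskerLeft (MorphismProperty.Over.pullback W ⊤ f) (overPullbackId W i hi).hom ≫
      (Functor.rightUnitor _).hom = eqToHom h := by
  obtain rfl : f = k := by rw [← hk, hi, Category.id_comp]
  refine NatTrans.ext (funext fun M => ?_)
  simp only [eqToHom_refl]
  refine over_pullback_hom_ext W _ ?_
  have e₁ := overPullbackComp_hom_fst W i f f hk M
  refine Eq.trans (Eq.trans ?_ e₁) (Category.id_comp _).symm
  refine (Category.assoc _ _ _).trans (congrArg _ ?_)
  exact (congrArg (· ≫ _) (Category.comp_id _))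

open Bicategory in
/-- The full sub-pseudofunctor of the self-indexing of `C` given by a class `W` of morphisms stable
under base change: its value at `Z` is the full subcategory of `Over Z` of morphisms in `W`. -/
noncomputable def selfIndexing : Pseudofunctor (LocallyDiscrete Cᵒᵖ) Cat :=
  LocallyDiscrete.mkPseudofunctor
    (fun X ↦ Cat.of (W.Over ⊤ X.unop))
    (fun f ↦ (MorphismProperty.Over.pullback W ⊤ f.unop).toCatHom)
    (fun X ↦ Cat.Hom.isoMk <| overPullbackId W _ rfl)
    (fun f g ↦ Cat.Hom.isoMk <| overPullbackComp W _ _ _ rfl)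
    (fun f g h ↦ by
      ext1
      refine (overPullback_assoc W _ _ _ _ _ _ _ rfl rfl rfl rfl
        (by simp)).trans ?_
      exact Action.eqToHom_natTrans _ _)
    (fun f ↦ by
      ext1
      refine (overPullback_left_unit W _ _ _ rfl rfl (by simp)).trans ?_
      exact Action.eqToHom_natTrans _ _)
    (fun f ↦ by
      ext1
      refine (overPullback_right_unit W _ _ _ rfl rfl (by simp)).trans ?_
      exact Action.eqToHom_natTrans _ _)

/-- An object of the total category of the self-indexing, as a morphism in `W`. -/
abbrev asOver (A : Pseudofunctor.CoGrothendieck (selfIndexing W)) : W.Over ⊤ A.base := A.fiber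

/-- The fibre component of a morphism in the total category of the self-indexing. -/
abbrev asOverHom {A B : Pseudofunctor.CoGrothendieck (selfIndexing W)} (f : A ⟶ B) :
    asOver W A ⟶ (MorphismProperty.Over.pullback W ⊤ f.base).obj (asOver W B) := f.fiber

/-- The functor sending a morphism `R ⟶ Z` in `W` to its domain `R`. -/
noncomputable def domFunctor : Pseudofunctor.CoGrothendieck (selfIndexing W) ⥤ C where
  obj A := (asOver W A).left
  map {A B} f := (asOverHom W f).left ≫ pullback.fst (asOver W B).hom f.base
  map_id A := congrArg (fun t : asOver W A ⟶ asOver W A => t.left)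
    ((overPullbackId W (𝟙 A.base) rfl).inv_hom_id_app (asOver W A))
  map_comp {A B D} f g := by
    have e₁ : ((overPullbackComp W f.base g.base (f.base ≫ g.base) rfl).inv.app
        (asOver W D)).left ≫ pullback.fst (asOver W D).hom (f.base ≫ g.base) =
        pullback.fst (pullback.snd (asOver W D).hom g.base) f.base ≫
          pullback.fst (asOver W D).hom g.base := by
      refine (congrArg (_ ≫ ·) (overPullbackComp_hom_fst W f.base g.base _ rfl
        (asOver W D)).symm).trans ((Category.assoc _ _ _).symm.trans ?_)
      refine (congrArg (· ≫ _) (congrArg (fun t : (MorphismProperty.Over.pullback W ⊤ f.base).obj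
        ((MorphismProperty.Over.pullback W ⊤ g.base).obj (asOver W D)) ⟶ _ => t.left)
        ((overPullbackComp W f.base g.base _ rfl).inv_hom_id_app (asOver W D)))).trans ?_
      exact Category.id_comp _
    have e₂ := overPullback_map_fst W f.base (asOverHom W g)
    change ((asOverHom W f).left ≫
      ((MorphismProperty.Over.pullback W ⊤ f.base).map (asOverHom W g)).left ≫
      ((overPullbackComp W f.base g.base (f.base ≫ g.base) rfl).inv.app (asOver W D)).left) ≫
        pullback.fst (asOver W D).hom (f.base ≫ g.base) = _
    refine (Category.assoc _ _ _).trans (Eq.trans ?_ (Category.assoc _ _ _).symm)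
    refine congrArg _ ((Category.assoc _ _ _).trans ((congrArg _ e₁).trans ?_))
    refine (Category.assoc _ _ _).symm.trans ((congrArg (· ≫ _) e₂).trans ?_)
    exact Category.assoc _ _ _

end SelfIndexing

/-- The fork `a, b ⇉ c` is a coequaliser, and it remains one after base change along every
morphism `q : R ⟶ Q` in `W`. -/
structure IsUniversalCoeq {C : Type u₁} [Category.{v₁} C] [HasPullbacks C] (W : MorphismProperty C)
    {A B Q : C} (a b : A ⟶ B) (c : B ⟶ Q) : Prop where
  w : a ≫ c = b ≫ c
  isCoeq : IsCoeq a b c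
  universal {R : C} (q : R ⟶ Q) (hq : W q) :
    IsCoeq
      (pullback.lift (pullback.fst (a ≫ c) q ≫ a) (pullback.snd (a ≫ c) q)
        (by rw [Category.assoc, pullback.condition]) : pullback (a ≫ c) q ⟶ pullback c q)
      (pullback.lift (pullback.fst (a ≫ c) q ≫ b) (pullback.snd (a ≫ c) q)
        (by rw [Category.assoc, ← w, pullback.condition]))
      (pullback.snd c q)

namespace DSch

variable {S : Scheme.{u}} (W : MorphismProperty (Over S))

/-- `X` is simple with respect to the sub-pseudofunctor of the self-indexing given by `W`: the
categorical scheme of leaves exists and the coequaliser `X₁ ⇉ X₀ ⟶ π₀(X)` of `S`-schemes is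
universal with respect to base change along morphisms in `W`. -/
structure IsSimpleFor (X : DSch S) : Prop where
  hasLeaves : HasLeaves X
  isUniversalCoeq : IsUniversalCoeq W X.toPrecat.d₀ X.toPrecat.d₁ (X.eta hasLeaves).toOver

/-- `f` is auto-split: it is in `W`, and the differential `X`-scheme `X ×_Y X` is of the form
`C_X(G) = X ×_{C(π₀(X))} C(G)` for some `G ⟶ π₀(X)` in `W`. -/
def IsAutoSplit {X Y : DSch S} (f : X ⟶ Y) (h : HasLeaves X) : Prop :=
  W f.toOver ∧ ∃ (G : Over S) (g : G ⟶ X.leaves h) (t : pullback f f ⟶ (const S).obj G),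
    W g ∧ IsPullback t (pullback.fst f f) ((const S).map g) (X.eta h)

variable [W.IsStableUnderBaseChange] {P : Pseudofunctor (LocallyDiscrete (Over S)ᵒᵖ) Cat.{u, u + 1}}
  (U : Pseudofunctor.StrongTrans P (selfIndexing W))

/-- All components of the transformation `U` are faithful functors. -/
def IsFaithful : Prop := ∀ Z, (U.app Z).toFunctor.Faithful

/-- `δ↓U` reflects coequalisers associated with universal connected components: if a fork
`A₁ ⇉ A₀ ⟶ Q` over `X₁ ⇉ X₀ ⟶ π₀(X)`, given by an object `A` of `δ↓P(X)`, is mapped by `U` to a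
coequaliser of `S`-schemes that is universal for `W`, then it is a coequaliser in the total category
of `P`. -/
def ReflectsUniversalCoeq : Prop :=
  ∀ (X : DSch S) (h : HasLeaves X) (A : Action P X.toPrecat) (Q : P.obj ⟨op (X.leaves h)⟩)
    (r : A.total₀ ⟶ ⟨X.leaves h, Q⟩), r.base = (X.eta h).toOver → A.src ≫ r = A.tgt ≫ r →
    IsUniversalCoeq W
      ((domFunctor W).map ((Pseudofunctor.CoGrothendieck.map U).map A.src))
      ((domFunctor W).map ((Pseudofunctor.CoGrothendieck.map U).map A.tgt))
      ((domFunctor W).map ((Pseudofunctor.CoGrothendieck.map U).map r)) →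
    IsCoeq A.src A.tgt r

/-- Picard-Vessiot morphisms with respect to `U : P ⟶ selfIndexing W`. -/
structure IsPicardVessiot (P : Pseudofunctor (LocallyDiscrete (Over S)ᵒᵖ) Cat.{u, u + 1})
    {X Y : DSch S} (f : X ⟶ Y) : Prop where
  leaves_source : HasLeaves X
  leaves_target : HasLeaves Y
  effectiveDescent : IsEffectiveDescent P f
  simple : IsSimpleFor W X
  autoSplit : IsAutoSplit W f leaves_source

end DSch

end DiffGalois

/-!
The category of `P`-actions of a differential scheme `X` receives the functor `C_X` from `P(π₀(X))`,
`Q ↦ η^* Q` with its canonical action. A morphism `C_X(Q) ⟶ C_X(Q')` is the same as a morphism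
`η^* Q ⟶ Q'` over `η` in the total category of `P` that coequalises the two maps of the canonical
action, so that `P`-simplicity of `X` makes `C_X` fully faithful (`DSch.IsSimple.faithful`,
`DSch.IsSimple.full`).

*The Galois equivalence.* Let `f : X ⟶ Y` be pre-Picard-Vessiot. By effective descent, an object of
`δ↓P(Y)` split by `f` is a descent datum on some `C_X(Q)`. Its isomorphism
`d₀^* C_X(Q) ≅ d₁^* C_X(Q)` over `X ×_Y X` is, since the functors `C` commute with pullbacks
(`DSch.constPullIso`), an isomorphism between two objects in the image of `C_{X ×_Y X}`, and comes
from a unique `d₀^* Q ≅ d₁^* Q` over the arrows of the Galois precategory. The unit and cocycle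
conditions may be checked after pullback along `η` to `X` and to `X ×_Y X ×_Y X`, where `η^*` is
faithful. Hence actions of the Galois precategory correspond to the descent data on objects
`C_X(Q)`: the functor `DSch.galToDescent` is fully faithful, and
`DSch.exists_galToDescent_iso` describes its image.

*Picard-Vessiot morphisms.* Simplicity with respect to the self-indexing implies `P`-simplicity
(`DSch.IsSimpleFor.isSimple`): a transformation from `P` to the self-indexing sends the cartesian
fork `η₁^* Q ⇉ η₀^* Q ⟶ Q` to a base change of `X₁ ⇉ X₀ ⟶ π₀(X)` along a morphism of the class,
which is again a universal coequaliser, and such coequalisers are reflected. It remains to see that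
`X ×_Y X` and `X ×_Y X ×_Y X` are simple. Call `Z' ⟶ Z` split if it is the base change of
`π₀(Z') ⟶ π₀(Z)`, a morphism of the class. As `Z ↦ Z[ε]` commutes with base change, a base change of
`T' ⟶ π₀(Z)` along `η` is simple with scheme of leaves `T'` when `Z` is simple, and therefore
(`DSch.IsSplit.baseChange`) a base change of a split morphism to a simple differential scheme is
simple and split, and `π₀` preserves the fibre product in question. Auto-splitness says that
`X ×_Y X ⟶ X` is split; so are then the projections from the objects of composable pairs and triples
of the kernel pair. As `π₀` preserves these two fibre products, it sends the kernel pair, which is a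
groupoid, to a groupoid (`Precat.IsGroupoid.mapFunctor`).
-/

namespace DiffGalois

/-! ### Coherence of the pullback functors of a pseudofunctor -/

section Coherence
open Pseudofunctor.LocallyDiscreteOpToCat

variable {C : Type u₁} [Category.{v₁} C] (F : Pseudofunctor (LocallyDiscrete Cᵒᵖ) Cat.{v, w})

/-- The pullback functor `f^* : F(Y) ⥤ F(X)` of a contravariant pseudofunctor. -/
abbrev pb {X Y : C} (f : X ⟶ Y) : F.obj ⟨op Y⟩ ⥤ F.obj ⟨op X⟩ := (F.map f.op.toLoc).toFunctor

/-- The structure isomorphism `k^* M ≅ g^* f^* M` for `k = g ≫ f`. The composite has a name of its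
own, with a proof of the equation, because the composites at hand are often equal only
propositionally. -/
def pbComp {X Y Z : C} (f : Y ⟶ Z) (g : X ⟶ Y) (k : X ⟶ Z) (h : g ≫ f = k) (M : F.obj ⟨op Z⟩) :
    (pb F k).obj M ≅ (pb F g).obj ((pb F f).obj M) :=
  (Cat.Hom.toNatIso (F.mapComp' f.op.toLoc g.op.toLoc k.op.toLoc (locComp h))).app M

/-- The structure isomorphism `p^* M ≅ M` for `p = 𝟙`. -/
def pbId {X : C} (p : X ⟶ X) (h : p = 𝟙 X) (M : F.obj ⟨op X⟩) : (pb F p).obj M ≅ M :=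
  (Cat.Hom.toNatIso (F.mapId' p.op.toLoc (locId h))).app M

variable {F}

lemma pbComp_hom_naturality {X Y Z : C} (f : Y ⟶ Z) (g : X ⟶ Y) (k : X ⟶ Z) (h : g ≫ f = k)
    {M N : F.obj ⟨op Z⟩} (a : M ⟶ N) :
    (pb F k).map a ≫ (pbComp F f g k h N).hom =
      (pbComp F f g k h M).hom ≫ (pb F g).map ((pb F f).map a) :=
  F.mapComp'_hom_naturality _ _ _ (locComp h) a

lemma pbComp_inv_naturality {X Y Z : C} (f : Y ⟶ Z) (g : X ⟶ Y) (k : X ⟶ Z) (h : g ≫ f = k)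
    {M N : F.obj ⟨op Z⟩} (a : M ⟶ N) :
    (pb F g).map ((pb F f).map a) ≫ (pbComp F f g k h N).inv =
      (pbComp F f g k h M).inv ≫ (pb F k).map a :=
  F.mapComp'_inv_naturality _ _ _ (locComp h) a

lemma pbComp_assoc {A B D E : C} (f : D ⟶ E) (g : B ⟶ D) (h : A ⟶ B) (gf : B ⟶ E)
    (hg : A ⟶ D) (k : A ⟶ E) (h₁ : g ≫ f = gf) (h₂ : h ≫ g = hg) (h₃ : h ≫ gf = k)
    (h₄ : hg ≫ f = k) (M : F.obj ⟨op E⟩) :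
    (pbComp F gf h k h₃ M).hom ≫ (pb F h).map (pbComp F f g gf h₁ M).hom =
      (pbComp F f hg k h₄ M).hom ≫ (pbComp F g h hg h₂ _).hom :=
  F.mapComp'₀₂₃_hom_comp_mapComp'_hom_whiskerRight_app f.op.toLoc g.op.toLoc
    h.op.toLoc gf.op.toLoc hg.op.toLoc k.op.toLoc (locComp h₁) (locComp h₂) (locComp h₃) M

lemma pbComp_id_inv {X Y : C} (p : X ⟶ X) (hp : p = 𝟙 X) (a : Y ⟶ X) (M : F.obj ⟨op X⟩) :
    (pbComp F p a a (by rw [hp, Category.comp_id]) M).inv = (pb F a).map (pbId F p hp M).hom :=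
  Action.mapId'_compat p hp a M

lemma pullHom_eq ⦃X₁ X₂ : C⦄ ⦃M₁ : F.obj ⟨op X₁⟩⦄ ⦃M₂ : F.obj ⟨op X₂⟩⦄
    ⦃Y : C⦄ ⦃f₁ : Y ⟶ X₁⦄ ⦃f₂ : Y ⟶ X₂⦄ (φ : (pb F f₁).obj M₁ ⟶ (pb F f₂).obj M₂) ⦃Y' : C⦄
    (g : Y' ⟶ Y) (gf₁ : Y' ⟶ X₁) (gf₂ : Y' ⟶ X₂) (h₁ : g ≫ f₁ = gf₁) (h₂ : g ≫ f₂ = gf₂) :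
    pullHom φ g gf₁ gf₂ h₁ h₂ =
      (pbComp F f₁ g gf₁ h₁ M₁).hom ≫ (pb F g).map φ ≫ (pbComp F f₂ g gf₂ h₂ M₂).inv :=
  rfl

lemma pbComp_inv_hom_naturality {X Y Y' Z : C} (f : Y ⟶ Z) (g : X ⟶ Y) (f' : Y' ⟶ Z) (g' : X ⟶ Y')
    (k : X ⟶ Z) (h : g ≫ f = k) (h' : g' ≫ f' = k) {M N : F.obj ⟨op Z⟩} (a : M ⟶ N) :
    (pb F g).map ((pb F f).map a) ≫ (pbComp F f g k h N).inv ≫ (pbComp F f' g' k h' N).hom =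
      ((pbComp F f g k h M).inv ≫ (pbComp F f' g' k h' M).hom) ≫
        (pb F g').map ((pb F f').map a) := by
  rw [Category.assoc, reassoc_of% pbComp_inv_naturality (F := F), pbComp_hom_naturality]

/-- The conjugate of `t^* φ` by coherence isomorphisms, in terms of `pullHom`. -/
lemma conj_pullHom_eq ⦃X₁ X₂ Z₁ Z₂ : C⦄ (p₁ : Z₁ ⟶ X₁) (p₂ : Z₂ ⟶ X₂) (M₁ : F.obj ⟨op X₁⟩)
    (M₂ : F.obj ⟨op X₂⟩) ⦃Y Y' : C⦄ (f₁ : Y ⟶ X₁) (f₂ : Y ⟶ X₂) (t : Y' ⟶ Y) (a₁ : Y' ⟶ Z₁)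
    (a₂ : Y' ⟶ Z₂) (k₁ : Y' ⟶ X₁) (k₂ : Y' ⟶ X₂) (h₁ : a₁ ≫ p₁ = k₁) (h₂ : a₂ ≫ p₂ = k₂)
    (h₃ : t ≫ f₁ = k₁) (h₄ : t ≫ f₂ = k₂) (φ : (pb F f₁).obj M₁ ⟶ (pb F f₂).obj M₂) :
    ((pbComp F p₁ a₁ k₁ h₁ M₁).inv ≫ (pbComp F f₁ t k₁ h₃ M₁).hom) ≫ (pb F t).map φ ≫
        (pbComp F f₂ t k₂ h₄ M₂).inv ≫ (pbComp F p₂ a₂ k₂ h₂ M₂).hom =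
      (pbComp F p₁ a₁ k₁ h₁ M₁).inv ≫ pullHom φ t k₁ k₂ h₃ h₄ ≫
        (pbComp F p₂ a₂ k₂ h₂ M₂).hom := by
  rw [pullHom_eq]
  simp only [Category.assoc]

namespace Action

lemma descentIso_hom {Y₀ Y₁ T : C} {d₀ d₁ : Y₁ ⟶ Y₀} (c : Y₀ ⟶ T) (hc : d₀ ≫ c = d₁ ≫ c)
    (M : F.obj ⟨op T⟩) (k : Y₁ ⟶ T) (hk : d₀ ≫ c = k) :
    (descentIso F c hc M).hom =
      (pbComp F c d₀ k hk M).inv ≫ (pbComp F c d₁ k (hc.symm.trans hk) M).hom := by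
  subst hk
  rfl

/-- The diagram chase behind `augmentPullIso`: all maps are coherence isomorphisms between the
pullbacks of one object, and the hypotheses are four instances of `pbComp_assoc`. -/
lemma augmentPullIso_aux {D : Type*} [Category* D] {x a a' b b' y y' z z' q : D}
    {K₀ : x ≅ a} {E₀ : a ≅ b} {L₀ : x ≅ y} {N₀ : y ≅ b} {K₁ : x ≅ a'} {E₁ : a' ≅ b'} {L₁ : x ≅ y'}
    {N₁ : y' ≅ b'} {E₂ : a ⟶ z} {P : x ≅ q} {R₀ : q ≅ z} {E₃ : a' ⟶ z'} {R₁ : q ≅ z'}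
    (h₀ : K₀.hom ≫ E₀.hom = L₀.hom ≫ N₀.hom) (h₁ : K₁.hom ≫ E₁.hom = L₁.hom ≫ N₁.hom)
    (h₂ : K₀.hom ≫ E₂ = P.hom ≫ R₀.hom) (h₃ : K₁.hom ≫ E₃ = P.hom ≫ R₁.hom) :
    (E₀.inv ≫ E₂) ≫ R₀.inv ≫ R₁.hom =
      (N₀.inv ≫ (L₀.inv ≫ L₁.hom) ≫ N₁.hom) ≫ E₁.inv ≫ E₃ := by
  rw [← cancel_epi E₀.hom, ← cancel_epi K₀.hom]
  simp only [Category.assoc, Iso.hom_inv_id_assoc, reassoc_of% h₂, reassoc_of% h₀,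
    ← reassoc_of% h₁, h₃]

/-- Pulling back the canonical action on `c'^* M` along `g : A ⟶ B` gives the canonical action on
`c^* t^* M`, when `g₀ ≫ c' = c ≫ t`. -/
def augmentPullIso {A B : Precat C} (g : A ⟶ B) {T T' : C} (c : A.C₀ ⟶ T)
    (hc : A.d₀ ≫ c = A.d₁ ≫ c) (c' : B.C₀ ⟶ T') (hc' : B.d₀ ≫ c' = B.d₁ ≫ c') (t : T ⟶ T')
    (k : A.C₀ ⟶ T') (hk : g.f₀ ≫ c' = k) (hk' : c ≫ t = k) (M : F.obj ⟨op T'⟩) :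
    (pull F g).obj ((augment F B c' hc').obj M) ≅ (augment F A c hc).obj ((pb F t).obj M) :=
  isoMk ((pbComp F c' g.f₀ k hk M).symm ≪≫ pbComp F t c k hk' M) (by
    have hk₁ : A.d₁ ≫ k = A.d₀ ≫ k := by rw [← hk', reassoc_of% hc]
    have h₀ := pbComp_assoc (F := F) c' g.f₀ A.d₀ k _ (A.d₀ ≫ k) hk rfl rfl (by simp [hk]) M
    have h₁ := pbComp_assoc (F := F) c' g.f₀ A.d₁ k _ (A.d₀ ≫ k) hk rfl hk₁ (by simp [hk, hk₁]) M
    have h₂ := pbComp_assoc (F := F) t c A.d₀ k _ (A.d₀ ≫ k) hk' rfl rfl (by simp [hk']) M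
    have h₃ := pbComp_assoc (F := F) t c A.d₁ k _ (A.d₀ ≫ k) hk' hc.symm hk₁ (by simp [hk']) M
    have hp := (pullIso_hom' g ((augment F B c' hc').obj M) _ _ rfl rfl).trans
      (congrArg (fun z => _ ≫ z ≫ _) (pullHom_descentIso F c' hc' M g.f₁ _ _ (A.d₀ ≫ k)
        g.d₀.symm g.d₁.symm (by simp [hk]) (by simp [hk, hk₁])))
    have hp' : (pullIso g ((augment F B c' hc').obj M)).hom =
        (pbComp F g.f₀ A.d₀ _ rfl _).inv ≫
        ((pbComp F c' (A.d₀ ≫ g.f₀) (A.d₀ ≫ k) (by simp [hk]) M).inv ≫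
          (pbComp F c' (A.d₁ ≫ g.f₀) (A.d₀ ≫ k) (by simp [hk, hk₁]) M).hom) ≫
        (pbComp F g.f₀ A.d₁ _ rfl _).hom := hp
    have hd := descentIso_hom (F := F) c hc ((pb F t).obj M) _ rfl
    refine (congrArg₂ (· ≫ ·) (Functor.map_comp _ _ _) hd).trans ?_
    refine Eq.trans ?_ (congrArg₂ (· ≫ ·) hp' (Functor.map_comp _ _ _)).symm
    exact augmentPullIso_aux (E₀ := (pb F A.d₀).mapIso (pbComp F c' g.f₀ k hk M))
      (E₁ := (pb F A.d₁).mapIso (pbComp F c' g.f₀ k hk M)) h₀ h₁ h₂ h₃)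

end Action
end Coherence

/-! ### Coequalisers in the total category and full faithfulness -/

section TotalCategory

variable {C : Type u₁} [Category.{v₁} C] {F : Pseudofunctor (LocallyDiscrete Cᵒᵖ) Cat.{v, w}}

/-- The fibre component of a morphism `f` of the total category, as a morphism to `k^*` for a
morphism `k` propositionally equal to the base component of `f`. -/
def fiberOver {a b : Pseudofunctor.CoGrothendieck F} (f : a ⟶ b) (k : a.base ⟶ b.base)
    (h : f.base = k) : a.fiber ⟶ (pb F k).obj b.fiber :=
  f.fiber ≫ eqToHom (by rw [h])

lemma total_hom_ext {a b : Pseudofunctor.CoGrothendieck F} {f g : a ⟶ b} (k : a.base ⟶ b.base)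
    (hf : f.base = k) (hg : g.base = k) (h : fiberOver f k hf = fiberOver g k hg) : f = g := by
  refine Pseudofunctor.CoGrothendieck.Hom.ext f g (hf.trans hg.symm) ?_
  subst hg
  simpa [fiberOver, ← cancel_mono (eqToHom (show (pb F f.base).obj b.fiber =
    (pb F g.base).obj b.fiber by rw [hf]))] using h

lemma fiberOver_rfl {a b : Pseudofunctor.CoGrothendieck F} (f : a ⟶ b) :
    fiberOver f f.base rfl = f.fiber := Category.comp_id _

lemma fiberOver_congr {a b : Pseudofunctor.CoGrothendieck F} {f g : a ⟶ b} (e : f = g)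
    (k : a.base ⟶ b.base) (h : f.base = k) :
    fiberOver f k h = fiberOver g k (e ▸ h) := by
  subst e
  rfl

/-- The fibre component of a composite, with the coherence isomorphism at an arbitrary name `k` for
the composite of the base components. -/
lemma fiberOver_comp {a b c : Pseudofunctor.CoGrothendieck F} (f : a ⟶ b) (g : b ⟶ c)
    (k : a.base ⟶ c.base) (h : f.base ≫ g.base = k) :
    fiberOver (f ≫ g) k h =
      f.fiber ≫ (pb F f.base).map g.fiber ≫ (pbComp F g.base f.base k h c.fiber).inv := by
  subst h
  refine (fiberOver_rfl _).trans ?_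
  have : (pbComp F g.base f.base _ rfl c.fiber).inv =
      (F.mapComp g.base.op.toLoc f.base.op.toLoc).inv.toNatTrans.app c.fiber := by
    change ((F.mapComp' g.base.op.toLoc f.base.op.toLoc _ rfl).inv.toNatTrans.app c.fiber) = _
    rw [Pseudofunctor.mapComp'_eq_mapComp]
  rw [this]
  rfl

namespace Action

variable {G : Precat C} {T : C} (c : G.C₀ ⟶ T) (hc : G.d₀ ≫ c = G.d₁ ≫ c)

/-- The morphism `c^* Q ⟶ Q'` of the total category over `c` given by a morphism
`c^* Q ⟶ c^* Q'`. -/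
def augmentHom {Q Q' : F.obj ⟨op T⟩} (α : (pb F c).obj Q ⟶ (pb F c).obj Q') :
    ((augment F G c hc).obj Q).total₀ ⟶ ⟨T, Q'⟩ where
  base := c
  fiber := α

/-- The cartesian morphism `c^* Q ⟶ Q` of the total category. -/
def augmentProj (Q : F.obj ⟨op T⟩) :
    ((augment F G c hc).obj Q).total₀ ⟶ ⟨T, Q⟩ :=
  augmentHom c hc (𝟙 _)

/-- A morphism out of `A₀` coequalises the source and the target map of the action `A` if and only
if its fibre component is compatible with the isomorphism of `A`. -/
lemma src_comp_eq_tgt_comp_iff {A : Action F G} {Z : Pseudofunctor.CoGrothendieck F}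
    (φ : A.total₀ ⟶ Z) (k : G.C₁ ⟶ Z.base) (h₀ : G.d₀ ≫ φ.base = k) (h₁ : G.d₁ ≫ φ.base = k) :
    A.src ≫ φ = A.tgt ≫ φ ↔
      (pb F G.d₀).map φ.fiber ≫ (pbComp F φ.base G.d₀ k h₀ Z.fiber).inv =
        A.iso.hom ≫ (pb F G.d₁).map φ.fiber ≫ (pbComp F φ.base G.d₁ k h₁ Z.fiber).inv := by
  have e₀ := (fiberOver_comp A.src φ k h₀).trans (Category.id_comp _)
  have e₁ := fiberOver_comp A.tgt φ k h₁
  constructor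
  · intro h
    exact e₀.symm.trans ((fiberOver_congr h k h₀).trans e₁)
  · intro h
    exact total_hom_ext (a := A.total₁) k h₀ h₁ (e₀.trans (h.trans e₁.symm))

/-- A morphism `c^* Q ⟶ c^* Q'` is compatible with the canonical actions if and only if the
corresponding morphism `c^* Q ⟶ Q'` of the total category coequalises source and target. -/
lemma src_comp_eq_tgt_comp_iff_comm {Q Q' : F.obj ⟨op T⟩} (α : (pb F c).obj Q ⟶ (pb F c).obj Q') :
    ((augment F G c hc).obj Q).src ≫ augmentHom c hc α =
      ((augment F G c hc).obj Q).tgt ≫ augmentHom c hc α ↔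
    (pb F G.d₀).map α ≫ (descentIso F c hc Q').hom =
      (descentIso F c hc Q).hom ≫ (pb F G.d₁).map α := by
  refine (src_comp_eq_tgt_comp_iff (augmentHom c hc α) (G.d₀ ≫ c) rfl hc.symm).trans ?_
  change (pb F G.d₀).map α ≫ (pbComp F c G.d₀ (G.d₀ ≫ c) rfl Q').inv =
    (descentIso F c hc Q).hom ≫ (pb F G.d₁).map α ≫ (pbComp F c G.d₁ (G.d₀ ≫ c) hc.symm Q').inv ↔ _
  rw [descentIso_hom (F := F) c hc Q' _ rfl,
    ← cancel_mono (pbComp F c G.d₁ (G.d₀ ≫ c) hc.symm Q').hom]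
  simp only [Category.assoc, Iso.inv_hom_id, Category.comp_id]

lemma augmentProj_condition (Q : F.obj ⟨op T⟩) :
    ((augment F G c hc).obj Q).src ≫ augmentProj c hc Q =
      ((augment F G c hc).obj Q).tgt ≫ augmentProj c hc Q :=
  (src_comp_eq_tgt_comp_iff_comm c hc (𝟙 ((pb F c).obj Q))).2 (by
    rw [CategoryTheory.Functor.map_id, CategoryTheory.Functor.map_id, Category.id_comp,
      Category.comp_id])

variable (hU : ∀ Q : F.obj ⟨op T⟩, IsCoeq ((augment F G c hc).obj Q).src
    ((augment F G c hc).obj Q).tgt (augmentProj c hc Q))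

include hU

/-- If the fork `d₀^* c^* Q ⇉ c^* Q ⟶ Q` is a coequaliser in the total category for every `Q`, then
the functor sending `Q` to `c^* Q` with its canonical action is faithful: a morphism `β : Q ⟶ Q'`
gives a morphism of the total category under `c^* Q` that determines it. -/
lemma augment_faithful : (augment F G c hc).Faithful where
  map_injective {Q Q'} β β' h := by
    replace h : (pb F c).map β = (pb F c).map β' := congrArg Hom.hom h
    obtain ⟨w, ⟨hl⟩⟩ := hU Q
    let ψ (γ : Q ⟶ Q') : (⟨T, Q⟩ : Pseudofunctor.CoGrothendieck F) ⟶ ⟨T, Q'⟩ :=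
      ⟨𝟙 T, γ ≫ (pbId F (𝟙 T) rfl Q').inv⟩
    have hψ (γ : Q ⟶ Q') : fiberOver (augmentProj c hc Q ≫ ψ γ) c (Category.comp_id c) =
        (pb F c).map γ := by
      refine (fiberOver_comp (augmentProj c hc Q) (ψ γ) c (Category.comp_id c)).trans ?_
      refine (Category.id_comp _).trans ?_
      refine (congrArg (_ ≫ ·) (pbComp_id_inv (𝟙 T) rfl c Q')).trans ?_
      refine (Functor.map_comp _ _ _).symm.trans (congrArg (pb F c).map ?_)
      exact (Category.assoc _ _ _).trans ((congrArg _ (Iso.inv_hom_id _)).trans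
        (Category.comp_id _))
    have e : augmentProj c hc Q ≫ ψ β = augmentProj c hc Q ≫ ψ β' :=
      total_hom_ext (a := ((augment F G c hc).obj Q).total₀) c (Category.comp_id c)
        (Category.comp_id c) ((hψ β).trans (h.trans (hψ β').symm))
    have e' : ψ β = ψ β' := Cofork.IsColimit.hom_ext hl e
    have e'' : β ≫ (pbId F (𝟙 T) rfl Q').inv = β' ≫ (pbId F (𝟙 T) rfl Q').inv := by
      have := Pseudofunctor.CoGrothendieck.Hom.congr e'
      exact this.trans (Category.comp_id _)
    exact (cancel_mono _).1 e''

/-- If moreover `c` is an epimorphism, then that functor is full: a morphism of canonical actions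
factors through the coequaliser, and the factorisation lies over the identity because `c` is an
epimorphism. -/
lemma augment_full (hce : Epi c) : (augment F G c hc).Full where
  map_surjective {Q Q'} α := by
    obtain ⟨w, ⟨hl⟩⟩ := hU Q
    let φ : ((augment F G c hc).obj Q).total₀ ⟶ (⟨T, Q'⟩ : Pseudofunctor.CoGrothendieck F) :=
      augmentHom c hc (Hom.hom α)
    have hφ : ((augment F G c hc).obj Q).src ≫ φ = ((augment F G c hc).obj Q).tgt ≫ φ :=
      (src_comp_eq_tgt_comp_iff_comm c hc (Hom.hom α)).2 (Hom.comm α)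
    let ψ : (⟨T, Q⟩ : Pseudofunctor.CoGrothendieck F) ⟶ ⟨T, Q'⟩ := Cofork.IsColimit.desc hl φ hφ
    have hψ : augmentProj c hc Q ≫ ψ = φ := Cofork.IsColimit.π_desc' hl φ hφ
    have hb : c ≫ ψ.base = c := congrArg Pseudofunctor.CoGrothendieck.Hom.base hψ
    have hid : ψ.base = 𝟙 T := (cancel_epi c).1 (hb.trans (Category.comp_id c).symm)
    refine ⟨ψ.fiber ≫ (pbId F ψ.base hid Q').hom, hom_ext ?_⟩
    have e := (fiberOver_congr hψ c hb).trans (fiberOver_rfl φ)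
    refine Eq.trans ?_ e
    refine Eq.trans ?_ (fiberOver_comp (augmentProj c hc Q) ψ c hb).symm
    refine Eq.trans ?_ (Category.id_comp _).symm
    refine Eq.trans ?_ (congrArg (_ ≫ ·) (pbComp_id_inv ψ.base hid c Q')).symm
    exact Functor.map_comp _ _ _

omit hU

end Action

lemma IsCoeq.epi {A B Q : C} {a b : A ⟶ B} {c : B ⟶ Q} (h : IsCoeq a b c) : Epi c := by
  obtain ⟨w, ⟨hl⟩⟩ := h
  exact ⟨fun _ _ e => Cofork.IsColimit.hom_ext hl e⟩

namespace DSch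

variable {S : Scheme.{u}} {P : Pseudofunctor (LocallyDiscrete (Over S)ᵒᵖ) Cat.{v, w}}

lemma IsSimple.faithful {X : DSch S} (h : IsSimple P X) :
    (constFunctor P X h.hasLeaves).Faithful :=
  Action.augment_faithful _ _ h.universal

lemma IsSimple.full {X : DSch S} (h : IsSimple P X) : (constFunctor P X h.hasLeaves).Full :=
  Action.augment_full _ _ h.universal h.isCoeq.epi

end DSch

end TotalCategory

/-! ### The pseudofunctor of actions -/

section Delta
open Pseudofunctor.LocallyDiscreteOpToCat

variable {C : Type u₁} [Category.{v₁} C] {F : Pseudofunctor (LocallyDiscrete Cᵒᵖ) Cat.{v, w}}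
  {D : Type*} [Category* D] (G : D ⥤ Precat C)

namespace Action

/-- The structure isomorphisms of the pseudofunctor of actions are those of `F` on underlying
objects. -/
lemma pbComp_actions_hom_hom {X Y Z : D} (f : Y ⟶ Z) (g : X ⟶ Y) (k : X ⟶ Z) (h : g ≫ f = k)
    (A : Action F (G.obj Z)) :
    Hom.hom (pbComp (actions (F := F) G) f g k h A).hom =
      (pbComp F (G.map f).f₀ (G.map g).f₀ (G.map k).f₀
        (by rw [← h, G.map_comp]; rfl) A.obj).hom := by
  subst h
  change Hom.hom (((actions (F := F) G).mapComp' f.op.toLoc g.op.toLoc _ rfl).hom.toNatTrans.app A)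
    = _
  rw [Pseudofunctor.mapComp'_eq_mapComp]
  rfl

lemma pbComp_actions_inv_hom {X Y Z : D} (f : Y ⟶ Z) (g : X ⟶ Y) (k : X ⟶ Z) (h : g ≫ f = k)
    (A : Action F (G.obj Z)) :
    Hom.hom (pbComp (actions (F := F) G) f g k h A).inv =
      (pbComp F (G.map f).f₀ (G.map g).f₀ (G.map k).f₀
        (by rw [← h, G.map_comp]; rfl) A.obj).inv := by
  subst h
  change Hom.hom (((actions (F := F) G).mapComp' f.op.toLoc g.op.toLoc _ rfl).inv.toNatTrans.app A)
    = _
  rw [Pseudofunctor.mapComp'_eq_mapComp]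
  rfl

/-- The forgetful functors commute with `pullHom`. -/
lemma pullHom_actions_hom ⦃X₁ X₂ : D⦄ ⦃M₁ : Action F (G.obj X₁)⦄ ⦃M₂ : Action F (G.obj X₂)⦄
    ⦃Y : D⦄ ⦃f₁ : Y ⟶ X₁⦄ ⦃f₂ : Y ⟶ X₂⦄
    (φ : (pb (actions (F := F) G) f₁).obj M₁ ⟶ (pb (actions (F := F) G) f₂).obj M₂) ⦃Y' : D⦄
    (g : Y' ⟶ Y) (gf₁ : Y' ⟶ X₁) (gf₂ : Y' ⟶ X₂) (h₁ : g ≫ f₁ = gf₁) (h₂ : g ≫ f₂ = gf₂) :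
    Hom.hom (pullHom φ g gf₁ gf₂ h₁ h₂) =
      pullHom (F := F) (M₁ := M₁.obj) (M₂ := M₂.obj) (f₁ := (G.map f₁).f₀) (f₂ := (G.map f₂).f₀)
        (Hom.hom φ) (G.map g).f₀ (G.map gf₁).f₀ (G.map gf₂).f₀
        (by rw [← h₁, G.map_comp]; rfl) (by rw [← h₂, G.map_comp]; rfl) := by
  refine (congrArg Hom.hom (pullHom_eq φ g gf₁ gf₂ h₁ h₂)).trans ?_
  refine congrArg₂ (· ≫ ·) (pbComp_actions_hom_hom G f₁ g gf₁ h₁ M₁) ?_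
  exact congrArg₂ (· ≫ ·) rfl (pbComp_actions_inv_hom G f₂ g gf₂ h₂ M₂)

end Action
end Delta

/-! ### Descent and transport of actions -/

section ActionLemmas
open Pseudofunctor.LocallyDiscreteOpToCat

variable {C : Type u₁} [Category.{v₁} C] {F : Pseudofunctor (LocallyDiscrete Cᵒᵖ) Cat.{v, w}}

namespace Action

lemma pullHom_injective ⦃X₁ X₂ : C⦄ ⦃M₁ : F.obj ⟨op X₁⟩⦄ ⦃M₂ : F.obj ⟨op X₂⟩⦄
    ⦃Y : C⦄ ⦃f₁ : Y ⟶ X₁⦄ ⦃f₂ : Y ⟶ X₂⦄ {φ ψ : (pb F f₁).obj M₁ ⟶ (pb F f₂).obj M₂} ⦃Y' : C⦄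
    (g : Y' ⟶ Y) (hg : (pb F g).Faithful) (gf₁ : Y' ⟶ X₁) (gf₂ : Y' ⟶ X₂) (h₁ : g ≫ f₁ = gf₁)
    (h₂ : g ≫ f₂ = gf₂) (h : pullHom φ g gf₁ gf₂ h₁ h₂ = pullHom ψ g gf₁ gf₂ h₁ h₂) : φ = ψ := by
  rw [pullHom_eq, pullHom_eq, cancel_epi, cancel_mono] at h
  exact hg.map_injective h

lemma pullHom_conj_eq ⦃X₁ X₂ Z₁ Z₂ : C⦄ (p₁ : Z₁ ⟶ X₁) (p₂ : Z₂ ⟶ X₂) (M₁ : F.obj ⟨op X₁⟩)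
    (M₂ : F.obj ⟨op X₂⟩) ⦃Y : C⦄ (a₁ : Y ⟶ Z₁) (a₂ : Y ⟶ Z₂) (f₁ : Y ⟶ X₁) (f₂ : Y ⟶ X₂)
    (h₁ : a₁ ≫ p₁ = f₁) (h₂ : a₂ ≫ p₂ = f₂)
    (φ : (pb F f₁).obj M₁ ⟶ (pb F f₂).obj M₂) ⦃Y' : C⦄
    (t : Y' ⟶ Y) (ta₁ : Y' ⟶ Z₁) (ta₂ : Y' ⟶ Z₂) (tf₁ : Y' ⟶ X₁) (tf₂ : Y' ⟶ X₂)
    (ha₁ : t ≫ a₁ = ta₁) (ha₂ : t ≫ a₂ = ta₂) (hf₁ : t ≫ f₁ = tf₁) (hf₂ : t ≫ f₂ = tf₂) :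
    pullHom (M₁ := (pb F p₁).obj M₁) (M₂ := (pb F p₂).obj M₂)
      ((pbComp F p₁ a₁ f₁ h₁ M₁).inv ≫ φ ≫ (pbComp F p₂ a₂ f₂ h₂ M₂).hom) t ta₁ ta₂ ha₁ ha₂ =
      (pbComp F p₁ ta₁ tf₁ (by rw [← ha₁, Category.assoc, h₁, hf₁]) M₁).inv ≫
        pullHom φ t tf₁ tf₂ hf₁ hf₂ ≫
        (pbComp F p₂ ta₂ tf₂ (by rw [← ha₂, Category.assoc, h₂, hf₂]) M₂).hom :=
  pullHom_conj p₁ p₂ M₁ M₂ a₁ a₂ f₁ f₂ h₁ h₂ φ t ta₁ ta₂ tf₁ tf₂ ha₁ ha₂ hf₁ hf₂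

/-- If the pullback along `g : A ⟶ B` of an isomorphism `ψ : d₀^* Q ≅ d₁^* Q` is an action of `A`,
then `ψ` is an action of `B`, provided that `g₀^*` and `g₂^*` are faithful. -/
def descend {A B : Precat C} (g : A ⟶ B) (h₀ : (pb F g.f₀).Faithful) (h₂ : (pb F g.f₂).Faithful)
    (Q : F.obj ⟨op B.C₀⟩) (ψ : (pb F B.d₀).obj Q ≅ (pb F B.d₁).obj Q)
    (χ : (pb F A.d₀).obj ((pb F g.f₀).obj Q) ⟶ (pb F A.d₁).obj ((pb F g.f₀).obj Q))
    (hu : pullHom χ A.n (𝟙 _) (𝟙 _) A.n_d₀ A.n_d₁ = 𝟙 _)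
    (hm : pullHom χ A.r₀ (A.r₀ ≫ A.d₀) (A.r₀ ≫ A.d₁) rfl rfl ≫
      pullHom χ A.r₁ (A.r₀ ≫ A.d₁) (A.r₁ ≫ A.d₁) A.r₁_d₀ rfl =
        pullHom χ A.m (A.r₀ ≫ A.d₀) (A.r₁ ≫ A.d₁) A.m_d₀ A.m_d₁)
    (hχ : χ = (pbComp F g.f₀ A.d₀ (A.d₀ ≫ g.f₀) rfl Q).inv ≫
      pullHom ψ.hom g.f₁ (A.d₀ ≫ g.f₀) (A.d₁ ≫ g.f₀) g.d₀.symm g.d₁.symm ≫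
        (pbComp F g.f₀ A.d₁ (A.d₁ ≫ g.f₀) rfl Q).hom) : Action F B where
  obj := Q
  iso := ψ
  unit := by
    subst hχ
    rw [pullHom_conj_eq (tf₁ := g.f₀) (tf₂ := g.f₀)
      (hf₁ := by rw [← Category.assoc, A.n_d₀, Category.id_comp])
      (hf₂ := by rw [← Category.assoc, A.n_d₁, Category.id_comp]),
      Iso.inv_comp_eq, Category.comp_id, ← Iso.eq_comp_inv, Iso.hom_inv_id, pullHom_pullHom,
      pullHom_congr _ g.n] at hu
    refine pullHom_injective g.f₀ h₀ g.f₀ g.f₀ (Category.comp_id _) (Category.comp_id _) ?_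
    rw [pullHom_pullHom, pullHom_one, hu]
  cocycle := by
    subst hχ
    have e₀ : A.r₀ ≫ A.d₀ ≫ g.f₀ = g.f₂ ≫ B.r₀ ≫ B.d₀ := by rw [g.d₀, reassoc_of% g.r₀]
    have e₁ : A.r₀ ≫ A.d₁ ≫ g.f₀ = g.f₂ ≫ B.r₀ ≫ B.d₁ := by rw [g.d₁, reassoc_of% g.r₀]
    have e₂ : A.r₁ ≫ A.d₁ ≫ g.f₀ = g.f₂ ≫ B.r₁ ≫ B.d₁ := by rw [g.d₁, reassoc_of% g.r₁]
    rw [pullHom_conj_eq (t := A.r₀) (tf₁ := g.f₂ ≫ B.r₀ ≫ B.d₀) (tf₂ := g.f₂ ≫ B.r₀ ≫ B.d₁)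
        (hf₁ := e₀) (hf₂ := e₁),
      pullHom_conj_eq (t := A.r₁) (tf₁ := g.f₂ ≫ B.r₀ ≫ B.d₁) (tf₂ := g.f₂ ≫ B.r₁ ≫ B.d₁)
        (hf₁ := by rw [reassoc_of% A.r₁_d₀, e₁]) (hf₂ := e₂),
      pullHom_conj_eq (t := A.m) (tf₁ := g.f₂ ≫ B.r₀ ≫ B.d₀) (tf₂ := g.f₂ ≫ B.r₁ ≫ B.d₁)
        (hf₁ := by rw [reassoc_of% A.m_d₀, e₀]) (hf₂ := by rw [reassoc_of% A.m_d₁, e₂])] at hm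
    simp only [Category.assoc, Iso.hom_inv_id_assoc, cancel_epi] at hm
    simp only [← Category.assoc _ _ (pbComp F _ _ _ _ _).hom, cancel_mono] at hm
    rw [pullHom_pullHom, pullHom_pullHom, pullHom_pullHom,
      pullHom_congr _ g.r₀, pullHom_congr _ g.r₁, pullHom_congr _ g.m] at hm
    refine pullHom_injective g.f₂ h₂ (g.f₂ ≫ B.r₀ ≫ B.d₀) (g.f₂ ≫ B.r₁ ≫ B.d₁) rfl rfl ?_
    rw [← pullHom_comp (gf₂ := g.f₂ ≫ B.r₀ ≫ B.d₁) (h₂ := rfl), pullHom_pullHom, pullHom_pullHom,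
      pullHom_pullHom, hm]

lemma pullHom_map_conj ⦃X₁ X₂ : C⦄ ⦃M₁ N₁ : F.obj ⟨op X₁⟩⦄ ⦃M₂ N₂ : F.obj ⟨op X₂⟩⦄
    ⦃Y : C⦄ ⦃f₁ : Y ⟶ X₁⦄ ⦃f₂ : Y ⟶ X₂⦄ (a : N₁ ⟶ M₁)
    (φ : (pb F f₁).obj M₁ ⟶ (pb F f₂).obj M₂) (b : M₂ ⟶ N₂) ⦃Y' : C⦄
    (g : Y' ⟶ Y) (gf₁ : Y' ⟶ X₁) (gf₂ : Y' ⟶ X₂) (h₁ : g ≫ f₁ = gf₁) (h₂ : g ≫ f₂ = gf₂) :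
    pullHom ((pb F f₁).map a ≫ φ ≫ (pb F f₂).map b) g gf₁ gf₂ h₁ h₂ =
      (pb F gf₁).map a ≫ pullHom φ g gf₁ gf₂ h₁ h₂ ≫ (pb F gf₂).map b := by
  rw [pullHom_eq, pullHom_eq, Functor.map_comp, Functor.map_comp]
  simp only [Category.assoc]
  rw [pbComp_inv_naturality, reassoc_of% pbComp_hom_naturality (F := F)]

/-- Transport of an action along an isomorphism of the underlying object. -/
def transport {G : Precat C} (A : Action F G) {M : F.obj ⟨op G.C₀⟩} (e : M ≅ A.obj) :
    Action F G where
  obj := M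
  iso := (pb F G.d₀).mapIso e ≪≫ A.iso ≪≫ (pb F G.d₁).mapIso e.symm
  unit := by
    refine (pullHom_map_conj e.hom A.iso.hom e.inv _ _ _ _ _).trans ?_
    rw [A.unit, Category.id_comp, ← Functor.map_comp, e.hom_inv_id,
      CategoryTheory.Functor.map_id]
  cocycle := by
    refine (congrArg₂ (· ≫ ·) (pullHom_map_conj e.hom A.iso.hom e.inv _ _ _ _ _)
      (pullHom_map_conj e.hom A.iso.hom e.inv _ _ _ _ _)).trans ?_
    refine Eq.trans ?_ (pullHom_map_conj e.hom A.iso.hom e.inv _ _ _ _ _).symm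
    simp only [Category.assoc, ← Functor.map_comp_assoc, e.inv_hom_id,
      CategoryTheory.Functor.map_id, Category.id_comp]
    rw [reassoc_of% A.cocycle]

/-- The transported action is isomorphic to the given one. -/
def transportIso {G : Precat C} (A : Action F G) {M : F.obj ⟨op G.C₀⟩} (e : M ≅ A.obj) :
    A.transport e ≅ A :=
  isoMk e (by
    change (pb F G.d₀).map e.hom ≫ A.iso.hom =
      ((pb F G.d₀).map e.hom ≫ A.iso.hom ≫ (pb F G.d₁).map e.inv) ≫ (pb F G.d₁).map e.hom
    rw [Category.assoc, Category.assoc, ← Functor.map_comp, e.inv_hom_id,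
      CategoryTheory.Functor.map_id, Category.comp_id])

end Action
end ActionLemmas

/-! ### Descent data on objects of the form `C_X(Q)` -/

namespace DSch
open Pseudofunctor.LocallyDiscreteOpToCat

variable {S : Scheme.{u}} (P : Pseudofunctor (LocallyDiscrete (Over S)ᵒᵖ) Cat.{v, w})

/-- The underlying object of `P(X)` of an object of `δ↓P(X)`. -/
noncomputable abbrev under (X : DSch S) : (delta P).obj ⟨op X⟩ ⥤ P.obj ⟨op X.X⟩ :=
  Action.forget P X.toPrecat

/-- The functor forgetting the differential structure of an action in `δ↓P`. -/
noncomputable def underlying (H : Precat (DSch S)) :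
    Action (delta P) H ⥤ Action P (H.mapFunctor (forget S)) where
  obj D :=
    { obj := (under P H.C₀).obj D.obj
      iso := (under P H.C₁).mapIso D.iso
      unit := (Action.pullHom_actions_hom (precat S) D.iso.hom H.n (𝟙 _) (𝟙 _) H.n_d₀
        H.n_d₁).symm.trans (congrArg Action.Hom.hom D.unit)
      cocycle := (congrArg₂ (· ≫ ·)
        (Action.pullHom_actions_hom (precat S) D.iso.hom H.r₀ _ _ rfl rfl).symm
        (Action.pullHom_actions_hom (precat S) D.iso.hom H.r₁ _ _ H.r₁_d₀ rfl).symm).trans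
          ((congrArg Action.Hom.hom D.cocycle).trans
            (Action.pullHom_actions_hom (precat S) D.iso.hom H.m _ _ H.m_d₀ H.m_d₁)) }
  map φ := ⟨(under P H.C₀).map (Action.Hom.hom φ), congrArg Action.Hom.hom (Action.Hom.comm φ)⟩
  map_id _ := rfl
  map_comp _ _ := rfl

/-- The underlying action of the canonical descent datum of `f^* A` is the canonical descent datum
of the underlying object of `f^* A`. -/
noncomputable def augmentUnderlying {X Y : DSch S} (f : X ⟶ Y) :
    Action.augment (delta P) (Precat.kernel f) f pullback.condition ⋙
      underlying P (Precat.kernel f) ≅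
    Action.forget P Y.toPrecat ⋙ Action.augment P ((Precat.kernel f).mapFunctor (forget S)) f.toOver
      (congrArg Hom.toOver (pullback.condition (f := f) (g := f))) :=
  NatIso.ofComponents (fun A => Action.isoMk
    (Iso.refl ((pb P f.toOver).obj ((under P Y).obj A))) (by
      refine (congrArg (· ≫ _) (CategoryTheory.Functor.map_id _ _)).trans ?_
      refine (Category.id_comp _).trans (Eq.trans ?_ (congrArg (_ ≫ ·)
        (CategoryTheory.Functor.map_id _ _)).symm)
      refine Eq.trans ?_ (Category.comp_id _).symm
      let k := (Precat.kernel f).d₀ ≫ f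
      have hk : (Precat.kernel f).d₁ ≫ f = k := pullback.condition.symm
      refine Eq.trans ?_ (congrArg Action.Hom.hom
        (Action.descentIso_hom (F := delta P) f pullback.condition A k rfl)).symm
      refine (Action.descentIso_hom (F := P) f.toOver
        (congrArg Hom.toOver (pullback.condition (f := f) (g := f))) _ k.toOver rfl).trans ?_
      exact (congrArg₂ (· ≫ ·)
        (Action.pbComp_actions_inv_hom (F := P) (precat S) f (Precat.kernel f).d₀ k rfl A)
        (Action.pbComp_actions_hom_hom (F := P) (precat S) f (Precat.kernel f).d₁ k hk A)).symm))
    (fun {A B} φ => Action.hom_ext ((Category.comp_id _).trans (Category.id_comp _).symm))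

section ConstPull

variable {P} {Z Z' : DSch S} (g : Z ⟶ Z') (hZ : HasLeaves Z) (hZ' : HasLeaves Z')
  (t : Z.leaves hZ ⟶ Z'.leaves hZ')
  (ht : g.toOver ≫ (Z'.eta hZ').toOver = (Z.eta hZ).toOver ≫ t)

/-- The functors `C_X` commute with pullbacks. -/
noncomputable def constPullIso (Q : P.obj ⟨op (Z'.leaves hZ')⟩) :
    (pb (delta P) g).obj ((constFunctor P Z' hZ').obj Q) ≅
      (constFunctor P Z hZ).obj ((pb P t).obj Q) :=
  Action.augmentPullIso ((precat S).map g) (Z.eta hZ).toOver (toPrecat_condition _)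
    (Z'.eta hZ').toOver (toPrecat_condition _) t (g.toOver ≫ (Z'.eta hZ').toOver) rfl ht.symm Q

lemma constPullIso_naturality {Q Q' : P.obj ⟨op (Z'.leaves hZ')⟩} (a : Q ⟶ Q') :
    (pb (delta P) g).map ((constFunctor P Z' hZ').map a) ≫ (constPullIso g hZ hZ' t ht Q').hom =
      (constPullIso g hZ hZ' t ht Q).hom ≫ (constFunctor P Z hZ).map ((pb P t).map a) := by
  refine Action.hom_ext ?_
  change (pb P g.toOver).map ((pb P (Z'.eta hZ').toOver).map a) ≫
      (pbComp P (Z'.eta hZ').toOver g.toOver _ rfl Q').inv ≫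
        (pbComp P t (Z.eta hZ).toOver _ ht.symm Q').hom =
    ((pbComp P (Z'.eta hZ').toOver g.toOver _ rfl Q).inv ≫
        (pbComp P t (Z.eta hZ).toOver _ ht.symm Q).hom) ≫
      (pb P (Z.eta hZ).toOver).map ((pb P t).map a)
  exact pbComp_inv_hom_naturality _ _ _ _ _ _ _ a

end ConstPull

section Galois

variable {P} {X Y : DSch S} {f : X ⟶ Y} (h : IsPrePicardVessiot P f)

/-- The functor `C_X`, with source the fibre over the objects of the Galois precategory. -/
noncomputable abbrev const₀ : P.obj ⟨op (gal h).C₀⟩ ⥤ (delta P).obj ⟨op (Precat.kernel f).C₀⟩ :=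
  constFunctor P X h.simple₀.hasLeaves

/-- The functor `C_{X ×_Y X}`, with source the fibre over the arrows of the Galois precategory. -/
noncomputable abbrev const₁ : P.obj ⟨op (gal h).C₁⟩ ⥤ (delta P).obj ⟨op (Precat.kernel f).C₁⟩ :=
  constFunctor P (Precat.kernel f).C₁ h.simple₁.hasLeaves

/-- The isomorphism `d₀^* C_X(Q) ≅ C_{X ×_Y X}(d₀^* Q)`. -/
noncomputable def constSrcIso (Q : P.obj ⟨op (gal h).C₀⟩) :
    (pb (delta P) (Precat.kernel f).d₀).obj ((const₀ h).obj Q) ≅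
      (const₁ h).obj ((pb P (gal h).d₀).obj Q) :=
  constPullIso (Precat.kernel f).d₀ h.simple₁.hasLeaves h.simple₀.hasLeaves (gal h).d₀
    (toGal h).d₀ Q

/-- The isomorphism `d₁^* C_X(Q) ≅ C_{X ×_Y X}(d₁^* Q)`. -/
noncomputable def constTgtIso (Q : P.obj ⟨op (gal h).C₀⟩) :
    (pb (delta P) (Precat.kernel f).d₁).obj ((const₀ h).obj Q) ≅
      (const₁ h).obj ((pb P (gal h).d₁).obj Q) :=
  constPullIso (Precat.kernel f).d₁ h.simple₁.hasLeaves h.simple₀.hasLeaves (gal h).d₁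
    (toGal h).d₁ Q

/-- The isomorphism `d₀^* C_X(Q) ≅ d₁^* C_X(Q)` given by an isomorphism `d₀^* Q ≅ d₁^* Q` over the
arrows of the Galois precategory. -/
noncomputable def constArrowIso {Q : P.obj ⟨op (gal h).C₀⟩}
    (ψ : (pb P (gal h).d₀).obj Q ≅ (pb P (gal h).d₁).obj Q) :
    (pb (delta P) (Precat.kernel f).d₀).obj ((const₀ h).obj Q) ≅
      (pb (delta P) (Precat.kernel f).d₁).obj ((const₀ h).obj Q) :=
  constSrcIso h Q ≪≫ (const₁ h).mapIso ψ ≪≫ (constTgtIso h Q).symm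

/-- Underlying `constArrowIso h ψ` is the pullback of `ψ` along the canonical morphism from the
kernel pair to the Galois precategory. -/
lemma under_constArrowIso_hom {Q : P.obj ⟨op (gal h).C₀⟩}
    (ψ : (pb P (gal h).d₀).obj Q ≅ (pb P (gal h).d₁).obj Q) :
    (under P _).map (constArrowIso h ψ).hom =
      (pbComp P (toGal h).f₀ (Precat.kernel f).d₀.toOver _ rfl Q).inv ≫
      pullHom ψ.hom (toGal h).f₁ ((Precat.kernel f).d₀.toOver ≫ (toGal h).f₀)
        ((Precat.kernel f).d₁.toOver ≫ (toGal h).f₀) (toGal h).d₀.symm (toGal h).d₁.symm ≫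
      (pbComp P (toGal h).f₀ (Precat.kernel f).d₁.toOver _ rfl Q).hom := by
  refine Eq.trans ?_ (conj_pullHom_eq _ _ _ _ _ _ _ _ _ _ _ _ _ _ _ _)
  rfl

/-- Since `C_{X ×_Y X}` is faithful, `C_X(a)` is a morphism of descent data if and only if `a` is
compatible with the isomorphisms over the arrows of the Galois precategory. -/
lemma constArrowIso_comm_iff {Q Q' : P.obj ⟨op (gal h).C₀⟩}
    (ψ : (pb P (gal h).d₀).obj Q ≅ (pb P (gal h).d₁).obj Q)
    (ψ' : (pb P (gal h).d₀).obj Q' ≅ (pb P (gal h).d₁).obj Q') (a : Q ⟶ Q') :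
    (pb (delta P) (Precat.kernel f).d₀).map ((const₀ h).map a) ≫ (constArrowIso h ψ').hom =
      (constArrowIso h ψ).hom ≫ (pb (delta P) (Precat.kernel f).d₁).map ((const₀ h).map a) ↔
    (pb P (gal h).d₀).map a ≫ ψ'.hom = ψ.hom ≫ (pb P (gal h).d₁).map a := by
  have n₀ : (pb (delta P) (Precat.kernel f).d₀).map ((const₀ h).map a) ≫ (constSrcIso h Q').hom =
      (constSrcIso h Q).hom ≫ (const₁ h).map ((pb P (gal h).d₀).map a) :=
    constPullIso_naturality _ _ _ _ _ a
  have n₁ : (pb (delta P) (Precat.kernel f).d₁).map ((const₀ h).map a) ≫ (constTgtIso h Q').hom =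
      (constTgtIso h Q).hom ≫ (const₁ h).map ((pb P (gal h).d₁).map a) :=
    constPullIso_naturality _ _ _ _ _ a
  have : (const₁ h).Faithful := h.simple₁.faithful
  rw [← (const₁ h).map_injective.eq_iff, Functor.map_comp, Functor.map_comp,
    ← cancel_epi (constSrcIso h Q).hom, ← reassoc_of% n₀,
    ← cancel_mono (constTgtIso h Q').inv]
  rw [← Iso.eq_comp_inv, Category.assoc, ← Iso.inv_comp_eq] at n₁
  simp only [constArrowIso, Iso.trans_hom, Functor.mapIso_hom, Iso.symm_hom, Category.assoc,
    ← n₁]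

end Galois

end DSch

/-! ### The Galois equivalence -/

namespace DSch
open Pseudofunctor.LocallyDiscreteOpToCat

variable {S : Scheme.{u}} {P : Pseudofunctor (LocallyDiscrete (Over S)ᵒᵖ) Cat.{v, w}}

section Galois

variable {X Y : DSch S} {f : X ⟶ Y} (h : IsPrePicardVessiot P f)

lemma under_constArrowIso_eq_pullIso (R : Action P (gal h)) :
    (under P _).map (constArrowIso h R.iso).hom = (Action.pullIso (toGal h) R).hom :=
  (under_constArrowIso_hom h R.iso).trans (Action.pullIso_hom (toGal h) R).symm

/-- The functor sending an action of the Galois precategory on `Q` to the corresponding descent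
datum on `C_X(Q)`. -/
noncomputable def galToDescent : Action P (gal h) ⥤ Action (delta P) (Precat.kernel f) where
  obj R :=
    { obj := (const₀ h).obj R.obj
      iso := constArrowIso h R.iso
      unit := Action.hom_ext (by
        have e := under_constArrowIso_eq_pullIso h R
        refine (Action.pullHom_actions_hom (precat S) (constArrowIso h R.iso).hom
          (Precat.kernel f).n (𝟙 _) (𝟙 _) (Precat.kernel f).n_d₀ (Precat.kernel f).n_d₁).trans ?_
        exact (congrArg (fun z => pullHom z _ _ _ _ _) e).trans
          (Action.pullObj (toGal h) R).unit)
      cocycle := Action.hom_ext (by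
        have e := under_constArrowIso_eq_pullIso h R
        refine (congrArg₂ (· ≫ ·)
          (Action.pullHom_actions_hom (precat S) (constArrowIso h R.iso).hom
            (Precat.kernel f).r₀ _ _ rfl rfl)
          (Action.pullHom_actions_hom (precat S) (constArrowIso h R.iso).hom
            (Precat.kernel f).r₁ _ _ (Precat.kernel f).r₁_d₀ rfl)).trans ?_
        refine Eq.trans ?_ (Action.pullHom_actions_hom (precat S) (constArrowIso h R.iso).hom
            (Precat.kernel f).m _ _ (Precat.kernel f).m_d₀ (Precat.kernel f).m_d₁).symm
        refine (congrArg₂ (· ≫ ·) (congrArg (fun z => pullHom z _ _ _ _ _) e)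
          (congrArg (fun z => pullHom z _ _ _ _ _) e)).trans ?_
        refine Eq.trans ?_ (congrArg (fun z => pullHom z _ _ _ _ _) e).symm
        exact (Action.pullObj (toGal h) R).cocycle) }
  map {R R'} a := ⟨(const₀ h).map a.hom, (constArrowIso_comm_iff h R.iso R'.iso a.hom).2 a.comm⟩
  map_id R := Action.hom_ext ((const₀ h).map_id _)
  map_comp a b := Action.hom_ext ((const₀ h).map_comp _ _)

instance : (galToDescent h).Faithful where
  map_injective e := Action.hom_ext
    (h.simple₀.faithful.map_injective (congrArg Action.Hom.hom e))

instance : (galToDescent h).Full where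
  map_surjective {R R'} φ := by
    obtain ⟨a, ha⟩ := h.simple₀.full.map_surjective (Action.Hom.hom φ)
    refine ⟨⟨a, (constArrowIso_comm_iff h R.iso R'.iso a).1 ?_⟩, Action.hom_ext ha⟩
    have := Action.Hom.comm φ
    rw [← ha] at this
    exact this

lemma faithful_of_augment_faithful {C : Type u₁} [Category.{v₁} C]
    {F : Pseudofunctor (LocallyDiscrete Cᵒᵖ) Cat.{v, w}} {G : Precat C} {T : C} (c : G.C₀ ⟶ T)
    (hc : G.d₀ ≫ c = G.d₁ ≫ c) (h : (Action.augment F G c hc).Faithful) : (pb F c).Faithful where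
  map_injective e := h.map_injective (Action.hom_ext e)

lemma IsSimple.pb_faithful {Z : DSch S} (h : IsSimple P Z) :
    (pb P (Z.eta h.hasLeaves).toOver).Faithful :=
  faithful_of_augment_faithful _ (toPrecat_condition _) h.faithful

/-- A descent datum on an object isomorphic to `C_X(Q)` comes from an action of the Galois
precategory: fullness of `C_{X ×_Y X}` gives the isomorphism `d₀^* Q ≅ d₁^* Q`, and faithfulness of
`η^*` on `X` and on `X ×_Y X ×_Y X` gives the unit and cocycle conditions. -/
lemma exists_galToDescent_iso (D : Action (delta P) (Precat.kernel f))
    (Q : P.obj ⟨op (gal h).C₀⟩) (e : D.obj ≅ (const₀ h).obj Q) :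
    ∃ R, Nonempty ((galToDescent h).obj R ≅ D) := by
  let D' := D.transport e.symm
  have hfaith : (const₁ h).Faithful := h.simple₁.faithful
  have hfull : (const₁ h).Full := h.simple₁.full
  let ψ : (pb P (gal h).d₀).obj Q ≅ (pb P (gal h).d₁).obj Q :=
    (const₁ h).preimageIso ((constSrcIso h Q).symm ≪≫ D'.iso ≪≫ constTgtIso h Q)
  have hψ : constArrowIso h ψ = D'.iso := by
    have : (const₁ h).mapIso ψ = (constSrcIso h Q).symm ≪≫ D'.iso ≪≫ constTgtIso h Q := by
      ext1
      exact (const₁ h).map_preimage _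
    ext1
    rw [constArrowIso, this]
    refine (congrArg (_ ≫ ·) ?_).trans ((constSrcIso h Q).hom_inv_id_assoc D'.iso.hom)
    exact (Category.assoc _ _ _).trans (congrArg (_ ≫ ·) ((Category.assoc _ _ _).trans
      ((congrArg (_ ≫ ·) (constTgtIso h Q).hom_inv_id).trans (Category.comp_id _))))
  let R : Action P (gal h) := Action.descend (toGal h)
    h.simple₀.pb_faithful
    h.simple₂.pb_faithful Q ψ
    ((under P _).map D'.iso.hom) ((underlying P _).obj D').unit ((underlying P _).obj D').cocycle
    (by rw [← hψ]; exact under_constArrowIso_hom h ψ)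
  refine ⟨R, ⟨?_ ≪≫ D.transportIso e.symm⟩⟩
  refine Action.isoMk (Iso.refl ((const₀ h).obj Q)) ?_
  refine (congrArg (· ≫ _) (CategoryTheory.Functor.map_id _ _)).trans ?_
  refine (Category.id_comp _).trans (Eq.trans ?_ (congrArg (_ ≫ ·)
    (CategoryTheory.Functor.map_id _ _)).symm)
  refine Eq.trans ?_ (Category.comp_id _).symm
  exact (congrArg Iso.hom hψ).symm

/-- Underlying the descent datum given by an action `R` of the Galois precategory is the pullback of
`R` along the canonical morphism from the kernel pair. -/
noncomputable def galToDescentUnderlying :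
    galToDescent h ⋙ underlying P (Precat.kernel f) ≅ Action.pull P (toGal h) :=
  NatIso.ofComponents (fun R => Action.isoMk (Iso.refl ((pb P (toGal h).f₀).obj R.obj)) (by
      refine (congrArg (· ≫ _) (CategoryTheory.Functor.map_id _ _)).trans ?_
      refine (Category.id_comp _).trans (Eq.trans ?_ (congrArg (_ ≫ ·)
        (CategoryTheory.Functor.map_id _ _)).symm)
      refine Eq.trans ?_ (Category.comp_id _).symm
      exact (under_constArrowIso_eq_pullIso h R).symm))
    (fun a => Action.hom_ext ((Category.comp_id _).trans (Category.id_comp _).symm))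

/-- The functor from `δ↓P(Y)` to descent data, sending `A` to `f^* A` with its canonical descent
datum. -/
noncomputable abbrev toDescent (P : Pseudofunctor (LocallyDiscrete (Over S)ᵒᵖ) Cat.{v, w})
    (f : X ⟶ Y) : (delta P).obj ⟨op Y⟩ ⥤ Action (delta P) (Precat.kernel f) :=
  Action.augment (delta P) (Precat.kernel f) f pullback.condition

lemma exists_galToDescent_toDescent_iso (A : (delta P).obj ⟨op Y⟩)
    (hA : split P f h.leaves_source A) :
    ∃ R, Nonempty ((galToDescent h).obj R ≅ (toDescent P f).obj A) := by
  obtain ⟨Q, ⟨e⟩⟩ := hA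
  exact exists_galToDescent_iso h _ Q e

lemma split_of_iso {A : (delta P).obj ⟨op Y⟩} {R : Action P (gal h)}
    (e : (toDescent P f).obj A ≅ (galToDescent h).obj R) : split P f h.leaves_source A :=
  ⟨R.obj, ⟨(Action.forget (delta P) (Precat.kernel f)).mapIso e⟩⟩

/-- The equivalence between descent data and `δ↓P(Y)`. -/
noncomputable def descentEquiv : (delta P).obj ⟨op Y⟩ ≌ Action (delta P) (Precat.kernel f) :=
  have : (toDescent P f).IsEquivalence := h.effectiveDescent
  (toDescent P f).asEquivalence

/-- The functor sending an action of the Galois precategory on `Q` to the object of `δ↓P(Y)` given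
by descent of `C_X(Q)`. -/
noncomputable def galToSplit : Action P (gal h) ⥤ (split P f h.leaves_source).FullSubcategory :=
  (split P f h.leaves_source).lift (galToDescent h ⋙ (descentEquiv h).inverse)
    (fun R => split_of_iso h ((descentEquiv h).counitIso.app ((galToDescent h).obj R)))

/-- The descent datum of the object given by `galToSplit`. -/
noncomputable def galToSplitDescentIso :
    galToSplit h ⋙ (split P f h.leaves_source).ι ⋙ toDescent P f ≅ galToDescent h :=
  (galToDescent h).isoWhiskerLeft (descentEquiv h).counitIso ≪≫ (galToDescent h).rightUnitor

instance : (galToSplit h).Faithful :=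
  have : (toDescent P f).IsEquivalence := h.effectiveDescent
  have : (galToSplit h ⋙ (split P f h.leaves_source).ι ⋙ toDescent P f).Faithful :=
    Functor.Faithful.of_iso (galToSplitDescentIso h).symm
  Functor.Faithful.of_comp (galToSplit h) ((split P f h.leaves_source).ι ⋙ toDescent P f)

instance : (galToSplit h).Full :=
  have : (toDescent P f).IsEquivalence := h.effectiveDescent
  have : (galToSplit h ⋙ (split P f h.leaves_source).ι ⋙ toDescent P f).Full :=
    Functor.Full.of_iso (galToSplitDescentIso h).symm
  Functor.Full.of_comp_faithful (galToSplit h) ((split P f h.leaves_source).ι ⋙ toDescent P f)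

instance : (galToSplit h).EssSurj where
  mem_essImage A := by
    have : (toDescent P f).IsEquivalence := h.effectiveDescent
    obtain ⟨R, ⟨e⟩⟩ := exists_galToDescent_toDescent_iso h A.obj A.property
    exact ⟨R, ⟨((split P f h.leaves_source).ι ⋙ toDescent P f).preimageIso
      ((galToSplitDescentIso h).app R ≪≫ e)⟩⟩

/-- The equivalence between the objects of `δ↓P(Y)` that are split by `f` and the actions of the
Galois precategory, inverse to `galToSplit`. -/
noncomputable def galoisEquiv : (split P f h.leaves_source).FullSubcategory ≌ Action P (gal h) :=
  have : (galToSplit h).IsEquivalence := { }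
  (galToSplit h).asEquivalence.symm

/-- The descent datum of an object `A` that is split by `f` is the one given by the action of the
Galois precategory that corresponds to `A`. -/
noncomputable def galoisEquivDescentIso : (galoisEquiv h).functor ⋙ galToDescent h ≅
    (split P f h.leaves_source).ι ⋙ toDescent P f :=
  (galoisEquiv h).functor.isoWhiskerLeft (galToSplitDescentIso h).symm ≪≫
    Functor.isoWhiskerRight (galoisEquiv h).unitIso.symm
      ((split P f h.leaves_source).ι ⋙ toDescent P f)

/-- The Galois equivalence for pre-Picard-Vessiot morphisms. The isomorphism `C_X(E(A)) ≅ f^* A` is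
the one that underlies the isomorphism of descent data `galoisEquivDescentIso`. -/
theorem galoisEquivalence : GaloisEquivalence h := by
  refine ⟨galoisEquiv h, Functor.isoWhiskerRight (galoisEquivDescentIso h)
      (Action.forget (delta P) (Precat.kernel f)),
    (galoisEquiv h).functor.isoWhiskerLeft (galToDescentUnderlying h).symm ≪≫
    Functor.isoWhiskerRight (galoisEquivDescentIso h) (underlying P (Precat.kernel f)) ≪≫
    (split P f h.leaves_source).ι.isoWhiskerLeft (augmentUnderlying P f), fun A => ?_⟩
  -- The other two factors of `θ'` are identities on underlying morphisms.
  exact ((Category.id_comp _).trans (Category.comp_id _)).symm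

end Galois

end DSch

/-! ### Universal coequalisers and cartesian morphisms of the self-indexing -/

section Coequalizers

variable {C : Type u₁} [Category.{v₁} C]

lemma isCoeq_iff {A B Q : C} {a b : A ⟶ B} {c : B ⟶ Q} :
    IsCoeq a b c ↔ a ≫ c = b ≫ c ∧
      ∀ ⦃Z : C⦄ (z : B ⟶ Z), a ≫ z = b ≫ z → ∃! t : Q ⟶ Z, c ≫ t = z := by
  constructor
  · rintro ⟨w, ⟨hl⟩⟩
    exact ⟨w, fun Z z hz => ⟨Cofork.IsColimit.desc hl z hz, Cofork.IsColimit.π_desc' hl z hz,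
      fun t ht => Cofork.IsColimit.hom_ext hl (ht.trans (Cofork.IsColimit.π_desc' hl z hz).symm)⟩⟩
  · rintro ⟨w, hl⟩
    exact ⟨w, ⟨Cofork.IsColimit.mk _ (fun s => (hl s.π s.condition).choose)
      (fun s => (hl s.π s.condition).choose_spec.1)
      (fun s m hm => (hl s.π s.condition).choose_spec.2 m hm)⟩⟩

lemma IsCoeq.of_iso {A B Q A' B' Q' : C} {a b : A ⟶ B} {c : B ⟶ Q} {a' b' : A' ⟶ B'}
    {c' : B' ⟶ Q'} (h : IsCoeq a b c) (e₁ : A' ≅ A) (e₀ : B' ≅ B) (e : Q' ≅ Q)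
    (ha : a' ≫ e₀.hom = e₁.hom ≫ a) (hb : b' ≫ e₀.hom = e₁.hom ≫ b)
    (hc : c' ≫ e.hom = e₀.hom ≫ c) : IsCoeq a' b' c' := by
  rw [isCoeq_iff] at h ⊢
  obtain ⟨w, h⟩ := h
  have ha' : e₁.inv ≫ a' = a ≫ e₀.inv := by rw [Iso.inv_comp_eq, ← Category.assoc, ← ha]; simp
  have hb' : e₁.inv ≫ b' = b ≫ e₀.inv := by rw [Iso.inv_comp_eq, ← Category.assoc, ← hb]; simp
  refine ⟨?_, fun Z z hz => ?_⟩
  · rw [← cancel_mono e.hom, Category.assoc, Category.assoc, hc, reassoc_of% ha, reassoc_of% hb, w]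
  · obtain ⟨t, ht, ht'⟩ := h (e₀.inv ≫ z) (by rw [← reassoc_of% ha', ← reassoc_of% hb', hz])
    refine ⟨e.hom ≫ t, ?_, fun y hy => ?_⟩
    · change c' ≫ e.hom ≫ t = z
      rw [reassoc_of% hc, ht, Iso.hom_inv_id_assoc]
    · rw [← Iso.inv_comp_eq]
      refine ht' _ ?_
      change c ≫ e.inv ≫ y = _
      rw [← hy, Iso.eq_inv_comp, ← reassoc_of% hc, Iso.hom_inv_id_assoc]

namespace IsUniversalCoeq

variable [HasPullbacks C] {W : MorphismProperty C} {A B Q A' B' Q' : C} {a b : A ⟶ B}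
  {c : B ⟶ Q} {a' b' : A' ⟶ B'} {c' : B' ⟶ Q'}

/-- The base change of a universal coequaliser along a morphism of the class is a coequaliser, for
arbitrary cartesian squares in place of the chosen pullbacks. -/
lemma isCoeq_of_isPullback (h : IsUniversalCoeq W a b c) {q : Q' ⟶ Q} (hq : W q) {x : A' ⟶ A}
    {y : B' ⟶ B} (hB : IsPullback y c' c q) (hA : IsPullback x (a' ≫ c') (a ≫ c) q)
    (ha : a' ≫ y = x ≫ a) (hb : b' ≫ y = x ≫ b) (hw : a' ≫ c' = b' ≫ c') : IsCoeq a' b' c' := by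
  refine (h.universal q hq).of_iso hA.isoPullback hB.isoPullback (Iso.refl _) ?_ ?_ ?_
  · refine pullback.hom_ext ?_ ?_
    · rw [Category.assoc, Category.assoc, pullback.lift_fst, hB.isoPullback_hom_fst, ha,
        hA.isoPullback_hom_fst_assoc]
    · rw [Category.assoc, Category.assoc, pullback.lift_snd, hB.isoPullback_hom_snd,
        hA.isoPullback_hom_snd]
  · refine pullback.hom_ext ?_ ?_
    · rw [Category.assoc, Category.assoc, pullback.lift_fst, hB.isoPullback_hom_fst, hb,
        hA.isoPullback_hom_fst_assoc]
    · rw [Category.assoc, Category.assoc, pullback.lift_snd, hB.isoPullback_hom_snd,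
        hA.isoPullback_hom_snd, hw]
  · simp

/-- Universal coequalisers are stable under base change along morphisms of the class. -/
lemma of_isPullback [W.IsStableUnderComposition] (h : IsUniversalCoeq W a b c) {q : Q' ⟶ Q}
    (hq : W q) {x : A' ⟶ A}
    {y : B' ⟶ B} (hB : IsPullback y c' c q) (hA : IsPullback x (a' ≫ c') (a ≫ c) q)
    (ha : a' ≫ y = x ≫ a) (hb : b' ≫ y = x ≫ b) (hw : a' ≫ c' = b' ≫ c') :
    IsUniversalCoeq W a' b' c' where
  w := hw
  isCoeq := h.isCoeq_of_isPullback hq hB hA ha hb hw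
  universal {R} r hr := by
    refine h.isCoeq_of_isPullback (W.comp_mem r q hr hq) (x := pullback.fst _ _ ≫ x)
      (y := pullback.fst _ _ ≫ y) ?_ ?_ ?_ ?_ ?_
    · exact ((IsPullback.of_hasPullback c' r).flip.paste_vert hB.flip).flip
    · rw [pullback.lift_snd]
      exact ((IsPullback.of_hasPullback (a' ≫ c') r).flip.paste_vert hA.flip).flip
    · rw [pullback.lift_fst_assoc, Category.assoc, Category.assoc, ha]
    · rw [pullback.lift_fst_assoc, Category.assoc, Category.assoc, hb]
    · rw [pullback.lift_snd, pullback.lift_snd]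

lemma comp_iso [W.RespectsIso] (h : IsUniversalCoeq W a b c) (e : Q ≅ Q') :
    IsUniversalCoeq W a b (c ≫ e.hom) where
  w := by rw [reassoc_of% h.w]
  isCoeq := h.isCoeq.of_iso (Iso.refl _) (Iso.refl _) e.symm (by simp) (by simp) (by simp)
  universal {R} r hr := by
    have hB : IsPullback (pullback.fst (c ≫ e.hom) r) (pullback.snd _ _) c (r ≫ e.inv) :=
      IsPullback.of_iso (IsPullback.of_hasPullback (c ≫ e.hom) r) (Iso.refl _) (Iso.refl _)
        (Iso.refl _) e.symm (by simp) (by simp) (by simp) (by simp)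
    have hA : IsPullback (pullback.fst (a ≫ c ≫ e.hom) r) (pullback.snd _ _) (a ≫ c)
        (r ≫ e.inv) :=
      IsPullback.of_iso (IsPullback.of_hasPullback (a ≫ c ≫ e.hom) r) (Iso.refl _) (Iso.refl _)
        (Iso.refl _) e.symm (by simp) (by simp) (by simp) (by simp)
    refine h.isCoeq_of_isPullback (q := r ≫ e.inv)
      (MorphismProperty.RespectsIso.postcomp W e.inv r hr)
      (x := pullback.fst _ _) (y := pullback.fst _ _) hB ?_ ?_ ?_ ?_
    · rw [pullback.lift_snd]
      exact hA
    · exact pullback.lift_fst _ _ _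
    · exact pullback.lift_fst _ _ _
    · rw [pullback.lift_snd, pullback.lift_snd]

end IsUniversalCoeq

end Coequalizers

section SelfIndexing

variable {C : Type u₁} [Category.{v₁} C] (W : MorphismProperty C) [HasPullbacks C]
  [W.IsStableUnderBaseChange]

/-- A cartesian morphism of the total category of the self-indexing is a pullback square. -/
lemma domFunctor_isPullback {A B : Pseudofunctor.CoGrothendieck (selfIndexing W)} (φ : A ⟶ B)
    [IsIso (asOverHom W φ)] :
    IsPullback ((domFunctor W).map φ) (asOver W A).hom (asOver W B).hom φ.base := by
  have h : (asOverHom W φ).left ≫ pullback.snd (asOver W B).hom φ.base = (asOver W A).hom :=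
    MorphismProperty.Over.w (asOverHom W φ)
  have hi : IsIso (asOverHom W φ).left :=
    Functor.map_isIso (MorphismProperty.Over.forget W ⊤ _ ⋙ Over.forget _) (asOverHom W φ)
  refine IsPullback.of_iso_pullback ⟨?_⟩ (@asIso _ _ _ _ _ hi) rfl h
  exact overPullback_fst_hom W φ.base (asOverHom W φ)

lemma asOver_prop (A : Pseudofunctor.CoGrothendieck (selfIndexing W)) : W (asOver W A).hom :=
  (asOver W A).prop

end SelfIndexing

/-! ### Simplicity with respect to the self-indexing -/

namespace DSch

variable {S : Scheme.{u}} (W : MorphismProperty (Over S)) [W.IsStableUnderBaseChange]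
  {P : Pseudofunctor (LocallyDiscrete (Over S)ᵒᵖ) Cat.{u, u + 1}}
  (U : Pseudofunctor.StrongTrans P (selfIndexing W))

/-- A transformation to the self-indexing maps cartesian morphisms to pullback squares. -/
lemma isPullback_map {A B : Pseudofunctor.CoGrothendieck P} (φ : A ⟶ B) [IsIso φ.fiber] :
    IsPullback ((domFunctor W).map ((Pseudofunctor.CoGrothendieck.map U).map φ))
      (asOver W ((Pseudofunctor.CoGrothendieck.map U).obj A)).hom
      (asOver W ((Pseudofunctor.CoGrothendieck.map U).obj B)).hom φ.base := by
  have : IsIso (asOverHom W ((Pseudofunctor.CoGrothendieck.map U).map φ)) := by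
    have h₁ : IsIso ((U.app ⟨op A.base⟩).toFunctor.map φ.fiber) := inferInstance
    have h₂ : IsIso ((U.naturality φ.base.op.toLoc).hom.toNatTrans.app B.fiber) :=
      inferInstanceAs (IsIso (((Cat.Hom.toNatIso (U.naturality φ.base.op.toLoc)).app B.fiber).hom))
    exact IsIso.comp_isIso' h₁ h₂
  exact domFunctor_isPullback W ((Pseudofunctor.CoGrothendieck.map U).map φ)

/-- A transformation to the self-indexing maps forks of cartesian morphisms over a universal
coequaliser to universal coequalisers. -/
lemma isUniversalCoeq_map [W.IsStableUnderComposition] {A B Q : Pseudofunctor.CoGrothendieck P}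
    (a b : A ⟶ B) (c : B ⟶ Q) (hw : a ≫ c = b ≫ c) (ha : IsIso a.fiber) (hb : IsIso b.fiber)
    (hc : IsIso c.fiber) (h : IsUniversalCoeq W a.base b.base c.base) :
    IsUniversalCoeq W ((domFunctor W).map ((Pseudofunctor.CoGrothendieck.map U).map a))
      ((domFunctor W).map ((Pseudofunctor.CoGrothendieck.map U).map b))
      ((domFunctor W).map ((Pseudofunctor.CoGrothendieck.map U).map c)) := by
  have pa := isPullback_map W U a
  have pb := isPullback_map W U b
  have pc := isPullback_map W U c
  have hw' : (domFunctor W).map ((Pseudofunctor.CoGrothendieck.map U).map a) ≫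
      (domFunctor W).map ((Pseudofunctor.CoGrothendieck.map U).map c) =
      (domFunctor W).map ((Pseudofunctor.CoGrothendieck.map U).map b) ≫
      (domFunctor W).map ((Pseudofunctor.CoGrothendieck.map U).map c) := by
    rw [← Functor.map_comp, ← Functor.map_comp, ← Functor.map_comp, ← Functor.map_comp, hw]
  exact h.of_isPullback (asOver_prop W _) pc.flip (pa.paste_horiz pc).flip pa.w pb.w hw'

lemma constProj_condition (X : DSch S) (h : HasLeaves X) (Q : P.obj ⟨op (X.leaves h)⟩) :
    ((constFunctor P X h).obj Q).src ≫ constProj P X h Q =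
      ((constFunctor P X h).obj Q).tgt ≫ constProj P X h Q :=
  Action.augmentProj_condition (F := P) (G := X.toPrecat) (X.eta h).toOver
    (toPrecat_condition _) Q

/-- If `P` has a transformation to the self-indexing that reflects universal coequalisers, then
simplicity with respect to the self-indexing implies simplicity with respect to `P`. -/
lemma IsSimpleFor.isSimple [W.IsStableUnderComposition] (hU : ReflectsUniversalCoeq W U)
    {X : DSch S} (h : IsSimpleFor W X) : IsSimple P X := by
  refine ⟨h.hasLeaves, h.isUniversalCoeq.isCoeq, fun Q => ?_⟩
  have hw := constProj_condition X h.hasLeaves Q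
  refine hU X h.hasLeaves _ Q (constProj P X h.hasLeaves Q) rfl hw ?_
  have i₁ : IsIso ((constFunctor P X h.hasLeaves).obj Q).src.fiber :=
    IsIso.id _
  have i₂ : IsIso ((constFunctor P X h.hasLeaves).obj Q).tgt.fiber :=
    ((constFunctor P X h.hasLeaves).obj Q).iso.isIso_hom
  have i₃ : IsIso (constProj P X h.hasLeaves Q).fiber := IsIso.id _
  exact isUniversalCoeq_map W U _ _ _ hw i₁ i₂ i₃ h.isUniversalCoeq

end DSch

/-! ### Coequalisers and fibre products of differential schemes -/

/-- Formation of `X[ε_i]` commutes with base change. -/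
lemma thickMap_isPullback {X Y : Scheme.{u}} (f : X ⟶ Y) (ι : Type) :
    IsPullback (thickMap f ι) (thickProj X ι) (thickProj Y ι) f := by
  refine ⟨⟨thickMap_proj f ι⟩, ⟨PullbackCone.IsLimit.mk _
    (fun s => thickLift s.snd (fun i => s.fst.appTop (eps Y i))
      (fun i j => by rw [← map_mul, eps_mul, map_zero])) (fun s => ?_)
    (fun s => thickLift_proj _ _ _) (fun s m h₁ h₂ => ?_)⟩⟩
  · refine thick_hom_ext ?_ fun i => ?_
    · rw [Category.assoc, thickMap_proj, ← Category.assoc, thickLift_proj, s.condition]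
    · rw [Scheme.Hom.comp_appTop, CategoryTheory.comp_apply, thickMap_eps, thickLift_eps]
  · refine thick_hom_ext (h₂.trans (thickLift_proj _ _ _).symm) fun i => ?_
    rw [thickLift_eps, ← h₁, Scheme.Hom.comp_appTop, CategoryTheory.comp_apply, thickMap_eps]

namespace DSch

variable {S : Scheme.{u}}

lemma const_flow (T : Over S) : ((const S).obj T).der.flow = thickProj T.left Unit := by
  have h := twist_comp_of_zero ((const S).obj T).der (thickProj T.left Unit) (eps T.left ())
    (eps_mul _ _) (f := 𝟙 T.left) (fun _ _ => rfl)
  exact (Category.comp_id _).symm.trans (h.trans (Category.comp_id _))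

/-- A morphism of `S`-schemes from a differential scheme that coequalises `X₁ ⇉ X₀`, as a
differential morphism to a scheme with zero derivation. -/
def homOfCondition {X : DSch S} {T : Over S} (h : X.X ⟶ T)
    (w : X.toPrecat.d₀ ≫ h = X.toPrecat.d₁ ≫ h) : X ⟶ (const S).obj T where
  toOver := h
  isDifferential := (isDifferential_iff_flow _ _ _).2 <| by
    rw [const_flow]
    exact (congrArg Over.Hom.left w).symm.trans (thickMap_proj h.left Unit).symm

/-- The underlying scheme of a fibre product of differential schemes is the fibre product. -/
instance {X Y Z : DSch S} (f : X ⟶ Z) (g : Y ⟶ Z) :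
    PreservesLimit (cospan f g) (forget S) := by
  refine preservesLimit_of_preserves_limit_cone (isPullback f g).isLimit ?_
  refine (isLimitMapConePullbackConeEquiv (forget S) (isPullback f g).w).symm ?_
  have h : IsPullback ((forget S).map (pullbackFst f g)) ((forget S).map (pullbackSnd f g))
      ((forget S).map f) ((forget S).map g) :=
    IsPullback.of_map (Over.forget S) (congrArg Hom.toOver (isPullback f g).w)
      (IsPullback.of_hasPullback f.toOver.left g.toOver.left)
  exact h.isLimit

lemma isPullback_lift_condition {A B C D : Over S} {a : A ⟶ B} {b : A ⟶ C} {c : B ⟶ D}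
    {d : C ⟶ D} (h : IsPullback a b c d) {X : DSch S} (x : X ⟶ (const S).obj B)
    (y : X ⟶ (const S).obj C) (l : X.toPrecat.C₀ ⟶ A) (hx : l ≫ a = x.toOver)
    (hy : l ≫ b = y.toOver) :
    X.toPrecat.d₀ ≫ l = X.toPrecat.d₁ ≫ l := by
  refine h.hom_ext ?_ ?_
  · refine (Category.assoc _ _ _).trans (Eq.trans ?_ (Category.assoc _ _ _).symm)
    exact hx ▸ toPrecat_condition x
  · refine (Category.assoc _ _ _).trans (Eq.trans ?_ (Category.assoc _ _ _).symm)
    exact hy ▸ toPrecat_condition y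

/-- `C` preserves pullbacks: into a scheme with zero derivation, a morphism is differential if and
only if it coequalises `X₁ ⇉ X₀`, which can be checked after the projections. -/
lemma const_map_isPullback {A B C D : Over S} {a : A ⟶ B} {b : A ⟶ C} {c : B ⟶ D} {d : C ⟶ D}
    (h : IsPullback a b c d) :
    IsPullback ((const S).map a) ((const S).map b) ((const S).map c) ((const S).map d) := by
  have w (s : PullbackCone ((const S).map c) ((const S).map d)) :
      s.fst.toOver ≫ c = s.snd.toOver ≫ d := congrArg Hom.toOver s.condition
  refine ⟨⟨hom_ext h.w⟩, ⟨PullbackCone.IsLimit.mk _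
    (fun s => homOfCondition (h.lift s.fst.toOver s.snd.toOver (w s))
      (isPullback_lift_condition h s.fst s.snd _ (h.lift_fst _ _ _) (h.lift_snd _ _ _)))
    (fun s => hom_ext (h.lift_fst _ _ _)) (fun s => hom_ext (h.lift_snd _ _ _))
    (fun s m h₁ h₂ => hom_ext (h.hom_ext ?_ ?_))⟩⟩
  · exact (congrArg Hom.toOver h₁).trans (h.lift_fst _ _ (w s)).symm
  · exact (congrArg Hom.toOver h₂).trans (h.lift_snd _ _ (w s)).symm

section Coequalizer

variable {X : DSch S} {T : Over S} {t : X ⟶ (const S).obj T}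

/-- A coequaliser of `X₁ ⇉ X₀` corepresents the differential morphisms from `X` to schemes with
zero derivation. -/
noncomputable def corepresentable (h : IsCoeq X.toPrecat.d₀ X.toPrecat.d₁ t.toOver) :
    ((const S) ⋙ coyoneda.obj (op X)).CorepresentableBy T where
  homEquiv {T'} := Equiv.ofBijective (fun g => t ≫ (const S).map g) <| by
    have h' := (isCoeq_iff.1 h).2
    constructor
    · intro g g' e
      exact (h' (t ≫ (const S).map g).toOver (toPrecat_condition _)).unique rfl
        (congrArg Hom.toOver e).symm
    · intro k
      obtain ⟨g, hg, -⟩ := h' k.toOver (toPrecat_condition k)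
      exact ⟨g, hom_ext hg⟩
  homEquiv_comp g f := by
    change t ≫ (const S).map (f ≫ g) = (t ≫ (const S).map f) ≫ (const S).map g
    rw [Functor.map_comp, Category.assoc]

lemma hasLeaves_of_isCoeq (h : IsCoeq X.toPrecat.d₀ X.toPrecat.d₁ t.toOver) : HasLeaves X :=
  (corepresentable h).isCorepresentable

lemma eta_hom_ext {h : HasLeaves X} {T' : Over S} {a b : X.leaves h ⟶ T'}
    (e : X.eta h ≫ (const S).map a = X.eta h ≫ (const S).map b) : a = b := by
  refine (const S).partialLeftAdjointHomEquiv (X := ⟨X, h⟩) |>.injective ?_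
  have key (c : X.leaves h ⟶ T') : (const S).partialLeftAdjointHomEquiv (X := ⟨X, h⟩) c =
      X.eta h ≫ (const S).map c :=
    (congrArg _ (Category.id_comp c).symm).trans
      ((const S).partialLeftAdjointHomEquiv_comp (X := ⟨X, h⟩) (𝟙 _) c)
  rw [key, key, e]

/-- The comparison of the categorical scheme of leaves with a coequaliser of `X₁ ⇉ X₀`. -/
lemma exists_leavesIso (hX : HasLeaves X) (h : IsCoeq X.toPrecat.d₀ X.toPrecat.d₁ t.toOver) :
    ∃ e : X.leaves hX ≅ T, X.eta hX ≫ (const S).map e.hom = t := by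
  let d := (const S).partialLeftAdjointHomEquiv (X := ⟨X, hX⟩).symm t
  have hd : X.eta hX ≫ (const S).map d = t := by
    refine Eq.trans ?_ ((const S).partialLeftAdjointHomEquiv (X := ⟨X, hX⟩).apply_symm_apply t)
    exact ((congrArg _ (Category.id_comp d).symm).trans
      ((const S).partialLeftAdjointHomEquiv_comp (X := ⟨X, hX⟩) (𝟙 _) d)).symm
  let d' : T ⟶ X.leaves hX := (corepresentable h).homEquiv.symm (X.eta hX)
  have hd' : t ≫ (const S).map d' = X.eta hX := (corepresentable h).homEquiv.apply_symm_apply _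
  refine ⟨⟨d, d', eta_hom_ext ?_, (corepresentable h).homEquiv.injective ?_⟩, hd⟩
  · rw [Functor.map_comp, reassoc_of% hd, hd', CategoryTheory.Functor.map_id, Category.comp_id]
  · change t ≫ (const S).map (d' ≫ d) = t ≫ (const S).map (𝟙 T)
    rw [Functor.map_comp, reassoc_of% hd', hd, CategoryTheory.Functor.map_id, Category.comp_id]

end Coequalizer

variable (W : MorphismProperty (Over S))

/-- Universal connected components are stable under the base changes `Z ×_{C(T)} C(T') ⟶ Z`. -/
lemma isUniversalCoeq_of_isPullback [W.IsStableUnderComposition] {Z Z' : DSch S} {T T' : Over S}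
    {c : Z ⟶ (const S).obj T} {t : Z' ⟶ (const S).obj T'} {p : Z' ⟶ Z} {g : T' ⟶ T} (hg : W g)
    (hc : IsUniversalCoeq W Z.toPrecat.d₀ Z.toPrecat.d₁ c.toOver)
    (h : IsPullback t p ((const S).map g) c) :
    IsUniversalCoeq W Z'.toPrecat.d₀ Z'.toPrecat.d₁ t.toOver := by
  have hB : IsPullback p.toOver t.toOver c.toOver g := (h.map (forget S)).flip
  -- The cartesian square of the `d₀` suffices: `d₀` and `d₁` agree after composition to `T`.
  have hD : IsPullback ((precat S).map p).f₁ Z'.toPrecat.d₀ Z.toPrecat.d₀ p.toOver :=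
    IsPullback.of_map (Over.forget S) ((precat S).map p).d₀.symm
      (thickMap_isPullback p.toOver.left Unit)
  exact hc.of_isPullback hg hB (hD.paste_vert hB) ((precat S).map p).d₀ ((precat S).map p).d₁
    (toPrecat_condition t)

/-- Over a simple `Z`, the base change of `T' ⟶ π₀(Z)` in `W` is simple, with scheme of leaves
`T'`. -/
lemma IsSimpleFor.of_isPullback [W.RespectsIso] [W.IsStableUnderComposition] {Z Z' : DSch S}
    {T' : Over S} (hZ : IsSimpleFor W Z) {t : Z' ⟶ (const S).obj T'} {p : Z' ⟶ Z}
    {g : T' ⟶ Z.leaves hZ.hasLeaves} (hg : W g)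
    (h : IsPullback t p ((const S).map g) (Z.eta hZ.hasLeaves)) :
    ∃ (hZ' : IsSimpleFor W Z') (e : Z'.leaves hZ'.hasLeaves ≅ T'),
      Z'.eta hZ'.hasLeaves ≫ (const S).map e.hom = t := by
  have hu := isUniversalCoeq_of_isPullback W hg hZ.isUniversalCoeq h
  have hL := hasLeaves_of_isCoeq hu.isCoeq
  obtain ⟨e, he⟩ := exists_leavesIso hL hu.isCoeq
  refine ⟨⟨hL, ?_⟩, e, he⟩
  have hu' := hu.comp_iso e.symm
  have : Z'.eta hL = t ≫ (const S).map e.inv := by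
    rw [← he, Category.assoc, ← Functor.map_comp, e.hom_inv_id,
      CategoryTheory.Functor.map_id, Category.comp_id]
  rw [this]
  exact hu'

end DSch

/-! ### Split morphisms -/

namespace DSch

variable {S : Scheme.{u}}

/-- The morphism of categorical schemes of leaves induced by a differential morphism. -/
noncomputable abbrev leavesMap {X Y : DSch S} (hX : HasLeaves X) (hY : HasLeaves Y) (p : X ⟶ Y) :
    X.leaves hX ⟶ Y.leaves hY :=
  (const S).partialLeftAdjoint.map
    (ObjectProperty.homMk p : (⟨X, hX⟩ : (const S).PartialLeftAdjointSource) ⟶ ⟨Y, hY⟩)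

lemma comp_eta {X Y : DSch S} (hX : HasLeaves X) (hY : HasLeaves Y) (p : X ⟶ Y) :
    p ≫ Y.eta hY = X.eta hX ≫ (const S).map (leavesMap hX hY p) :=
  hom_ext (eta_naturality (X := ⟨X, hX⟩) (Y := ⟨Y, hY⟩) (ObjectProperty.homMk p))

variable (W : MorphismProperty (Over S))

/-- `p : Z' ⟶ Z` is split over `Z`: it is the base change along `Z ⟶ C(π₀(Z))` of a morphism of
`W`, namely of `π₀(Z') ⟶ π₀(Z)`. -/
structure IsSplit {Z' Z : DSch S} (p : Z' ⟶ Z) (hZ' : HasLeaves Z') (hZ : HasLeaves Z) : Prop where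
  mem : W (leavesMap hZ' hZ p)
  isPullback : IsPullback (Z'.eta hZ') p ((const S).map (leavesMap hZ' hZ p)) (Z.eta hZ)

variable [W.IsStableUnderBaseChange] [W.IsStableUnderComposition]

/-- Over a simple `Z`, a base change of a morphism `T' ⟶ π₀(Z)` in `W` is simple and split. -/
lemma IsSimpleFor.isSplit_of_isPullback {Z Z' : DSch S}
    {T' : Over S} (hZ : IsSimpleFor W Z) {t : Z' ⟶ (const S).obj T'} {p : Z' ⟶ Z}
    {g : T' ⟶ Z.leaves hZ.hasLeaves} (hg : W g)
    (h : IsPullback t p ((const S).map g) (Z.eta hZ.hasLeaves)) :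
    ∃ (hZ' : IsSimpleFor W Z'), IsSplit W p hZ'.hasLeaves hZ.hasLeaves ∧
      ∃ e : Z'.leaves hZ'.hasLeaves ≅ T', Z'.eta hZ'.hasLeaves ≫ (const S).map e.hom = t ∧
        leavesMap hZ'.hasLeaves hZ.hasLeaves p = e.hom ≫ g := by
  obtain ⟨hZ', e, he⟩ := hZ.of_isPullback W hg h
  have hp : leavesMap hZ'.hasLeaves hZ.hasLeaves p = e.hom ≫ g := by
    refine eta_hom_ext ?_
    rw [← comp_eta, Functor.map_comp, reassoc_of% he, h.w]
  refine ⟨hZ', ⟨?_, ?_⟩, e, he, hp⟩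
  · rw [hp]
    exact MorphismProperty.RespectsIso.precomp W e.hom g hg
  · refine IsPullback.of_iso h (Iso.refl _) ((const S).mapIso e.symm) (Iso.refl _) (Iso.refl _)
      ?_ ?_ ?_ ?_
    · rw [Functor.mapIso_hom, Iso.symm_hom, Iso.refl_hom, Category.id_comp, ← he, Category.assoc,
        ← Functor.map_comp, e.hom_inv_id, CategoryTheory.Functor.map_id, Category.comp_id]
    · simp
    · rw [hp, Functor.mapIso_hom, Iso.symm_hom, Iso.refl_hom, Category.comp_id,
        ← Functor.map_comp, e.inv_hom_id_assoc]
    · simp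

/-- Base change of a split morphism along a morphism from a simple differential scheme is simple
and split, and the functor `π₀` preserves this fibre product. -/
lemma IsSplit.baseChange {Z Z' V V' : DSch S} {p : Z' ⟶ Z} {hZ' : HasLeaves Z'}
    {hZ : HasLeaves Z} (hp : IsSplit W p hZ' hZ) (hV : IsSimpleFor W V) {s : V ⟶ Z} {a : V' ⟶ V}
    {b : V' ⟶ Z'} (h : IsPullback a b s p) :
    ∃ (hV' : IsSimpleFor W V'), IsSplit W a hV'.hasLeaves hV.hasLeaves ∧
      IsPullback (leavesMap hV'.hasLeaves hV.hasLeaves a) (leavesMap hV'.hasLeaves hZ' b)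
        (leavesMap hV.hasLeaves hZ s) (leavesMap hZ' hZ p) := by
  let ps := leavesMap hV.hasLeaves hZ s
  let pp := leavesMap hZ' hZ p
  have hG : IsPullback (pullback.fst ps pp) (pullback.snd ps pp) ps pp :=
    IsPullback.of_hasPullback ps pp
  have hC := const_map_isPullback hG
  -- `V'` is the base change of `G' = π₀(V) ×_{π₀(Z)} π₀(Z')` along `V ⟶ C(π₀(V))`.
  have w : (a ≫ V.eta hV.hasLeaves) ≫ (const S).map ps = (b ≫ Z'.eta hZ') ≫ (const S).map pp := by
    rw [Category.assoc, Category.assoc, ← comp_eta, ← comp_eta, reassoc_of% h.w]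
  have outer : IsPullback a (b ≫ Z'.eta hZ') (V.eta hV.hasLeaves ≫ (const S).map ps)
      ((const S).map pp) := by
    rw [← comp_eta]
    exact h.paste_vert hp.isPullback.flip
  let t : V' ⟶ (const S).obj (pullback ps pp) := hC.lift _ _ w
  have ht : IsPullback t a ((const S).map (pullback.fst ps pp)) (V.eta hV.hasLeaves) :=
    IsPullback.of_right (h₁₂ := (const S).map (pullback.snd ps pp)) (h₂₂ := (const S).map ps)
      (v₁₃ := (const S).map pp) (by rw [hC.lift_snd]; exact outer.flip) (hC.lift_fst _ _ w) hC.flip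
  obtain ⟨hV', hs, e, he, hea⟩ :=
    hV.isSplit_of_isPullback W (MorphismProperty.pullback_fst ps pp hp.mem) ht
  refine ⟨hV', hs, ?_⟩
  have heb : leavesMap hV'.hasLeaves hZ' b = e.hom ≫ pullback.snd ps pp := by
    refine eta_hom_ext ?_
    rw [← comp_eta, Functor.map_comp, reassoc_of% he, hC.lift_snd]
  exact IsPullback.of_iso hG e.symm (Iso.refl _) (Iso.refl _) (Iso.refl _)
    (by rw [hea]; simp) (by rw [heb]; simp) (by simp [ps]) (by simp [pp])

end DSch

/-! ### Groupoids and Picard-Vessiot morphisms -/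

namespace Precat

variable {C : Type u₁} [Category.{v₁} C]

/-- An internal equivalence relation is a groupoid. -/
lemma IsGroupoid.of_hom_ext {G : Precat C} (hG : IsPullback G.r₀ G.r₁ G.d₁ G.d₀)
    (ext : ∀ {T : C} {a b : T ⟶ G.C₁}, a ≫ G.d₀ = b ≫ G.d₀ → a ≫ G.d₁ = b ≫ G.d₁ → a = b)
    (i : G.C₁ ⟶ G.C₁) (h₀ : i ≫ G.d₀ = G.d₁) (h₁ : i ≫ G.d₁ = G.d₀) : G.IsGroupoid where
  isPullback := hG
  id_comp {T} a c e₀ e₁ := by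
    refine ext ?_ ?_
    · rw [Category.assoc, G.m_d₀, reassoc_of% e₀, G.n_d₀, Category.comp_id]
    · rw [Category.assoc, G.m_d₁, reassoc_of% e₁]
  comp_id {T} a c e₀ e₁ := by
    refine ext ?_ ?_
    · rw [Category.assoc, G.m_d₀, reassoc_of% e₀]
    · rw [Category.assoc, G.m_d₁, reassoc_of% e₁, G.n_d₁, Category.comp_id]
  assoc {T} p q s t h hs₀ hs₁ ht₀ ht₁ := by
    refine ext ?_ ?_
    · rw [Category.assoc, Category.assoc, G.m_d₀, reassoc_of% hs₀, reassoc_of% ht₀, G.m_d₀]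
    · rw [Category.assoc, Category.assoc, G.m_d₁, reassoc_of% hs₁, reassoc_of% ht₁, G.m_d₁]
  inverse := by
    have l₀ := hG.lift_fst (𝟙 _) i (by rw [h₀, Category.id_comp])
    have l₁ := hG.lift_snd (𝟙 _) i (by rw [h₀, Category.id_comp])
    have r₀ := hG.lift_fst i (𝟙 _) (by rw [h₁, Category.id_comp])
    have r₁ := hG.lift_snd i (𝟙 _) (by rw [h₁, Category.id_comp])
    refine ⟨i, _, _, h₀, h₁, ⟨l₀, l₁, ext ?_ ?_⟩, ⟨r₀, r₁, ext ?_ ?_⟩⟩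
    · rw [Category.assoc, G.m_d₀, reassoc_of% l₀, Category.assoc, G.n_d₀, Category.comp_id]
    · rw [Category.assoc, G.m_d₁, reassoc_of% l₁, h₁, Category.assoc, G.n_d₁, Category.comp_id]
    · rw [Category.assoc, G.m_d₀, reassoc_of% r₀, h₀, Category.assoc, G.n_d₀, Category.comp_id]
    · rw [Category.assoc, G.m_d₁, reassoc_of% r₁, Category.assoc, G.n_d₁, Category.comp_id]

lemma kernel_isGroupoid [HasPullbacks C] {X Y : C} (f : X ⟶ Y) : (kernel f).IsGroupoid :=
  IsGroupoid.of_hom_ext (IsPullback.of_hasPullback (pullback.snd f f) (pullback.fst f f))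
    (fun h₀ h₁ => pullback.hom_ext h₀ h₁)
    (pullback.lift (pullback.snd f f) (pullback.fst f f) pullback.condition.symm)
    (pullback.lift_fst _ _ _) (pullback.lift_snd _ _ _)

lemma IsGroupoid.lift {G : Precat C} (hG : G.IsGroupoid) (P : ObjectProperty C) (h₀ : P G.C₀)
    (h₁ : P G.C₁) (h₂ : P G.C₂) : (G.lift P h₀ h₁ h₂).IsGroupoid where
  isPullback := IsPullback.of_map P.ι (ObjectProperty.hom_ext _ G.r₁_d₀.symm) hG.isPullback
  id_comp {T} a c e₀ e₁ := ObjectProperty.hom_ext _ <|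
    hG.id_comp a.hom c.hom (congrArg (·.hom) e₀) (congrArg (·.hom) e₁)
  comp_id {T} a c e₀ e₁ := ObjectProperty.hom_ext _ <|
    hG.comp_id a.hom c.hom (congrArg (·.hom) e₀) (congrArg (·.hom) e₁)
  assoc {T} p q s t e e₀ e₁ e₂ e₃ := ObjectProperty.hom_ext _ <|
    hG.assoc p.hom q.hom s.hom t.hom (congrArg (·.hom) e) (congrArg (·.hom) e₀)
      (congrArg (·.hom) e₁) (congrArg (·.hom) e₂) (congrArg (·.hom) e₃)
  inverse := by
    obtain ⟨i, l, r, a, b, ⟨c, d, e⟩, c', d', e'⟩ := hG.inverse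
    refine ⟨ObjectProperty.homMk i, ObjectProperty.homMk l, ObjectProperty.homMk r, ?_, ?_,
      ⟨?_, ?_, ?_⟩, ?_, ?_, ?_⟩ <;> refine ObjectProperty.hom_ext _ ?_ <;> assumption

/-- It suffices to check the groupoid axioms on the universal arrow and on the universal triple of
composable arrows. -/
lemma IsGroupoid.of_universal {G : Precat C} (hG : IsPullback G.r₀ G.r₁ G.d₁ G.d₀)
    (hl : ∃ k : G.C₁ ⟶ G.C₂, k ≫ G.r₀ = G.d₀ ≫ G.n ∧ k ≫ G.r₁ = 𝟙 _ ∧ k ≫ G.m = 𝟙 _)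
    (hr : ∃ k : G.C₁ ⟶ G.C₂, k ≫ G.r₀ = 𝟙 _ ∧ k ≫ G.r₁ = G.d₁ ≫ G.n ∧ k ≫ G.m = 𝟙 _)
    {E : C} {x y : E ⟶ G.C₂} (hE : IsPullback x y G.r₁ G.r₀)
    (ha : ∃ k l : E ⟶ G.C₂, k ≫ G.r₀ = x ≫ G.m ∧ k ≫ G.r₁ = y ≫ G.r₁ ∧
      l ≫ G.r₀ = x ≫ G.r₀ ∧ l ≫ G.r₁ = y ≫ G.m ∧ k ≫ G.m = l ≫ G.m)
    (hi : ∃ (i : G.C₁ ⟶ G.C₁) (l r : G.C₁ ⟶ G.C₂), i ≫ G.d₀ = G.d₁ ∧ i ≫ G.d₁ = G.d₀ ∧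
      (l ≫ G.r₀ = 𝟙 _ ∧ l ≫ G.r₁ = i ∧ l ≫ G.m = G.d₀ ≫ G.n) ∧
      (r ≫ G.r₀ = i ∧ r ≫ G.r₁ = 𝟙 _ ∧ r ≫ G.m = G.d₁ ≫ G.n)) : G.IsGroupoid where
  isPullback := hG
  id_comp {T} a c e₀ e₁ := by
    obtain ⟨k, k₀, k₁, hk⟩ := hl
    obtain rfl : c = a ≫ k := hG.hom_ext (by rw [Category.assoc, k₀, e₀])
      (by rw [Category.assoc, k₁, e₁, Category.comp_id])
    rw [Category.assoc, hk, Category.comp_id]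
  comp_id {T} a c e₀ e₁ := by
    obtain ⟨k, k₀, k₁, hk⟩ := hr
    obtain rfl : c = a ≫ k := hG.hom_ext (by rw [Category.assoc, k₀, e₀, Category.comp_id])
      (by rw [Category.assoc, k₁, e₁])
    rw [Category.assoc, hk, Category.comp_id]
  assoc {T} p q s t h hs₀ hs₁ ht₀ ht₁ := by
    obtain ⟨k, l, k₀, k₁, l₀, l₁, hkl⟩ := ha
    have hp : hE.lift p q h ≫ x = p := hE.lift_fst p q h
    have hq : hE.lift p q h ≫ y = q := hE.lift_snd p q h
    obtain rfl : s = hE.lift p q h ≫ k := hG.hom_ext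
      (by rw [Category.assoc, k₀, reassoc_of% hp, hs₀])
      (by rw [Category.assoc, k₁, reassoc_of% hq, hs₁])
    obtain rfl : t = hE.lift p q h ≫ l := hG.hom_ext
      (by rw [Category.assoc, l₀, reassoc_of% hp, ht₀])
      (by rw [Category.assoc, l₁, reassoc_of% hq, ht₁])
    rw [Category.assoc, Category.assoc, hkl]
  inverse := hi

/-- A functor that preserves the objects of composable pairs and of composable triples of an
internal groupoid sends it to a groupoid. -/
lemma IsGroupoid.mapFunctor {D : Type*} [Category* D] {G : Precat C} (hG : G.IsGroupoid)
    (F : C ⥤ D) (h₂ : IsPullback (F.map G.r₀) (F.map G.r₁) (F.map G.d₁) (F.map G.d₀)) {E : C}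
    {x y : E ⟶ G.C₂} (hxy : x ≫ G.r₁ = y ≫ G.r₀)
    (h₃ : IsPullback (F.map x) (F.map y) (F.map G.r₁) (F.map G.r₀)) :
    (G.mapFunctor F).IsGroupoid := by
  have map_eq {A B B' D : C} {a : A ⟶ B} {b : B ⟶ D} {c : A ⟶ B'} {d : B' ⟶ D}
      (h : a ≫ b = c ≫ d) : F.map a ≫ F.map b = F.map c ≫ F.map d := by
    rw [← F.map_comp, ← F.map_comp, h]
  have map_eq' {A B D : C} {a : A ⟶ B} {b : B ⟶ D} {c : A ⟶ D} (h : a ≫ b = c) :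
      F.map a ≫ F.map b = F.map c := by
    rw [← F.map_comp, h]
  have map_id {A B : C} {a : A ⟶ B} {b : B ⟶ A} (h : a ≫ b = 𝟙 _) :
      F.map a ≫ F.map b = 𝟙 _ := by
    rw [← F.map_comp, h, CategoryTheory.Functor.map_id]
  refine IsGroupoid.of_universal h₂ ?_ ?_ h₃ ?_ ?_
  · have k₀ := hG.isPullback.lift_fst (G.d₀ ≫ G.n) (𝟙 _) (by simp [G.n_d₁])
    have k₁ := hG.isPullback.lift_snd (G.d₀ ≫ G.n) (𝟙 _) (by simp [G.n_d₁])
    exact ⟨F.map _, map_eq k₀, map_id k₁,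
      map_id (hG.id_comp (𝟙 _) _ (by rw [k₀, Category.id_comp]) k₁)⟩
  · have k₀ := hG.isPullback.lift_fst (𝟙 _) (G.d₁ ≫ G.n) (by simp [G.n_d₀])
    have k₁ := hG.isPullback.lift_snd (𝟙 _) (G.d₁ ≫ G.n) (by simp [G.n_d₀])
    exact ⟨F.map _, map_id k₀, map_eq k₁,
      map_id (hG.comp_id (𝟙 _) _ k₀ (by rw [k₁, Category.id_comp]))⟩
  · have hk : (x ≫ G.m) ≫ G.d₁ = (y ≫ G.r₁) ≫ G.d₀ := by
      rw [Category.assoc, Category.assoc, G.m_d₁, reassoc_of% hxy, G.r₁_d₀]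
    have hl : (x ≫ G.r₀) ≫ G.d₁ = (y ≫ G.m) ≫ G.d₀ := by
      rw [Category.assoc, Category.assoc, G.m_d₀, ← reassoc_of% hxy, G.r₁_d₀]
    have k₀ := hG.isPullback.lift_fst _ _ hk
    have k₁ := hG.isPullback.lift_snd _ _ hk
    have l₀ := hG.isPullback.lift_fst _ _ hl
    have l₁ := hG.isPullback.lift_snd _ _ hl
    exact ⟨F.map _, F.map _, map_eq k₀, map_eq k₁, map_eq l₀, map_eq l₁,
      map_eq (hG.assoc x y _ _ hxy k₀ k₁ l₀ l₁)⟩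
  · obtain ⟨i, l, r, a, b, ⟨c, d, e⟩, c', d', e'⟩ := hG.inverse
    exact ⟨F.map i, F.map l, F.map r, map_eq' a, map_eq' b, ⟨map_id c, map_eq' d, map_eq e⟩,
      map_eq' c', map_id d', map_eq e'⟩

end Precat

namespace DSch

variable {S : Scheme.{u}} {W : MorphismProperty (Over S)} [W.IsStableUnderBaseChange]
  [W.IsStableUnderComposition] {P : Pseudofunctor (LocallyDiscrete (Over S)ᵒᵖ) Cat.{u, u + 1}}
  {U : Pseudofunctor.StrongTrans P (selfIndexing W)} {X Y : DSch S} {f : X ⟶ Y}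

/-- The first projection `X ×_Y X ⟶ X` is split over `X`; this is auto-splitness, rephrased by
means of the scheme of leaves of `X ×_Y X`. -/
lemma IsPicardVessiot.exists_isSplit (h : IsPicardVessiot W P f) :
    ∃ (h₁ : IsSimpleFor W (Precat.kernel f).C₁),
      IsSplit W (Precat.kernel f).d₀ h₁.hasLeaves h.simple.hasLeaves := by
  obtain ⟨-, G, g, t, hg, ht⟩ := h.autoSplit
  obtain ⟨h₁, hs, -⟩ := h.simple.isSplit_of_isPullback W hg ht
  exact ⟨h₁, hs⟩

/-- `X ×_Y X ×_Y X` is the base change of the split morphism `d₀ : X ×_Y X ⟶ X` along `d₁`, so that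
it is simple and split over `X ×_Y X`, and `π₀` preserves this fibre product. -/
lemma IsPicardVessiot.exists_isSplit₂ (h : IsPicardVessiot W P f) :
    ∃ (h₁ : IsSimpleFor W (Precat.kernel f).C₁) (h₂ : IsSimpleFor W (Precat.kernel f).C₂),
      IsSplit W (Precat.kernel f).r₀ h₂.hasLeaves h₁.hasLeaves ∧
      IsPullback (leavesMap h₂.hasLeaves h₁.hasLeaves (Precat.kernel f).r₀)
        (leavesMap h₂.hasLeaves h₁.hasLeaves (Precat.kernel f).r₁)
        (leavesMap h₁.hasLeaves h.leaves_source (Precat.kernel f).d₁)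
        (leavesMap h₁.hasLeaves h.leaves_source (Precat.kernel f).d₀) := by
  obtain ⟨h₁, hs⟩ := h.exists_isSplit
  obtain ⟨h₂, hs₂, hp⟩ := hs.baseChange W h₁ (Precat.kernel_isGroupoid f).isPullback
  exact ⟨h₁, h₂, hs₂, hp⟩

lemma IsPicardVessiot.isPrePicardVessiot (h : IsPicardVessiot W P f)
    (hU : ReflectsUniversalCoeq W U) : IsPrePicardVessiot P f := by
  obtain ⟨h₁, h₂, -⟩ := h.exists_isSplit₂
  exact ⟨h.leaves_source, h.leaves_target, h.effectiveDescent, h.simple.isSimple W U hU,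
    h₁.isSimple W U hU, h₂.isSimple W U hU⟩

lemma IsPicardVessiot.gal_isGroupoid (h : IsPicardVessiot W P f) (h' : IsPrePicardVessiot P f) :
    (gal h').IsGroupoid := by
  obtain ⟨h₁, h₂, hs₂, hp⟩ := h.exists_isSplit₂
  -- The object of composable triples is split over `X ×_Y X ×_Y X` in the same way.
  obtain ⟨h₃, -, hp₃⟩ := hs₂.baseChange W h₂
    (IsPullback.of_hasPullback (Precat.kernel f).r₁ (Precat.kernel f).r₀)
  refine ((Precat.kernel_isGroupoid f).lift _ h'.simple₀.hasLeaves h'.simple₁.hasLeaves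
    h'.simple₂.hasLeaves).mapFunctor (const S).partialLeftAdjoint hp (E := ⟨_, h₃.hasLeaves⟩)
    (x := ObjectProperty.homMk (pullback.fst _ _)) (y := ObjectProperty.homMk (pullback.snd _ _))
    (ObjectProperty.hom_ext _ pullback.condition) hp₃

end DSch

end DiffGalois

theorem theorem5p8 (S : AlgebraicGeometry.Scheme.{u}) {X Y : DiffGalois.DSch S} (f : X ⟶ Y) :
    (∀ (P : Pseudofunctor (LocallyDiscrete (Over S)ᵒᵖ) Cat.{v, w})
      (h : DiffGalois.DSch.IsPrePicardVessiot P f), DiffGalois.DSch.GaloisEquivalence h) ∧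
    (∀ (W : MorphismProperty (Over S)) [W.IsStableUnderBaseChange] [W.IsStableUnderComposition]
      (P : Pseudofunctor (LocallyDiscrete (Over S)ᵒᵖ) Cat.{u, u + 1})
      (U : Pseudofunctor.StrongTrans P (DiffGalois.selfIndexing W)),
      DiffGalois.DSch.IsFaithful W U → DiffGalois.DSch.ReflectsUniversalCoeq W U →
      DiffGalois.DSch.IsPicardVessiot W P f →
      ∃ h : DiffGalois.DSch.IsPrePicardVessiot P f,
        DiffGalois.DSch.GaloisEquivalence h ∧ (DiffGalois.DSch.gal h).IsGroupoid) := by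
  refine ⟨fun P h => DiffGalois.DSch.galoisEquivalence h, fun W _ _ P U _ hU hf => ?_⟩
  have h := hf.isPrePicardVessiot hU
  exact ⟨h, DiffGalois.DSch.galoisEquivalence h, hf.gal_isGroupoid h⟩
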